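/- **Conventions.** A labeled graph of size $n$ is a finite simple graph whose vertices carry the labels $1,\dots,n$; labeled graphs are identified when they are isomorphic by a label-preserving map. *Reducing* labels means replacing them by $1,2,\dots$ while preserving their order. A module of $G$ is a set $M$ of vertices such that every vertex outside $M$ is adjacent to all or to none of the vertices of $M$; $G$ is prime if it has at least $3$ vertices and its only modules are $\emptyset$, the singletons and the whole vertex set. For labeled graphs $G,H$, $\mathrm{Occ}_G(H)$ is the number of partial injections $\mathfrak I$ from the labels of $H$ to $\mathbb N$ such that the subgraph of $H$ induced by the domain of $\mathfrak I$, relabeled by $\mathfrak I$, is $G$. **Trees.** A *substitution tree* is a rooted non-plane tree $t$ whose leaves are labeled bijectively by $\{1,\dots,|t|\}$, where $|t|$ (the size) is the number of leaves, and in which every internal node has $k\ge 2$ children and is decorated with a labeled graph of size $k$. The children of a node are ordered by their minimal leaf labels, the $i$-th child corresponding to the vertex labeled $i$ of the decoration. The decoration is written $\oplus$ if it is a complete graph and $\ominus$ if it has no edge; such nodes are called linear, the others non-linear. Let $\mathcal P$ be a set of prime labeled graphs stable by relabeling. $\mathcal T_{\mathcal P}$ is the set of substitution trees all of whose non-linear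 nodes are decorated with elements of $\mathcal P$ and in which no node decorated with $\oplus$ (resp. $\ominus$) has a child decorated with $\oplus$ (resp. $\ominus$). *Blossoming* a tree $t\in\mathcal T_{\mathcal P}$ at a leaf $\ell$ means: for every internal node on the path from the root to $\ell$, the label of the vertex of its decoration corresponding to the child containing $\ell$ is replaced by $*$ and the other labels of the decoration are reduced; then $\ell$ itself becomes an unlabeled blossom and the other leaf labels are reduced. A *blossomed tree* is a tree so obtained; its size is its number of leaves other than the blossom. Its blossom is $\oplus$-replaceable (resp. $\ominus$-replaceable) if it has no parent decorated with $\oplus$ (resp. $\ominus$). **Series.** All series are formal power series and exponential generating functions with respect to size. - $T$: trees of $\mathcal T_{\mathcal P}$; $T_{\mathrm{not}\oplus}$: those whose root is not decorated with $\oplus$. $T'$ and $T'_{\mathrm{not}\oplus}$ are their derivatives. - $T^{\mathsf{blo}}$: blossomed trees; $T^{\oplus}$: those whose blossom is $\oplus$-replaceable. - $T^{\mathsf{blo}}_{\mathrm{not}\oplus}$, $T^{\oplus}_{\mathrm{not}\oplus}$, $T^{\ominus}_{\mathrm{not}\oplus}$: blossomed trees whose root is not decorated with $\oplus$, respectively with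 no further condition, with $\oplus$-replaceable blossom, with $\ominus$-replaceable blossom; by convention the tree reduced to its blossom is counted in $T^{\mathsf{blo}}_{\mathrm{not}\oplus}$ and $T^{\ominus}_{\mathrm{not}\oplus}$ but not in $T^{\oplus}_{\mathrm{not}\oplus}$. - For a labeled graph $G$, $\mathrm{Occ}_{G,\mathcal P}(z)=\sum_{H\in\mathcal P}\mathrm{Occ}_G(H)\,\dfrac{z^{|H|-|G|}}{|H|!}$. **Induced trees.** A marked tree is a pair $(t,\mathfrak I)$ where $\mathfrak I$ is a partial injection from the leaf labels of $t$ to $\mathbb N$; the leaves in its domain are marked, the mark of $\ell$ being $\mathfrak I(\ell)$. The induced tree $t_{\mathfrak I}$ has as leaves the marked leaves, labeled by their marks, and as internal nodes the first common ancestors in $t$ of two or more marked leaves, with the inherited ancestor relation; the decoration of an internal node $\mathfrak n$ of $t_{\mathfrak I}$ is the subgraph of its decoration in $t$ induced by the children containing a marked leaf, these being relabeled $1,2,\dots$ by increasing minimal mark. Let $\phi(\mathfrak n)$ be the node of $t$ corresponding to $\mathfrak n$, and let $\mathcal N(t,\mathfrak I)$ be the set of internal nodes $\mathfrak n$ of $t_{\mathfrak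 I}$ such that $\phi(\mathfrak n)$ is non-linear in $t$. **Theorem.** Let $\tau$ be a substitution tree of size at least $2$, let $\mathfrak N$ be a set of internal nodes of $\tau$ containing every non-linear node of $\tau$, and let $\overline{\mathfrak N}$ be the set of the other internal nodes of $\tau$. Let $T_{\tau,\mathfrak N}$ be the exponential generating function, counted by the total number of leaves of $t$, of the marked trees $(t,\mathfrak I)$ such that $t\in\mathcal T_{\mathcal P}$, $t_{\mathfrak I}=\tau$ (as non-plane decorated trees with labeled leaves) and $\mathcal N(t,\mathfrak I)=\mathfrak N$. Then $$\begin{aligned} T_{\tau,\mathfrak N}={}&z^{|\tau|}\,T^{\mathrm{root}}\,(T^{\oplus}_{\mathrm{not}\oplus})^{d_{=}}\,(T^{\ominus}_{\mathrm{not}\oplus})^{d_{\neq}}\,(T^{\mathsf{blo}}_{\mathrm{not}\oplus})^{d_{\overline{\mathfrak N}\to\mathfrak N}}\,(T'_{\mathrm{not}\oplus})^{d_{\overline{\mathfrak N}\to\ell}}\,\exp(n_L\,T_{\mathrm{not}\oplus})\\ &\times (T^{\oplus})^{d_{\mathfrak N\to\overline{\mathfrak N}}}\,(T^{\mathsf{blo}})^{d_{\mathfrak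 N\to\mathfrak N}}\,(T')^{d_{\mathfrak N\to\ell}}\prod_{\mathfrak n\in\mathfrak N}\mathrm{Occ}_{\mathrm{dec}(\mathfrak n),\mathcal P}(T), \end{aligned}$$ where $d_{=}$ (resp. $d_{\neq}$) is the number of edges of $\tau$ between two nodes of $\overline{\mathfrak N}$ with the same decoration (both $\oplus$ or both $\ominus$) (resp. with different decorations, $\oplus$ and $\ominus$); for $A,B\in\{\mathfrak N,\overline{\mathfrak N}\}$, $d_{A\to B}$ is the number of edges of $\tau$ from a node of $A$ to one of its children in $B$, and $d_{A\to\ell}$ is the number of edges from a node of $A$ to a leaf; $n_L=|\overline{\mathfrak N}|$; $\mathrm{dec}(\mathfrak n)$ is the decoration of $\mathfrak n$ in $\tau$; and $T^{\mathrm{root}}=T^{\mathsf{blo}}$ if the root of $\tau$ is in $\mathfrak N$, $T^{\mathrm{root}}=T^{\oplus}$ otherwise. -/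

import Mathlib

open scoped PowerSeries

namespace ModDec

noncomputable section

/-! ### Graphs

A labeled graph of size `n` is a `SimpleGraph (Fin n)`; the vertex `i : Fin n` carries the label
`i + 1`. Equality in `SimpleGraph (Fin n)` is label preserving isomorphism. -/

/-- A module of a graph: every outside vertex sees all of `M` or nothing of `M`. -/
def IsModule {V : Type*} (G : SimpleGraph V) (M : Set V) : Prop :=
  ∀ x ∈ M, ∀ y ∈ M, ∀ z ∉ M, (G.Adj x z ↔ G.Adj y z)

/-- A graph is prime if it has at least three vertices and only trivial modules. -/
def IsPrime {n : ℕ} (G : SimpleGraph (Fin n)) : Prop :=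
  3 ≤ n ∧ ∀ M : Set (Fin n), IsModule G M → M = ∅ ∨ M = Set.univ ∨ ∃ v, M = {v}

/-- A class of labeled graphs, given by its members `P n` of each size `n`, is stable by
relabeling. -/
def StableByRelabeling (P : ∀ n : ℕ, Set (SimpleGraph (Fin n))) : Prop :=
  ∀ (n : ℕ) (π : Equiv.Perm (Fin n)) (G : SimpleGraph (Fin n)),
    G ∈ P n → G.map π.toEmbedding ∈ P n

/-- `Occ_G(H)`: the number of partial injections `I` from the labels of `H` to the integers such
that the labeled subgraph `H_I` is `G`. Such an `I` is the inverse of an embedding of `G` into `H`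
as an induced subgraph, and conversely. -/
def occ {k m : ℕ} (G : SimpleGraph (Fin k)) (H : SimpleGraph (Fin m)) : ℕ :=
  Nat.card (G ↪g H)

/-- `Occ_{G,P}(z) = ∑_{H ∈ P} Occ_G(H) z^(|H|-|G|) / |H|!`. (The terms with `|H| < |G|` vanish.) -/
def occSeries (P : ∀ n : ℕ, Set (SimpleGraph (Fin n))) {k : ℕ} (G : SimpleGraph (Fin k)) :
    ℚ⟦X⟧ :=
  PowerSeries.mk fun n =>
    (∑ᶠ H ∈ P (n + k), (occ G H : ℚ)) / ((n + k).factorial : ℚ)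

/-! ### Trees -/

/-- Rooted trees with leaves labeled by integers, whose internal nodes have at least two children
and are decorated with a graph on (the set of positions of) their children. The decoration `⊕` is
the complete graph `⊤` and the decoration `⊖` is the empty graph `⊥`. -/
inductive STree : Type
  | leaf (a : ℕ) : STree
  | node (n : ℕ) (G : SimpleGraph (Fin (n + 2))) (ts : Fin (n + 2) → STree) : STree

namespace STree

/-- The set of labels of the leaves. -/
def labels : STree → Finset ℕ
  | leaf a => {a}
  | node _ _ ts => Finset.univ.biUnion fun i => (ts i).labels

/-- The size of a tree: its number of leaves. -/
def size : STree → ℕ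
  | leaf _ => 1
  | node _ _ ts => ∑ i, (ts i).size

/-- Change the labels of the leaves. -/
def relabel (f : ℕ → ℕ) : STree → STree
  | leaf a => leaf (f a)
  | node n G ts => node n G fun i => (ts i).relabel f

/-- The leaves have distinct labels, and the children of every node are listed by increasing
minimal leaf label. With this convention each non-plane tree is represented exactly once (the
`i`-th vertex of the decoration being the `i`-th child), so that isomorphism of non-plane trees is
equality. -/
def WellFormed : STree → Prop
  | leaf _ => True
  | node _ _ ts =>
      (∀ i j, i ≠ j → Disjoint (ts i).labels (ts j).labels) ∧
      StrictMono (fun i => (ts i).labels.min) ∧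
      ∀ i, (ts i).WellFormed

/-- Substitution trees: the leaves have distinct labels forming the set `{1, …, |t|}`. -/
def IsSubstitutionTree (t : STree) : Prop :=
  t.WellFormed ∧ t.labels = Finset.Icc 1 t.size

/-- The root is an internal node decorated with `⊕`. -/
def RootOplus : STree → Prop
  | leaf _ => False
  | node _ G _ => G = ⊤

/-- The root is an internal node decorated with `⊖`. -/
def RootOminus : STree → Prop
  | leaf _ => False
  | node _ G _ => G = ⊥

/-- Every internal node is decorated with `⊕`, `⊖` or a graph of `P`, no child of a node decorated
with `⊕` is decorated with `⊕`, and no child of a node decorated with `⊖` is decorated with `⊖`. -/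
def IsDecomposition (P : ∀ n : ℕ, Set (SimpleGraph (Fin n))) : STree → Prop
  | leaf _ => True
  | node n G ts =>
      (G = ⊤ ∨ G = ⊥ ∨ G ∈ P (n + 2)) ∧
      (G = ⊤ → ∀ i, ¬ (ts i).RootOplus) ∧
      (G = ⊥ → ∀ i, ¬ (ts i).RootOminus) ∧
      ∀ i, (ts i).IsDecomposition P

/-! Nodes are addressed by lists of integers: `[]` is the root, and `i :: p` is the node `p` of the
`i`-th tree (counted from `0`) attached to the root. -/

/-- The subtree `t[p]` rooted at the node `p`, if there is such a node. -/
def subtreeAt : STree → List ℕ → Option STree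
  | t, [] => some t
  | leaf _, _ :: _ => none
  | node n _ ts, i :: p => if h : i < n + 2 then (ts ⟨i, h⟩).subtreeAt p else none

/-- The internal nodes. -/
def internalNodes (t : STree) : Set (List ℕ) :=
  {p | ∃ n G ts, t.subtreeAt p = some (node n G ts)}

/-- The leaves, as nodes. -/
def leafNodes (t : STree) : Set (List ℕ) :=
  {p | ∃ a, t.subtreeAt p = some (leaf a)}

/-- The internal nodes decorated with `⊕`. -/
def oplusNodes (t : STree) : Set (List ℕ) :=
  {p | ∃ s, t.subtreeAt p = some s ∧ s.RootOplus}

/-- The internal nodes decorated with `⊖`. -/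
def ominusNodes (t : STree) : Set (List ℕ) :=
  {p | ∃ s, t.subtreeAt p = some s ∧ s.RootOminus}

/-- The non-linear nodes: the internal nodes decorated neither with `⊕` nor with `⊖`. -/
def nonlinearNodes (t : STree) : Set (List ℕ) :=
  t.internalNodes \ (t.oplusNodes ∪ t.ominusNodes)

/-- The decoration of the internal node `p` (and a default value if `p` is not one). -/
def dec (t : STree) (p : List ℕ) : Σ k : ℕ, SimpleGraph (Fin k) :=
  match t.subtreeAt p with
  | some (node n G _) => ⟨n + 2, G⟩
  | _ => ⟨0, ⊥⟩

/-! ### Marked trees and induced subtrees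

A partial injection from labels to integers is a `PEquiv ℕ ℕ`. -/

/-- The set of the marks `I(ℓ)` of the marked leaves `ℓ` of `t`. -/
def marks (I : ℕ ≃. ℕ) (t : STree) : Finset ℕ :=
  t.labels.biUnion fun a => (I a).toFinset

/-- The positions of the trees of the family `ts` that contain a marked leaf. -/
def markedChildren (I : ℕ ≃. ℕ) {m : ℕ} (ts : Fin m → STree) : Finset (Fin m) :=
  Finset.univ.filter fun i => (marks I (ts i)).Nonempty

/-- The positions of the trees of the family `ts` that contain a marked leaf, enumerated by
increasing minimal mark. -/
def markedOrder (I : ℕ ≃. ℕ) {m : ℕ} (ts : Fin m → STree) {k : ℕ}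
    (h : (markedChildren I ts).card = k) : Fin k → Fin m :=
  let e : Fin k → Fin m := (markedChildren I ts).orderEmbOfFin h
  e ∘ Tuple.sort fun j => (marks I (ts (e j))).min

/-- The subtree `t_I` induced by the marked leaves. A node of `t` survives if at least two of
its subtrees contain a marked leaf, that is, if it is the first common ancestor of two marked
leaves; its new children are listed by increasing minimal mark, and its new decoration is the
decoration in `t` induced on the surviving children, in this order. A surviving leaf is relabeled
by its mark. (The value is the arbitrary `leaf 0` if no leaf is marked.) -/
def induced (I : ℕ ≃. ℕ) : STree → STree
  | leaf a => leaf ((I a).getD 0)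
  | node _ G ts =>
      if h : 2 ≤ (markedChildren I ts).card then
        let σ := markedOrder I ts (k := (markedChildren I ts).card - 2 + 2) (by omega)
        node ((markedChildren I ts).card - 2) (G.comap σ) fun j => (ts (σ j)).induced I
      else if h1 : (markedChildren I ts).Nonempty then
        (ts ((markedChildren I ts).min' h1)).induced I
      else leaf 0

/-- The node `φ(p)` of `t` that corresponds to the node `p` of the induced subtree `t_I`. -/
def phi (I : ℕ ≃. ℕ) : STree → List ℕ → List ℕ
  | leaf _ => fun _ => []
  | node _ _ ts => fun p =>
      if h : 2 ≤ (markedChildren I ts).card then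
        let σ := markedOrder I ts (k := (markedChildren I ts).card - 2 + 2) (by omega)
        match p with
        | [] => []
        | j :: q =>
            if hj : j < (markedChildren I ts).card - 2 + 2 then
              (σ ⟨j, hj⟩ : ℕ) :: (ts (σ ⟨j, hj⟩)).phi I q
            else []
      else if h1 : (markedChildren I ts).Nonempty then
        ((markedChildren I ts).min' h1 : ℕ) :: (ts ((markedChildren I ts).min' h1)).phi I p
      else []

/-- `𝒩(t, I)`: the internal nodes `p` of `t_I` such that `φ(p)` is non-linear. -/
def nonlinearOrigin (I : ℕ ≃. ℕ) (t : STree) : Set (List ℕ) :=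
  {p | p ∈ (t.induced I).internalNodes ∧ t.phi I p ∈ t.nonlinearNodes}

end STree

open STree

/-- `𝒯_P`: the modular decomposition trees all of whose nodes are linear or decorated by an element
of `P` (where `P` is a class of prime graphs). -/
def treeClass (P : ∀ n : ℕ, Set (SimpleGraph (Fin n))) : Set STree :=
  {t | t.IsSubstitutionTree ∧ t.IsDecomposition P}

/-- The marked trees `(t, I)` with `t ∈ 𝒯_P`, with `t_I = τ` and with `𝒩(t, I) = N`. -/
def markedTreeClass (P : ∀ n : ℕ, Set (SimpleGraph (Fin n))) (τ : STree) (N : Set (List ℕ)) :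
    Set (STree × (ℕ ≃. ℕ)) :=
  {x | x.1 ∈ treeClass P ∧ (∀ a, (x.2 a).isSome → a ∈ x.1.labels) ∧
    x.1.induced x.2 = τ ∧ x.1.nonlinearOrigin x.2 = N}

/-- The number of edges from a node in `A` to one of its children in `B`. -/
def numEdges (A B : Set (List ℕ)) : ℕ :=
  {e : List ℕ × List ℕ | e.1 ∈ A ∧ e.2 ∈ B ∧ ∃ i, e.2 = e.1 ++ [i]}.ncard

/-! ### Blossomed trees -/

/-- Trees with one blossom. A node above the blossom has the child `b` containing the blossom,
which corresponds to the vertex `none` (labeled `*`) of its decoration, and at least one other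
child; the other children correspond to the labels `1, …, n + 1` of the decoration. -/
inductive BTree : Type
  | blossom : BTree
  | node (n : ℕ) (G : SimpleGraph (Option (Fin (n + 1)))) (b : BTree) (ts : Fin (n + 1) → STree) :
      BTree

namespace BTree

/-- The labels of the leaves other than the blossom. -/
def labels : BTree → Finset ℕ
  | blossom => ∅
  | node _ _ b ts => b.labels ∪ Finset.univ.biUnion fun i => (ts i).labels

/-- The size of a blossomed tree: its number of leaves without the blossom. -/
def size : BTree → ℕ
  | blossom => 0
  | node _ _ b ts => b.size + ∑ i, (ts i).size

/-- Change the labels of the leaves. -/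
def relabel (f : ℕ → ℕ) : BTree → BTree
  | blossom => blossom
  | node n G b ts => node n G (b.relabel f) fun i => (ts i).relabel f

/-- Reduction: the labels are replaced by `1, 2, …` in an order preserving way. -/
def reduce (b : BTree) : BTree :=
  b.relabel fun x => (b.labels.filter (· ≤ x)).card

/-- The root is an internal node decorated with `⊕`. -/
def RootOplus : BTree → Prop
  | blossom => False
  | node _ G _ _ => G = ⊤

/-- The blossom is `⊕`-replaceable: it has no parent decorated with `⊕`. -/
def OplusReplaceable : BTree → Prop
  | blossom => True
  | node _ G blossom _ => G ≠ ⊤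
  | node _ _ (node n G b ts) _ => OplusReplaceable (node n G b ts)

/-- The blossom is `⊖`-replaceable: it has no parent decorated with `⊖`. -/
def OminusReplaceable : BTree → Prop
  | blossom => True
  | node _ G blossom _ => G ≠ ⊥
  | node _ _ (node n G b ts) _ => OminusReplaceable (node n G b ts)

end BTree

/-- The leaf labeled `a` of the tree becomes the blossom; in the decoration of each node above it
the label `i` of the child containing the leaf becomes `*`, and the other labels are reduced. -/
def STree.blossomAt (a : ℕ) : STree → BTree
  | .leaf _ => .blossom
  | .node n G ts =>
      if h : (Finset.univ.filter fun i => a ∈ (ts i).labels).Nonempty then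
        let i := (Finset.univ.filter fun i => a ∈ (ts i).labels).min' h
        .node n (G.comap (finSuccEquiv' i).symm) ((ts i).blossomAt a) fun j => ts (i.succAbove j)
      else .blossom

/-- The blossoming of `(t, a)`, where `a` is (the label of) a leaf of `t`. -/
def STree.blossoming (a : ℕ) (t : STree) : BTree := (t.blossomAt a).reduce

/-- Blossomed trees: those obtained by blossoming a tree of `𝒯_P`. -/
def blossomedClass (P : ∀ n : ℕ, Set (SimpleGraph (Fin n))) : Set BTree :=
  {b | ∃ t ∈ treeClass P, ∃ a ∈ t.labels, b = t.blossoming a}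

/-! ### Generating series -/

/-- The exponential generating function of a combinatorial class, with respect to `size`. All the
classes considered below have finitely many elements of each size. -/
def egf {α : Type*} (size : α → ℕ) (C : Set α) : ℚ⟦X⟧ :=
  PowerSeries.mk fun n => ({x ∈ C | size x = n}.ncard : ℚ) / (n.factorial : ℚ)

section Series

variable (P : ∀ n : ℕ, Set (SimpleGraph (Fin n)))

/-- `T`. -/
def serT : ℚ⟦X⟧ := egf STree.size (treeClass P)

/-- `T_{not⊕}`: trees whose root is not decorated with `⊕`. -/
def serTnotOplus : ℚ⟦X⟧ := egf STree.size {t ∈ treeClass P | ¬ t.RootOplus}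

/-- `T^blo`: blossomed trees. -/
def serTblo : ℚ⟦X⟧ := egf BTree.size (blossomedClass P)

/-- `T^⊕`: blossomed trees with an `⊕`-replaceable blossom. -/
def serToplus : ℚ⟦X⟧ := egf BTree.size {b ∈ blossomedClass P | b.OplusReplaceable}

/-- `T_{not⊕}^blo`: blossomed trees whose root is not decorated with `⊕`. -/
def serTnotOplusBlo : ℚ⟦X⟧ := egf BTree.size {b ∈ blossomedClass P | ¬ b.RootOplus}

/-- `T_{not⊕}^⊕`: blossomed trees whose root is not decorated with `⊕`, with an `⊕`-replaceable
blossom; by convention the tree reduced to its blossom is excluded. -/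
def serTnotOplusOplus : ℚ⟦X⟧ :=
  egf BTree.size
    {b ∈ blossomedClass P | ¬ b.RootOplus ∧ b.OplusReplaceable ∧ b ≠ BTree.blossom}

/-- `T_{not⊕}^⊖`: blossomed trees whose root is not decorated with `⊕`, with a `⊖`-replaceable
blossom. -/
def serTnotOplusOminus : ℚ⟦X⟧ :=
  egf BTree.size {b ∈ blossomedClass P | ¬ b.RootOplus ∧ b.OminusReplaceable}

/-- `T_{τ,N}`, counted by the total number of leaves. -/
def serTtau (τ : STree) (N : Set (List ℕ)) : ℚ⟦X⟧ :=
  egf (fun x => x.1.size) (markedTreeClass P τ N)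

end Series

end

end ModDec

namespace ModDec

noncomputable section

open Finset

/-! ### Labels and relabelings of trees -/

/-! The marked trees are not cut into pieces along the paths of `phi`. Their series is found as the
solution of a linear system that the blossomed series satisfy too.

Give every decomposition tree a weight that ignores labels. Let M, M⁺, M⁻ be the exponential series
of this weight over all trees, over those whose root is not ⊕, and over those whose root is not ⊖.
Put E = 1 + T = exp(T_not⊕) = exp(T_not⊖) and p = Occ_{•,P}(T), where • is the one-vertex graph. Let
the weight of t be the number of markings that induce τ with set of non-linear origins N. Either one
child of the root of t carries all the marks, and the same count recurs on that child, or the root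
of t is the origin of the root of τ, and the marked children form an occurrence of its decoration.
Distinguishing ⊕, ⊖ and prime roots (`weightSeries_rootWeight`) yields M = E M⁺ + s⁺, M = E M⁻ + s⁻,
M⁺ + M⁻ = (1 + p) M + s. The sources come from the second alternative and are products over the
children of the root of τ; exactly one of them is present. Elimination gives M (2 − E − pE) = s⁺ +
s⁻ + E s.

A blossomed tree of size n comes from n + 1 pairs (tree, leaf), so z times a blossomed series is the
series of the trees with one distinguished leaf (`X_mul_egf_blossomedClass`). These series solve the
same system with other sources, whence T^⊕ (2 − E − pE) = 1, T^blo = E T^⊕, T_not⊕^blo = T^⊕, E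
T_not⊕^⊕ = T^⊕ − 1, E T_not⊕^⊖ = T^⊕. Thus T^⊕ inverts the common denominator. A root of τ in N
contributes E T^⊕ = T^blo and an occurrence series. A linear root contributes T^⊕ and one factor E,
which is the source of exp(n_L T_not⊕). The series M⁺ and M⁻ give the factors below a linear parent.
Induction on τ (`weightSeries_markingWeight`) then gives a product over nodes and edges, and
`coreSeries_eq_closedSeries` collects its exponents. That the weight really counts markings is
`hasCard_markings`. -/

theorem min_image_lt_min_image {f : ℕ → ℕ} {U s t : Finset ℕ} (hf : StrictMonoOn f U)
    (hs : s ⊆ U) (ht : t ⊆ U) (htn : t.Nonempty) (h : s.min < t.min) :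
    (s.image f).min < (t.image f).min := by
  obtain ⟨b, hb⟩ := Finset.min_of_nonempty (htn.image f)
  obtain ⟨c, hc, rfl⟩ := Finset.mem_image.1 (Finset.mem_of_min hb)
  have hsn : s.Nonempty := by
    rw [Finset.nonempty_iff_ne_empty]
    rintro rfl
    simp at h
  obtain ⟨a, ha⟩ := Finset.min_of_nonempty hsn
  have hac : a < c := by
    have h1 := lt_of_lt_of_le h (Finset.min_le hc)
    rw [ha] at h1
    exact_mod_cast h1
  have h2 : (s.image f).min ≤ (f a : WithTop ℕ) :=
    Finset.min_le (Finset.mem_image_of_mem f (Finset.mem_of_min ha))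
  rw [hb]
  refine lt_of_le_of_lt h2 ?_
  exact WithTop.coe_lt_coe.2 (hf (hs (Finset.mem_of_min ha)) (ht hc) hac)

theorem min_ne_min_of_disjoint {s t : Finset ℕ} (hs : s.Nonempty) (h : Disjoint s t) :
    s.min ≠ t.min := by
  intro he
  obtain ⟨a, ha⟩ := Finset.min_of_nonempty hs
  exact Finset.disjoint_left.1 h (Finset.mem_of_min ha) (Finset.mem_of_min (he ▸ ha))

namespace STree

theorem labels_nonempty (t : STree) : t.labels.Nonempty := by
  induction t with
  | leaf a => simp [labels]
  | node n G ts ih =>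
    obtain ⟨a, ha⟩ := ih 0
    exact ⟨a, by simpa [labels] using ⟨0, ha⟩⟩

theorem labels_subset_node {n : ℕ} (G : SimpleGraph (Fin (n + 2))) (ts : Fin (n + 2) → STree)
    (i : Fin (n + 2)) : (ts i).labels ⊆ (node n G ts).labels :=
  Finset.subset_biUnion_of_mem (fun i => (ts i).labels) (Finset.mem_univ i)

theorem WellFormed.card_labels {t : STree} (h : t.WellFormed) : t.labels.card = t.size := by
  induction t with
  | leaf a => simp [labels, size]
  | node n G ts ih =>
    rw [labels, size, Finset.card_biUnion fun i _ j _ hij => h.1 i j hij]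
    exact Finset.sum_congr rfl fun i _ => ih i (h.2.2 i)

theorem labels_relabel (f : ℕ → ℕ) (t : STree) : (t.relabel f).labels = t.labels.image f := by
  induction t with
  | leaf a => simp [labels, relabel]
  | node n G ts ih =>
    simp only [labels, relabel, ih]
    rw [Finset.biUnion_image]

theorem relabel_relabel (f g : ℕ → ℕ) (t : STree) :
    (t.relabel f).relabel g = t.relabel fun x => g (f x) := by
  induction t with
  | leaf a => rfl
  | node n G ts ih => simp only [relabel, ih]

theorem relabel_eq_self {f : ℕ → ℕ} {t : STree} (h : ∀ a ∈ t.labels, f a = a) :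
    t.relabel f = t := by
  induction t with
  | leaf a => simp [relabel, h a (by simp [labels])]
  | node n G ts ih =>
    simp only [relabel]
    congr 1
    funext i
    exact ih i fun a ha => h a (labels_subset_node G ts i ha)

theorem WellFormed.relabel {f : ℕ → ℕ} {t : STree} (h : t.WellFormed)
    (hf : StrictMonoOn f t.labels) : (t.relabel f).WellFormed := by
  induction t with
  | leaf a => trivial
  | node n G ts ih =>
    refine ⟨fun i j hij => ?_, fun i j hij => ?_, fun i => ih i (h.2.2 i) (hf.mono ?_)⟩
    · rw [labels_relabel, labels_relabel, Finset.disjoint_left]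
      intro x hx hx'
      obtain ⟨a, ha, rfl⟩ := Finset.mem_image.1 hx
      obtain ⟨b, hb, hab⟩ := Finset.mem_image.1 hx'
      have := hf.injOn (labels_subset_node G ts j hb) (labels_subset_node G ts i ha) hab
      exact Finset.disjoint_left.1 (h.1 i j hij) ha (this ▸ hb)
    · simp only [labels_relabel]
      exact min_image_lt_min_image hf (labels_subset_node G ts i) (labels_subset_node G ts j)
        (labels_nonempty _) (h.2.1 hij)
    · exact_mod_cast labels_subset_node G ts i

@[simp]
theorem rootOplus_relabel (f : ℕ → ℕ) (t : STree) : (t.relabel f).RootOplus ↔ t.RootOplus := by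
  cases t <;> rfl

@[simp]
theorem rootOminus_relabel (f : ℕ → ℕ) (t : STree) :
    (t.relabel f).RootOminus ↔ t.RootOminus := by
  cases t <;> rfl

theorem isDecomposition_relabel (P : ∀ n : ℕ, Set (SimpleGraph (Fin n))) (f : ℕ → ℕ) (t : STree) :
    (t.relabel f).IsDecomposition P ↔ t.IsDecomposition P := by
  induction t with
  | leaf a => rfl
  | node n G ts ih => simp only [relabel, IsDecomposition, ih, rootOplus_relabel, rootOminus_relabel]

/-- The children of the root split the labels into at least two nonempty parts. Hence the arity is
bounded by the number of labels, every child lives on a proper subset, and strong induction on the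
label set applies. -/
theorem finite_wellFormed (A : Finset ℕ) : {t : STree | t.WellFormed ∧ t.labels = A}.Finite := by
  induction A using Finset.strongInduction with
  | H A ih =>
    have hsub : {t : STree | t.WellFormed ∧ t.labels = A} ⊆
        (leaf '' (A : Set ℕ)) ∪ ⋃ n ∈ Finset.range A.card,
          (fun x : SimpleGraph (Fin (n + 2)) × (Fin (n + 2) → STree) => node n x.1 x.2) ''
            (Set.univ ×ˢ Set.pi Set.univ fun _ => ⋃ B ∈ A.ssubsets,
              {t : STree | t.WellFormed ∧ t.labels = B}) := by
      rintro t ⟨hw, rfl⟩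
      cases t with
      | leaf a => left; exact ⟨a, by simp [labels], rfl⟩
      | node n G ts =>
        right
        have hcard : n < (node n G ts).labels.card := by
          rw [labels, Finset.card_biUnion fun i _ j _ hij => hw.1 i j hij]
          have : ∑ i : Fin (n + 2), 1 ≤ ∑ i, (ts i).labels.card :=
            Finset.sum_le_sum fun i _ => Finset.card_pos.2 (labels_nonempty _)
          simp at this
          omega
        refine Set.mem_biUnion (Finset.mem_coe.2 (Finset.mem_range.2 hcard))
          ⟨(G, ts), ⟨trivial, fun i _ => ?_⟩, rfl⟩
        refine Set.mem_biUnion (Finset.mem_coe.2 (Finset.mem_ssubsets.2 ?_)) ⟨hw.2.2 i, rfl⟩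
        refine Finset.ssubset_iff_subset_ne.2 ⟨labels_subset_node G ts i, fun he => ?_⟩
        obtain ⟨j, hj⟩ := exists_ne i
        obtain ⟨a, ha⟩ := labels_nonempty (ts j)
        have : a ∈ (ts i).labels := he ▸ labels_subset_node G ts j ha
        exact Finset.disjoint_left.1 (hw.1 j i hj) ha this
    refine Set.Finite.subset ?_ hsub
    refine ((Finset.finite_toSet A).image _).union ?_
    refine Set.Finite.biUnion (Finset.finite_toSet _) fun n _ => Set.Finite.image _ ?_
    refine Set.finite_univ.prod (Set.Finite.pi fun _ => ?_)
    exact Set.Finite.biUnion (Finset.finite_toSet _) fun B hB =>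
      ih B (Finset.mem_ssubsets.1 hB)

end STree

/-! ### Sums of label-independent weights over the trees on a label set -/

open STree

/-- The trees of `𝒯_P` with set of labels `A`, except that `A` is arbitrary. -/
def treesOn (P : ∀ n : ℕ, Set (SimpleGraph (Fin n))) (A : Finset ℕ) : Finset STree :=
  Set.Finite.toFinset (s := {t : STree | (t.WellFormed ∧ t.labels = A) ∧ t.IsDecomposition P})
    ((finite_wellFormed A).subset fun _ h => h.1)

theorem mem_treesOn {P : ∀ n : ℕ, Set (SimpleGraph (Fin n))} {A : Finset ℕ} {t : STree} :
    t ∈ treesOn P A ↔ (t.WellFormed ∧ t.labels = A) ∧ t.IsDecomposition P := by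
  simp [treesOn]

theorem mem_treesOn_Icc {P : ∀ n : ℕ, Set (SimpleGraph (Fin n))} {n : ℕ} {t : STree} :
    t ∈ treesOn P (Finset.Icc 1 n) ↔ t ∈ treeClass P ∧ t.size = n := by
  rw [mem_treesOn, treeClass, Set.mem_ofPred_eq, IsSubstitutionTree]
  constructor
  · rintro ⟨⟨h1, h2⟩, h3⟩
    have : t.size = n := by rw [← h1.card_labels, h2]; simp
    exact ⟨⟨⟨h1, this ▸ h2⟩, h3⟩, this⟩
  · rintro ⟨⟨⟨h1, h2⟩, h3⟩, rfl⟩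
    exact ⟨⟨h1, h2⟩, h3⟩

/-- A weight on trees that does not depend on the labels. -/
def LabelFree {α : Type*} (w : STree → α) : Prop := ∀ f t, w (t.relabel f) = w t

theorem relabel_mem_treesOn {P : ∀ n : ℕ, Set (SimpleGraph (Fin n))} {A : Finset ℕ} {f : ℕ → ℕ}
    (hf : StrictMonoOn f A) {t : STree} (ht : t ∈ treesOn P A) :
    t.relabel f ∈ treesOn P (A.image f) := by
  obtain ⟨⟨h1, rfl⟩, h3⟩ := mem_treesOn.1 ht
  exact mem_treesOn.2 ⟨⟨h1.relabel hf, labels_relabel f t⟩, (isDecomposition_relabel P f t).2 h3⟩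

theorem strictMonoOn_invFunOn {A : Finset ℕ} {f : ℕ → ℕ} (hf : StrictMonoOn f A) :
    StrictMonoOn (Function.invFunOn f A) (A.image f) := by
  intro x hx y hy hxy
  obtain ⟨a, ha, rfl⟩ := Finset.mem_image.1 (Finset.mem_coe.1 hx)
  obtain ⟨b, hb, rfl⟩ := Finset.mem_image.1 (Finset.mem_coe.1 hy)
  rw [hf.injOn.leftInvOn_invFunOn (Finset.mem_coe.2 ha),
    hf.injOn.leftInvOn_invFunOn (Finset.mem_coe.2 hb)]
  exact (hf.lt_iff_lt ha hb).1 hxy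

theorem image_invFunOn {A : Finset ℕ} {f : ℕ → ℕ} (hf : StrictMonoOn f A) :
    (A.image f).image (Function.invFunOn f A) = A := by
  rw [Finset.image_image]
  conv_rhs => rw [← Finset.image_id (s := A)]
  exact Finset.image_congr fun a ha => hf.injOn.leftInvOn_invFunOn ha

/-- An increasing relabeling keeps the order of the children by minimal label, hence leaves the
decorations untouched; the inverse map on labels undoes it. -/
theorem sum_treesOn_image {P : ∀ n : ℕ, Set (SimpleGraph (Fin n))} {w : STree → ℚ}
    (hw : LabelFree w) {A : Finset ℕ} {f : ℕ → ℕ} (hf : StrictMonoOn f A) :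
    ∑ t ∈ treesOn P (A.image f), w t = ∑ t ∈ treesOn P A, w t := by
  symm
  refine Finset.sum_bij' (fun t _ => t.relabel f)
    (fun t _ => t.relabel (Function.invFunOn f A)) (fun t ht => relabel_mem_treesOn hf ht)
    (fun t ht => ?_) (fun t ht => ?_) (fun t ht => ?_) (fun t _ => (hw f t).symm)
  · have := relabel_mem_treesOn (strictMonoOn_invFunOn hf) ht
    rwa [image_invFunOn hf] at this
  · rw [relabel_relabel]
    refine relabel_eq_self fun a ha => hf.injOn.leftInvOn_invFunOn ?_
    rwa [(mem_treesOn.1 ht).1.2] at ha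
  · rw [relabel_relabel]
    refine relabel_eq_self fun a ha => ?_
    rw [(mem_treesOn.1 ht).1.2] at ha
    exact Function.invFunOn_eq (by simpa using ha)

/-- The rank function of a finite set of integers. -/
def rank (A : Finset ℕ) (x : ℕ) : ℕ := (A.filter (· ≤ x)).card

theorem strictMonoOn_rank (A : Finset ℕ) : StrictMonoOn (rank A) A := by
  intro x _ y hy hxy
  refine Finset.card_lt_card (Finset.ssubset_iff_of_subset ?_ |>.2 ⟨y, ?_, ?_⟩)
  · intro z hz
    simp only [Finset.mem_filter] at hz ⊢
    exact ⟨hz.1, hz.2.trans hxy.le⟩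
  · simpa using hy
  · simp [hxy]

theorem image_rank (A : Finset ℕ) : A.image (rank A) = Finset.Icc 1 A.card := by
  refine Finset.eq_of_subset_of_card_le (fun y hy => ?_) ?_
  · obtain ⟨x, hx, rfl⟩ := Finset.mem_image.1 hy
    exact Finset.mem_Icc.2 ⟨Finset.card_pos.2 ⟨x, by simp [hx]⟩,
      Finset.card_le_card (Finset.filter_subset _ _)⟩
  · rw [Finset.card_image_of_injOn (strictMonoOn_rank A).injOn]
    simp

theorem sum_treesOn_eq {P : ∀ n : ℕ, Set (SimpleGraph (Fin n))} {w : STree → ℚ}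
    (hw : LabelFree w) (A : Finset ℕ) :
    ∑ t ∈ treesOn P A, w t = ∑ t ∈ treesOn P (Finset.Icc 1 A.card), w t := by
  rw [← image_rank, sum_treesOn_image hw (strictMonoOn_rank A)]

/-- The exponential generating function of the trees of `𝒯_P` weighted by `w`. -/
def weightSeries (P : ∀ n : ℕ, Set (SimpleGraph (Fin n))) (w : STree → ℚ) : ℚ⟦X⟧ :=
  PowerSeries.mk fun n => (∑ t ∈ treesOn P (Finset.Icc 1 n), w t) / (n.factorial : ℚ)

/-- Only the number of labels matters, so the block of labels given to a subtree can be replaced by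
a coefficient of a series. -/
theorem sum_treesOn_eq_coeff {P : ∀ n : ℕ, Set (SimpleGraph (Fin n))} {w : STree → ℚ}
    (hw : LabelFree w) (A : Finset ℕ) :
    ∑ t ∈ treesOn P A, w t
      = (A.card.factorial : ℚ) * PowerSeries.coeff A.card (weightSeries P w) := by
  rw [sum_treesOn_eq hw, weightSeries, PowerSeries.coeff_mk]
  field_simp

/-! ### Ordered set partitions -/

/-- The ordered partitions of `A` into `m` parts, possibly empty. -/
def orderedPartitions (m : ℕ) (A : Finset ℕ) : Finset (Fin m → Finset ℕ) :=
  (Fintype.piFinset fun _ => A.powerset).filter fun p =>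
    (∀ i j, i ≠ j → Disjoint (p i) (p j)) ∧ Finset.univ.biUnion p = A

theorem mem_orderedPartitions {m : ℕ} {A : Finset ℕ} {p : Fin m → Finset ℕ} :
    p ∈ orderedPartitions m A ↔
      (∀ i j, i ≠ j → Disjoint (p i) (p j)) ∧ Finset.univ.biUnion p = A := by
  rw [orderedPartitions, Finset.mem_filter, and_iff_right_iff_imp]
  rintro ⟨_, rfl⟩
  simp only [Fintype.mem_piFinset, Finset.mem_powerset]
  exact fun i => Finset.subset_biUnion_of_mem p (Finset.mem_univ i)

/-- Once the first block `B` is chosen, the other blocks form an ordered partition of its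
complement; this is the inductive step of the product formula below. -/
theorem sum_orderedPartitions_succ {m : ℕ} (A : Finset ℕ) (F : (Fin (m + 1) → Finset ℕ) → ℚ) :
    ∑ p ∈ orderedPartitions (m + 1) A, F p =
      ∑ B ∈ A.powerset, ∑ p ∈ orderedPartitions m (A \ B), F (Fin.cons B p) := by
  rw [Finset.sum_sigma']
  refine Finset.sum_bij' (fun p _ => ⟨p 0, Fin.tail p⟩) (fun x _ => Fin.cons x.1 x.2) ?_ ?_ ?_ ?_ ?_
  · intro p hp
    obtain ⟨h1, h2⟩ := mem_orderedPartitions.1 hp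
    simp only [Finset.mem_sigma, Finset.mem_powerset, mem_orderedPartitions]
    refine ⟨h2 ▸ Finset.subset_biUnion_of_mem p (Finset.mem_univ 0),
      fun i j hij => h1 _ _ (by simpa using hij), ?_⟩
    ext x
    rw [← h2]
    simp only [Finset.mem_biUnion, Finset.mem_univ, true_and, Finset.mem_sdiff, Fin.exists_fin_succ,
      Fin.tail]
    constructor
    · rintro ⟨i, hi⟩
      exact ⟨Or.inr ⟨i, hi⟩, fun h0 =>
        Finset.disjoint_left.1 (h1 0 i.succ (Fin.succ_ne_zero i).symm) h0 hi⟩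
    · rintro ⟨h | h, h0⟩
      · exact absurd h h0
      · exact h
  · rintro ⟨B, p⟩ hx
    simp only [Finset.mem_sigma, Finset.mem_powerset, mem_orderedPartitions] at hx
    obtain ⟨hB, h1, h2⟩ := hx
    have hsub : ∀ i, Disjoint B (p i) := fun i => by
      have : p i ⊆ A \ B := h2 ▸ Finset.subset_biUnion_of_mem p (Finset.mem_univ i)
      exact Finset.disjoint_of_subset_right this Finset.disjoint_sdiff
    refine mem_orderedPartitions.2 ⟨fun i j => ?_, ?_⟩
    · refine Fin.cases ?_ (fun i => ?_) i <;> refine Fin.cases ?_ (fun j => ?_) j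
      · simp
      · intro _; simpa using hsub j
      · intro _; simpa using (hsub i).symm
      · intro hij; simpa using h1 i j (by simpa using hij)
    · ext x
      simp only [Finset.mem_biUnion, Finset.mem_univ, true_and, Fin.exists_fin_succ, Fin.cons_zero,
        Fin.cons_succ]
      have : (∃ i, x ∈ p i) ↔ x ∈ A \ B := by rw [← h2]; simp
      rw [this, Finset.mem_sdiff]
      by_cases hx : x ∈ B
      · simp [hx, hB hx]
      · simp [hx]
  · intro p _; simp
  · rintro ⟨B, p⟩ _; simp
  · intro p _; simp

/-- The product formula for exponential generating functions: the number of first blocks of size b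
is a binomial coefficient, which turns the two factorials into that of `A.card`. Empty blocks do no
harm later, since no tree has an empty label set. -/
theorem sum_orderedPartitions {m : ℕ} (f : Fin m → ℚ⟦X⟧) (A : Finset ℕ) :
    ∑ p ∈ orderedPartitions m A,
        ∏ i, (((p i).card.factorial : ℚ) * PowerSeries.coeff (p i).card (f i))
      = (A.card.factorial : ℚ) * PowerSeries.coeff A.card (∏ i, f i) := by
  induction m generalizing A with
  | zero =>
    simp only [Finset.univ_eq_empty, Finset.prod_empty, Finset.sum_const, PowerSeries.coeff_one]
    rcases Finset.eq_empty_or_nonempty A with rfl | hA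
    · have : orderedPartitions 0 ∅ = {fun i => i.elim0} := by
        ext p
        simp only [mem_orderedPartitions, Finset.mem_singleton]
        exact ⟨fun _ => Subsingleton.elim _ _, fun _ => ⟨fun i => i.elim0, by simp⟩⟩
      simp [this]
    · have : orderedPartitions 0 A = ∅ := by
        ext p
        simp only [mem_orderedPartitions, Finset.notMem_empty, iff_false, not_and]
        intro _ h
        simp at h
        exact hA.ne_empty h.symm
      simp [this, hA.ne_empty]
  | succ m ih =>
    rw [sum_orderedPartitions_succ]
    simp only [Fin.prod_univ_succ, Fin.cons_zero, Fin.cons_succ]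
    have key : ∀ B ∈ A.powerset, ∑ p ∈ orderedPartitions m (A \ B),
        (((B.card).factorial : ℚ) * PowerSeries.coeff B.card (f 0)) *
          ∏ i : Fin m, (((p i).card.factorial : ℚ) * PowerSeries.coeff (p i).card (f i.succ))
        = ((B.card).factorial : ℚ) * PowerSeries.coeff B.card (f 0) *
          (((A.card - B.card).factorial : ℚ) *
            PowerSeries.coeff (A.card - B.card) (∏ i : Fin m, f i.succ)) := by
      intro B hB
      rw [← Finset.mul_sum, ih (fun i => f i.succ), Finset.card_sdiff_of_subset
        (Finset.mem_powerset.1 hB)]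
    rw [Finset.sum_congr rfl key,
      Finset.sum_powerset_apply_card (fun b => (b.factorial : ℚ) * PowerSeries.coeff b (f 0) *
          (((A.card - b).factorial : ℚ) *
            PowerSeries.coeff (A.card - b) (∏ i : Fin m, f i.succ))),
      PowerSeries.coeff_mul, Finset.Nat.sum_antidiagonal_eq_sum_range_succ
        (fun a b => PowerSeries.coeff a (f 0) * PowerSeries.coeff b (∏ i : Fin m, f i.succ)),
      Finset.mul_sum]
    refine Finset.sum_congr rfl fun b hb => ?_
    have hb' : b ≤ A.card := Nat.lt_succ_iff.1 (Finset.mem_range.1 hb)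
    rw [nsmul_eq_mul]
    have h := Nat.choose_mul_factorial_mul_factorial hb'
    have h' : ((A.card.choose b : ℕ) : ℚ) * (b.factorial : ℚ) * ((A.card - b).factorial : ℚ)
      = (A.card.factorial : ℚ) := by exact_mod_cast h
    rw [← h']
    ring

end

end ModDec

/-! ### Decorations and families of subtrees at a root -/

namespace ModDec

noncomputable section

open Finset STree

open scoped Classical in
/-- The induced embeddings of a graph into another one, as functions. -/
def embeddings {q m : ℕ} (G' : SimpleGraph (Fin q)) (G : SimpleGraph (Fin m)) :
    Finset (Fin q → Fin m) :=
  Finset.univ.filter fun σ => Function.Injective σ ∧ G.comap σ = G'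

theorem mem_embeddings {q m : ℕ} {G' : SimpleGraph (Fin q)} {G : SimpleGraph (Fin m)}
    {σ : Fin q → Fin m} : σ ∈ embeddings G' G ↔ Function.Injective σ ∧ G.comap σ = G' := by
  simp [embeddings]

theorem card_embeddings {q m : ℕ} (G' : SimpleGraph (Fin q)) (G : SimpleGraph (Fin m)) :
    (embeddings G' G).card = occ G' G := by
  rw [occ, ← Set.ncard_coe_finset, ← Nat.card_coe_set_eq]
  refine Nat.card_congr ⟨fun σ => ⟨⟨σ.1, (mem_embeddings.1 σ.2).1⟩, fun {a b} => ?_⟩,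
    fun f => ⟨f, mem_embeddings.2 ⟨f.injective, ?_⟩⟩, fun σ => rfl, fun f => rfl⟩
  · obtain ⟨σ, hσ⟩ := σ
    conv_rhs => rw [← (mem_embeddings.1 hσ).2]
    rfl
  · ext a b
    exact f.map_rel_iff

/-- The weight of a tree whose root is decorated with a graph of `Q`, defined from weights on
the subtrees attached at an occurrence of `G'` in the decoration of the root. -/
def rootWeight (Q : ∀ n : ℕ, Set (SimpleGraph (Fin n))) {q : ℕ} (G' : SimpleGraph (Fin q))
    (v : Fin q → STree → ℚ) : STree → ℚ
  | .leaf _ => 0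
  | .node n G ts => open scoped Classical in
      if G ∈ Q (n + 2) then ∑ σ ∈ embeddings G' G, ∏ j, v j (ts (σ j)) else 0

/-- `Q` is a class of graphs allowed as decorations of the root of a decomposition tree, provided
that its subtrees satisfy `ok`. -/
structure RootClass (P Q : ∀ n : ℕ, Set (SimpleGraph (Fin n))) (ok : STree → Prop) : Prop where
  stable : StableByRelabeling Q
  zero : Q 0 = ∅
  one : Q 1 = ∅
  decomposition : ∀ n G ts, G ∈ Q (n + 2) →
    ((node n G ts).IsDecomposition P ↔ ∀ i, (ts i).IsDecomposition P ∧ ok (ts i))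
  labelFree : LabelFree ok

/-- The graphs of size `m` in the class `Q`. -/
def graphs (Q : ∀ n : ℕ, Set (SimpleGraph (Fin n))) (m : ℕ) : Finset (SimpleGraph (Fin m)) :=
  (Set.toFinite (Q m)).toFinset

theorem mem_graphs {Q : ∀ n : ℕ, Set (SimpleGraph (Fin n))} {m : ℕ} {G : SimpleGraph (Fin m)} :
    G ∈ graphs Q m ↔ G ∈ Q m := by simp [graphs]

theorem StableByRelabeling.comap_mem {Q : ∀ n : ℕ, Set (SimpleGraph (Fin n))}
    (h : StableByRelabeling Q) {n : ℕ} (π : Equiv.Perm (Fin n)) {G : SimpleGraph (Fin n)}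
    (hG : G ∈ Q n) : G.comap π ∈ Q n := by
  have := h n π.symm G hG
  rwa [SimpleGraph.map_symm] at this

variable {P Q : ∀ n : ℕ, Set (SimpleGraph (Fin n))} {ok : STree → Prop}

open scoped Classical in
/-- The possible decorations and families of subtrees at a root with `m` children. -/
def families (P Q : ∀ n : ℕ, Set (SimpleGraph (Fin n))) (ok : STree → Prop) (m : ℕ)
    (A : Finset ℕ) : Finset (SimpleGraph (Fin m) × (Fin m → STree)) :=
  graphs Q m ×ˢ (orderedPartitions m A).biUnion fun p =>
    Fintype.piFinset fun i => (treesOn P (p i)).filter ok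

theorem mem_families {m : ℕ} {A : Finset ℕ} {x : SimpleGraph (Fin m) × (Fin m → STree)} :
    x ∈ families P Q ok m A ↔ x.1 ∈ Q m ∧
      ((∀ i j, i ≠ j → Disjoint (x.2 i).labels (x.2 j).labels) ∧
        Finset.univ.biUnion (fun i => (x.2 i).labels) = A) ∧
      ∀ i, (x.2 i).WellFormed ∧ (x.2 i).IsDecomposition P ∧ ok (x.2 i) := by
  simp only [families, Finset.mem_product, mem_graphs, Finset.mem_biUnion, Fintype.mem_piFinset,
    Finset.mem_filter, mem_treesOn]
  refine and_congr_right fun _ => ⟨?_, fun h => ?_⟩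
  · rintro ⟨p, hp, h⟩
    obtain rfl : p = fun i => (x.2 i).labels := funext fun i => (h i).1.1.2.symm
    exact ⟨mem_orderedPartitions.1 hp, fun i => ⟨(h i).1.1.1, (h i).1.2, (h i).2⟩⟩
  · exact ⟨fun i => (x.2 i).labels, mem_orderedPartitions.2 h.1,
      fun i => ⟨⟨⟨(h.2 i).1, rfl⟩, (h.2 i).2.1⟩, (h.2 i).2.2⟩⟩

/-- The partition is recovered from the family as its label sets, so the union that defines
`families` is disjoint. -/
theorem sum_families {m : ℕ} (A : Finset ℕ) (F : SimpleGraph (Fin m) → (Fin m → STree) → ℚ) :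
    ∑ x ∈ families P Q ok m A, F x.1 x.2 = open scoped Classical in
      ∑ G ∈ graphs Q m, ∑ p ∈ orderedPartitions m A,
        ∑ ts ∈ Fintype.piFinset (fun i => (treesOn P (p i)).filter ok), F G ts := by
  classical
  rw [families, Finset.sum_product]
  refine Finset.sum_congr rfl fun G _ => ?_
  rw [Finset.sum_biUnion]
  intro p _ p' _ hpp
  rw [Function.onFun, Finset.disjoint_left]
  intro ts h h'
  refine hpp (funext fun i => ?_)
  simp only [Fintype.mem_piFinset, Finset.mem_filter, mem_treesOn] at h h'
  rw [← (h i).1.1.2, (h' i).1.1.2]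

open scoped Classical in
/-- Every family can be sorted in exactly one way. -/
theorem sum_families_eq_factorial_mul (hQ : RootClass P Q ok) {m : ℕ} (A : Finset ℕ)
    (F : SimpleGraph (Fin m) → (Fin m → STree) → ℚ)
    (hF : ∀ (π : Equiv.Perm (Fin m)) G ts, F (G.comap π) (ts ∘ π) = F G ts) :
    ∑ x ∈ families P Q ok m A, F x.1 x.2 = (m.factorial : ℚ) *
      ∑ x ∈ (families P Q ok m A).filter (fun x => StrictMono fun i => (x.2 i).labels.min),
        F x.1 x.2 := by
  have hcard : (m.factorial : ℚ) = ((Finset.univ : Finset (Equiv.Perm (Fin m))).card : ℚ) := by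
    rw [Finset.card_univ, Fintype.card_perm, Fintype.card_fin]
  rw [hcard, ← nsmul_eq_mul, ← Finset.sum_const, ← Finset.sum_product']
  symm
  -- A family corresponds to the pair formed by its sorted version and the permutation that unsorts
  -- it. The decoration is permuted along with the subtrees, which is where stability under
  -- relabeling is used.
  refine Finset.sum_bij (fun y _ => (y.2.1.comap y.1, y.2.2 ∘ y.1)) ?_ ?_ ?_ ?_
  · rintro ⟨π, G, ts⟩ h
    simp only [Finset.mem_product, Finset.mem_univ, true_and, Finset.mem_filter,
      mem_families] at h
    obtain ⟨⟨h1, ⟨h2, h3⟩, h4⟩, -⟩ := h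
    refine mem_families.2 ⟨hQ.stable.comap_mem π h1, ⟨fun i j hij => h2 _ _ (by simpa using hij),
      ?_⟩, fun i => h4 _⟩
    rw [← h3]
    ext x
    simp only [Finset.mem_biUnion, Finset.mem_univ, true_and, Function.comp_apply]
    exact ⟨fun ⟨i, hi⟩ => ⟨_, hi⟩, fun ⟨i, hi⟩ => ⟨π.symm i, by simpa using hi⟩⟩
  · rintro ⟨π, G, ts⟩ h ⟨π', G', ts'⟩ h' he
    simp only [Finset.mem_product, Finset.mem_univ, true_and, Finset.mem_filter] at h h'
    simp only [Prod.mk.injEq] at he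
    have hkey : (fun i => (ts i).labels.min) ∘ π = (fun i => (ts' i).labels.min) ∘ π' :=
      funext fun i => by
        have := congrFun he.2 i
        simp only [Function.comp_apply] at this ⊢
        rw [this]
    -- Two increasing sequences with the same range coincide, so the sorted sequence of minima is
    -- determined first and then the permutation.
    have hfun : (fun i => (ts i).labels.min) = fun i => (ts' i).labels.min := by
      rw [← StrictMono.range_inj h.2 h'.2]
      have := congrArg Set.range hkey
      rwa [EquivLike.range_comp, EquivLike.range_comp] at this
    have hπ : π = π' := by
      ext i
      have := congrFun hkey i
      simp only [Function.comp_apply] at this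
      rw [congrFun hfun (π i)] at this
      rw [h'.2.injective this]
    subst hπ
    obtain rfl : ts = ts' := funext fun i => by simpa using congrFun he.2 (π.symm i)
    obtain rfl : G = G' := by
      have := congrArg (fun H => H.comap π.symm) he.1
      simpa [SimpleGraph.comap_comap] using this
    rfl
  · rintro ⟨G, ts⟩ h
    have hinj : Function.Injective fun i => (ts i).labels.min := fun i j hij => by
      by_contra hne
      exact min_ne_min_of_disjoint (labels_nonempty _) ((mem_families.1 h).2.1.1 i j hne) hij
    set π := Tuple.sort fun i => (ts i).labels.min with hπ
    have hsm : StrictMono ((fun i => (ts i).labels.min) ∘ π) :=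
      (Tuple.monotone_sort _).strictMono_of_injective (hinj.comp π.injective)
    refine ⟨(π.symm, G.comap π, ts ∘ π), ?_, ?_⟩
    · obtain ⟨h1, ⟨h2, h3⟩, h4⟩ := mem_families.1 h
      simp only [Finset.mem_product, Finset.mem_univ, true_and, Finset.mem_filter]
      refine ⟨mem_families.2 ⟨hQ.stable.comap_mem π h1,
        ⟨fun i j hij => h2 _ _ (by simpa using hij), ?_⟩, fun i => h4 _⟩, hsm⟩
      rw [← h3]
      ext x
      simp only [Finset.mem_biUnion, Finset.mem_univ, true_and, Function.comp_apply]
      exact ⟨fun ⟨i, hi⟩ => ⟨_, hi⟩, fun ⟨i, hi⟩ => ⟨π.symm i, by simpa using hi⟩⟩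
    · ext <;> simp [SimpleGraph.comap_comap]
  · rintro ⟨π, G, ts⟩ _
    exact (hF π G ts).symm

/-- Composition with `π` matches the occurrences in the two decorations. This is the invariance
required by `sum_families_eq_factorial_mul`. -/
theorem sum_embeddings_comap {q m : ℕ} (G' : SimpleGraph (Fin q)) (v : Fin q → STree → ℚ)
    (π : Equiv.Perm (Fin m)) (G : SimpleGraph (Fin m)) (ts : Fin m → STree) :
    ∑ σ ∈ embeddings G' (G.comap π), ∏ j, v j ((ts ∘ π) (σ j))
      = ∑ σ ∈ embeddings G' G, ∏ j, v j (ts (σ j)) := by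
  refine Finset.sum_bij' (fun σ _ => π ∘ σ) (fun σ _ => π.symm ∘ σ) ?_ ?_ ?_ ?_ ?_
  · intro σ h
    obtain ⟨h1, h2⟩ := mem_embeddings.1 h
    exact mem_embeddings.2 ⟨π.injective.comp h1, by rw [← SimpleGraph.comap_comap]; exact h2⟩
  · intro σ h
    obtain ⟨h1, h2⟩ := mem_embeddings.1 h
    refine mem_embeddings.2 ⟨π.symm.injective.comp h1, ?_⟩
    rw [SimpleGraph.comap_comap, ← Function.comp_assoc]
    simpa using h2
  · intro σ _; ext; simp
  · intro σ _; ext; simp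
  · intro σ _; simp

/-- A well-formed tree with `k + 2` children is a sorted family, and sorted families account for a
fraction 1/(k + 2)! of the total over all families. -/
theorem sum_treesOn_rootWeight (hQ : RootClass P Q ok) {q : ℕ} (G' : SimpleGraph (Fin q))
    (v : Fin q → STree → ℚ) (A : Finset ℕ) :
    ∑ t ∈ treesOn P A, rootWeight Q G' v t =
      ∑ k ∈ Finset.range A.card, (∑ x ∈ families P Q ok (k + 2) A,
        ∑ σ ∈ embeddings G' x.1, ∏ j, v j (x.2 (σ j))) / ((k + 2).factorial : ℚ) := by
  classical
  have h1 : ∀ k, (∑ x ∈ families P Q ok (k + 2) A,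
        ∑ σ ∈ embeddings G' x.1, ∏ j, v j (x.2 (σ j))) / ((k + 2).factorial : ℚ)
      = ∑ x ∈ (families P Q ok (k + 2) A).filter
          (fun x => StrictMono fun i => (x.2 i).labels.min),
        ∑ σ ∈ embeddings G' x.1, ∏ j, v j (x.2 (σ j)) := by
    intro k
    rw [sum_families_eq_factorial_mul hQ A
      (fun G ts => ∑ σ ∈ embeddings G' G, ∏ j, v j (ts (σ j)))
      (fun π G ts => sum_embeddings_comap G' v π G ts)]
    field_simp
  simp only [h1]
  rw [Finset.sum_sigma']
  symm
  -- Leaves and roots decorated outside `Q` have weight zero, so only trees of nonzero weight need a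
  -- preimage.
  refine Finset.sum_bij_ne_zero (fun x _ _ => node x.1 x.2.1 x.2.2) ?_ ?_ ?_ ?_
  · rintro ⟨k, G, ts⟩ h -
    simp only [Finset.mem_sigma, Finset.mem_filter, mem_families] at h
    obtain ⟨-, ⟨h1, ⟨h2, h3⟩, h4⟩, h5⟩ := h
    exact mem_treesOn.2 ⟨⟨⟨h2, h5, fun i => (h4 i).1⟩, h3⟩,
      (hQ.decomposition k G ts h1).2 fun i => (h4 i).2⟩
  · rintro ⟨k, G, ts⟩ _ _ ⟨k', G', ts'⟩ _ _ he
    simp only [STree.node.injEq] at he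
    obtain ⟨rfl, h1, h2⟩ := he
    obtain rfl := eq_of_heq h1
    obtain rfl := eq_of_heq h2
    rfl
  · intro t ht hne
    cases t with
    | leaf a => exact absurd rfl hne
    | node k G ts =>
      have hG : G ∈ Q (k + 2) := by
        by_contra hG
        exact hne (by simp [rootWeight, hG])
      obtain ⟨⟨⟨h1, h2, h3⟩, h4⟩, h5⟩ := mem_treesOn.1 ht
      have h6 := (hQ.decomposition k G ts hG).1 h5
      have hk : k < A.card := by
        rw [← h4, labels, Finset.card_biUnion fun i _ j _ hij => h1 i j hij]
        have : ∑ i : Fin (k + 2), 1 ≤ ∑ i, (ts i).labels.card :=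
          Finset.sum_le_sum fun i _ => Finset.card_pos.2 (labels_nonempty _)
        simp at this
        omega
      refine ⟨⟨k, G, ts⟩, ?_, ?_, rfl⟩
      · simp only [Finset.mem_sigma, Finset.mem_filter, mem_families]
        exact ⟨Finset.mem_range.2 hk, ⟨hG, ⟨h1, h4⟩, fun i => ⟨h3 i, h6 i⟩⟩, h2⟩
      · simpa [rootWeight, hG] using hne
  · rintro ⟨k, G, ts⟩ h -
    simp only [Finset.mem_sigma, Finset.mem_filter, mem_families] at h
    simp [rootWeight, h.2.1.1]

end

end ModDec

/-! ### The series of a weight that is read off at the root -/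

namespace ModDec

noncomputable section

open Finset STree

variable {P Q : ∀ n : ℕ, Set (SimpleGraph (Fin n))} {ok : STree → Prop}

/-- Used with the q children singled out by an occurrence, which carry their own series, while the
`m - q` other children all carry the same one. -/
theorem prod_extend {M : Type*} [CommMonoid M] {q m : ℕ} {σ : Fin q → Fin m}
    (hσ : Function.Injective σ) (a : Fin q → M) (b : M) :
    ∏ i, Function.extend σ a (fun _ => b) i = (∏ j, a j) * b ^ (m - q) := by
  classical
  rw [← Finset.prod_mul_prod_compl (Finset.univ.image σ), Finset.prod_image hσ.injOn]
  congr 1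
  · exact Finset.prod_congr rfl fun j _ => hσ.extend_apply _ _ _
  · rw [Finset.prod_congr rfl (g := fun _ => b), Finset.prod_const, Finset.card_compl,
      Finset.card_image_of_injective _ hσ]
    · simp
    · intro i hi
      refine Function.extend_apply' _ _ _ ?_
      simpa using hi

/-- Since `U ^ d` is divisible by `X ^ d`, the terms with `d > n` do not reach degree `n`, and the
substitution reduces to a finite sum. -/
theorem coeff_mul_subst (A f : ℚ⟦X⟧) {U : ℚ⟦X⟧} (hU : PowerSeries.constantCoeff U = 0) (n N : ℕ)
    (hN : n < N) :
    PowerSeries.coeff n (A * f.subst U) =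
      ∑ d ∈ Finset.range N, PowerSeries.coeff d f * PowerSeries.coeff n (A * U ^ d) := by
  have hX : ∀ d, PowerSeries.X ^ d ∣ U ^ d := fun d =>
    pow_dvd_pow_of_dvd (PowerSeries.X_dvd_iff.2 hU) d
  have hsub : ∀ i ≤ n, PowerSeries.coeff i (f.subst U) =
      ∑ d ∈ Finset.range N, PowerSeries.coeff d f * PowerSeries.coeff i (U ^ d) := by
    intro i hi
    rw [PowerSeries.coeff_subst' (PowerSeries.HasSubst.of_constantCoeff_zero' hU)]
    refine finsum_eq_sum_of_support_subset _ fun d hd => ?_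
    by_contra hdN
    have hid : i < d := by
      simp only [Finset.coe_range, Set.mem_Iio, not_lt] at hdN
      omega
    exact hd (by simp [PowerSeries.X_pow_dvd_iff.1 (hX d) i hid])
  simp only [PowerSeries.coeff_mul]
  have h : ∀ x ∈ Finset.HasAntidiagonal.antidiagonal n,
      PowerSeries.coeff x.1 A * PowerSeries.coeff x.2 (f.subst U) =
        ∑ d ∈ Finset.range N, PowerSeries.coeff d f *
          (PowerSeries.coeff x.1 A * PowerSeries.coeff x.2 (U ^ d)) := by
    intro x hx
    rw [hsub x.2 (by have := Finset.HasAntidiagonal.mem_antidiagonal.1 hx; omega), Finset.mul_sum]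
    exact Finset.sum_congr rfl fun d _ => by ring
  rw [Finset.sum_congr rfl h, Finset.sum_comm]
  simp only [Finset.mul_sum]

theorem constantCoeff_weightSeries (w : STree → ℚ) :
    PowerSeries.constantCoeff (weightSeries P w) = 0 := by
  rw [← PowerSeries.coeff_zero_eq_constantCoeff_apply, weightSeries, PowerSeries.coeff_mk]
  have : treesOn P (Finset.Icc 1 0) = ∅ := by
    ext t
    simp only [mem_treesOn, Finset.notMem_empty, iff_false]
    rintro ⟨⟨-, h⟩, -⟩
    exact (labels_nonempty t).ne_empty (by simpa using h)
  rw [this]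
  simp

-- For a fixed decoration and a fixed occurrence σ the weight is a product over the children, with
-- the value 1 away from σ, so the product formula for ordered partitions applies. The result does
-- not depend on σ, which leaves the number of occurrences as a factor.
open scoped Classical in
theorem sum_families_embeddings (hQ : RootClass P Q ok) {q m : ℕ}
    (G' : SimpleGraph (Fin q)) (v : Fin q → STree → ℚ) (hv : ∀ j, LabelFree (v j))
    (A : Finset ℕ) :
    ∑ x ∈ families P Q ok m A, ∑ σ ∈ embeddings G' x.1, ∏ j, v j (x.2 (σ j)) =
      (A.card.factorial : ℚ) * ((∑ G ∈ graphs Q m, (occ G' G : ℚ)) * PowerSeries.coeff A.card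
        ((∏ j, weightSeries P fun t => if ok t then v j t else 0) *
          (weightSeries P fun t => if ok t then 1 else 0) ^ (m - q))) := by
  rw [sum_families A fun G ts => ∑ σ ∈ embeddings G' G, ∏ j, v j (ts (σ j)), Finset.sum_mul,
    Finset.mul_sum]
  refine Finset.sum_congr rfl fun G _ => ?_
  rw [← card_embeddings, mul_left_comm, ← nsmul_eq_mul, ← Finset.sum_const]
  rw [Finset.sum_congr rfl fun p _ => Finset.sum_comm, Finset.sum_comm]
  refine Finset.sum_congr rfl fun σ hσ => ?_
  have hinj := (mem_embeddings.1 hσ).1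
  have hprod : ∀ ts : Fin m → STree, ∏ j, v j (ts (σ j)) =
      ∏ i, Function.extend σ v (fun _ _ => 1) i (ts i) := by
    intro ts
    have := prod_extend hinj (fun j => v j (ts (σ j))) 1
    rw [one_pow, mul_one] at this
    rw [← this]
    refine Finset.prod_congr rfl fun i _ => ?_
    by_cases hi : ∃ j, σ j = i
    · obtain ⟨j, rfl⟩ := hi
      rw [hinj.extend_apply, hinj.extend_apply]
    · rw [Function.extend_apply' _ _ _ hi, Function.extend_apply' _ _ _ hi]
  simp only [hprod]
  rw [← prod_extend hinj, ← sum_orderedPartitions]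
  refine Finset.sum_congr rfl fun p _ => ?_
  rw [← Finset.prod_univ_sum (fun i => (treesOn P (p i)).filter ok)
    (fun i t => Function.extend σ v (fun _ _ => 1) i t)]
  refine Finset.prod_congr rfl fun i _ => ?_
  rw [Finset.sum_filter]
  by_cases hi : ∃ j, σ j = i
  · obtain ⟨j, rfl⟩ := hi
    rw [hinj.extend_apply, hinj.extend_apply, sum_treesOn_eq_coeff]
    intro f t
    simp only [hv j f t, hQ.labelFree f t]
  · rw [Function.extend_apply' _ _ _ hi, Function.extend_apply' _ _ _ hi, sum_treesOn_eq_coeff]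
    intro f t
    simp only [hQ.labelFree f t]

open scoped Classical in
/-- Decomposition at the root. -/
theorem weightSeries_rootWeight (hQ : RootClass P Q ok) {q : ℕ} (G' : SimpleGraph (Fin q))
    (v : Fin q → STree → ℚ) (hv : ∀ j, LabelFree (v j)) :
    weightSeries P (rootWeight Q G' v) =
      (∏ j, weightSeries P fun t => if ok t then v j t else 0) *
        (occSeries Q G').subst (weightSeries P fun t => if ok t then 1 else 0) := by
  ext n
  set U := weightSeries P fun t => if ok t then 1 else 0 with hUdef
  set A := ∏ j, weightSeries P fun t => if ok t then v j t else 0 with hA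
  have hU : PowerSeries.constantCoeff U = 0 := constantCoeff_weightSeries _
  -- `g m` is the contribution of the decorations of size `m`. The left side sums it from `m = 2`,
  -- the right side from `m = q`; the two ranges differ by vanishing terms only.
  set g : ℕ → ℚ := fun m => (∑ G ∈ graphs Q m, (occ G' G : ℚ)) / (m.factorial : ℚ) *
    PowerSeries.coeff n (A * U ^ (m - q)) with hg
  have hL : PowerSeries.coeff n (weightSeries P (rootWeight Q G' v)) =
      ∑ k ∈ Finset.range n, g (k + 2) := by
    rw [weightSeries, PowerSeries.coeff_mk, sum_treesOn_rootWeight hQ, Finset.sum_div]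
    rw [Nat.card_Icc, Nat.add_sub_cancel]
    refine Finset.sum_congr rfl fun k _ => ?_
    rw [sum_families_embeddings hQ G' v hv, Nat.card_Icc, Nat.add_sub_cancel]
    field_simp
    simp only [hg]
    field_simp
    rfl
  have h0 : g 0 = 0 := by
    have : graphs Q 0 = ∅ := by ext G; simp [mem_graphs, hQ.zero]
    simp [hg, this]
  have h1 : g 1 = 0 := by
    have : graphs Q 1 = ∅ := by ext G; simp [mem_graphs, hQ.one]
    simp [hg, this]
  -- There is no injection into fewer than `q` vertices. This also disposes of the values of `m` at
  -- which `m - q` is truncated.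
  have hsmall : ∀ m < q, g m = 0 := by
    intro m hm
    have : ∀ G ∈ graphs Q m, (occ G' G : ℚ) = 0 := by
      intro G _
      rw [← card_embeddings, Nat.cast_eq_zero, Finset.card_eq_zero]
      ext σ
      simp only [mem_embeddings, Finset.notMem_empty, iff_false, not_and]
      intro h
      have := Fintype.card_le_of_injective σ h
      simp at this
      omega
    simp [hg, Finset.sum_eq_zero this]
  -- A product of `m` tree series, none of which has a constant term, has order at least `m`.
  have hlarge : ∀ m, n + 2 ≤ m → g m = 0 := by
    intro m hm
    rcases lt_or_ge m q with h | h
    · exact hsmall m h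
    have hdvd : PowerSeries.X ^ m ∣ A * U ^ (m - q) := by
      have h1 : (PowerSeries.X : ℚ⟦X⟧) ^ q ∣ A := by
        have : ∏ _j : Fin q, (PowerSeries.X : ℚ⟦X⟧) ∣ A :=
          Finset.prod_dvd_prod_of_dvd _ _ fun j _ =>
            PowerSeries.X_dvd_iff.2 (constantCoeff_weightSeries _)
        simpa using this
      have h2 := mul_dvd_mul h1 (pow_dvd_pow_of_dvd (PowerSeries.X_dvd_iff.2 hU) (m - q))
      rwa [← pow_add, Nat.add_sub_cancel' h] at h2
    simp only [hg]
    rw [PowerSeries.X_pow_dvd_iff.1 hdvd n (by omega), mul_zero]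
  have hR : PowerSeries.coeff n (A * (occSeries Q G').subst U) =
      ∑ d ∈ Finset.range (n + 2), g (q + d) := by
    rw [coeff_mul_subst A _ hU n (n + 2) (by omega)]
    refine Finset.sum_congr rfl fun d _ => ?_
    simp only [hg]
    rw [occSeries, PowerSeries.coeff_mk, Nat.add_sub_cancel_left, Nat.add_comm d q,
      finsum_mem_eq_finite_toFinset_sum _ (Set.toFinite _)]
    rfl
  have hsum : ∀ N, n + 2 ≤ N → ∑ m ∈ Finset.range N, g m = ∑ m ∈ Finset.range (n + 2), g m := by
    intro N hN
    refine (Finset.sum_subset (Finset.range_subset_range.2 hN) fun m _ hm => hlarge m ?_).symm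
    simpa using hm
  rw [hL, hR, ← zero_add (∑ d ∈ Finset.range (n + 2), g (q + d)),
    ← Finset.sum_eq_zero (s := Finset.range q) (f := g) (by simpa using hsmall),
    ← Finset.sum_range_add, hsum _ (by omega), Finset.sum_range_succ', Finset.sum_range_succ', h0,
    h1]
  simp

end

end ModDec

namespace ModDec

noncomputable section

open Finset STree

variable {P : ∀ n : ℕ, Set (SimpleGraph (Fin n))}

/-! ### The three kinds of roots -/

/-- The complete graphs with at least two vertices. -/
def completeGraphs (n : ℕ) : Set (SimpleGraph (Fin n)) := {G | 2 ≤ n ∧ G = ⊤}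

/-- The edgeless graphs with at least two vertices. -/
def edgelessGraphs (n : ℕ) : Set (SimpleGraph (Fin n)) := {G | 2 ≤ n ∧ G = ⊥}

theorem top_ne_bot_fin (n : ℕ) : (⊤ : SimpleGraph (Fin (n + 2))) ≠ ⊥ := top_ne_bot

/-- Every vertex set of a complete or edgeless graph is a module; a pair is a non-trivial one as
soon as there is a third vertex. -/
theorem exists_isModule_of_linear {n : ℕ} (hn : 3 ≤ n) {G : SimpleGraph (Fin n)}
    (hG : G = ⊤ ∨ G = ⊥) : ¬ IsPrime G := by
  rintro ⟨-, h⟩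
  have hM : IsModule G {⟨0, by omega⟩, ⟨1, by omega⟩} := by
    intro x hx y hy z hz
    rcases hG with rfl | rfl
    · have hxz : x ≠ z := fun h => hz (h ▸ hx)
      have hyz : y ≠ z := fun h => hz (h ▸ hy)
      simp [hxz, hyz]
    · simp
  rcases h _ hM with h | h | ⟨v, h⟩
  · exact (Set.insert_nonempty _ _).ne_empty h
  · have := h.symm ▸ Set.mem_univ (⟨2, by omega⟩ : Fin n)
    simp at this
  · have h0 : (⟨0, by omega⟩ : Fin n) ∈ ({v} : Set (Fin n)) := h ▸ Set.mem_insert _ _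
    have h1 : (⟨1, by omega⟩ : Fin n) ∈ ({v} : Set (Fin n)) :=
      h ▸ Set.mem_insert_of_mem _ rfl
    have := (Set.mem_singleton_iff.1 h0).trans (Set.mem_singleton_iff.1 h1).symm
    simp at this

theorem not_linear_of_mem (hprime : ∀ (n : ℕ) (G : SimpleGraph (Fin n)), G ∈ P n → IsPrime G)
    {n : ℕ} {G : SimpleGraph (Fin n)} (hG : G ∈ P n) : ¬ (G = ⊤ ∨ G = ⊥) := fun h =>
  exists_isModule_of_linear (hprime n G hG).1 h (hprime n G hG)

theorem rootClass_completeGraphs :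
    RootClass P completeGraphs fun t => ¬ t.RootOplus where
  stable := by
    rintro n π G ⟨h, rfl⟩
    refine ⟨h, ?_⟩
    rw [← Equiv.symm_symm π, SimpleGraph.map_symm]
    exact SimpleGraph.comap_top π.symm.injective
  zero := by ext; simp [completeGraphs]
  one := by ext; simp [completeGraphs]
  decomposition := by
    rintro n G ts ⟨-, rfl⟩
    simp only [IsDecomposition, top_ne_bot_fin, true_or, true_and, forall_const,
      false_imp_iff, ← forall_and, and_comm]
  labelFree := fun f t => by simp

theorem rootClass_edgelessGraphs :
    RootClass P edgelessGraphs fun t => ¬ t.RootOminus where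
  stable := by
    rintro n π G ⟨h, rfl⟩
    refine ⟨h, ?_⟩
    rw [← Equiv.symm_symm π, SimpleGraph.map_symm]
    exact SimpleGraph.comap_bot _
  zero := by ext; simp [edgelessGraphs]
  one := by ext; simp [edgelessGraphs]
  decomposition := by
    rintro n G ts ⟨-, rfl⟩
    simp only [IsDecomposition, (top_ne_bot_fin _).symm, true_or, or_true, true_and, forall_const,
      false_imp_iff, ← forall_and, and_comm]
  labelFree := fun f t => by simp

theorem rootClass_prime (hprime : ∀ (n : ℕ) (G : SimpleGraph (Fin n)), G ∈ P n → IsPrime G)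
    (hstable : StableByRelabeling P) : RootClass P P fun _ => True where
  stable := hstable
  zero := by
    ext G
    simpa using fun h => absurd (hprime 0 G h).1 (by omega)
  one := by
    ext G
    simpa using fun h => absurd (hprime 1 G h).1 (by omega)
  decomposition := by
    intro n G ts hG
    have h := not_linear_of_mem hprime hG
    rw [not_or] at h
    simp [IsDecomposition, h.1, h.2, hG]
  labelFree := fun f t => rfl

/-! ### Occurrence series of the complete and of the edgeless graphs -/

theorem occ_eq_descFactorial {q m : ℕ} {G' : SimpleGraph (Fin q)} {H : SimpleGraph (Fin m)}
    (h : ∀ σ : Fin q → Fin m, Function.Injective σ → H.comap σ = G') :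
    occ G' H = m.descFactorial q := by
  classical
  have := Fintype.card_embedding_eq (α := Fin q) (β := Fin m)
  rw [Fintype.card_fin, Fintype.card_fin] at this
  rw [← this, ← card_embeddings, ← Fintype.card_coe]
  exact Fintype.card_congr ⟨fun σ => ⟨σ.1, (mem_embeddings.1 σ.2).1⟩,
    fun f => ⟨f, mem_embeddings.2 ⟨f.injective, h f f.injective⟩⟩, fun _ => rfl, fun _ => rfl⟩

/-- Every injection is an occurrence: there are (n + q)!/n! of them, and division by (n + q)! leaves
1/n!. The test in the conclusion is the requirement of at least two children. -/
theorem coeff_occSeries_linear {Q : ∀ n : ℕ, Set (SimpleGraph (Fin n))}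
    {lin : ∀ n, SimpleGraph (Fin n)} (hQ : ∀ n, Q n = {G | 2 ≤ n ∧ G = lin n}) {q : ℕ}
    (G' : SimpleGraph (Fin q))
    (h : ∀ m (σ : Fin q → Fin m), Function.Injective σ → (lin m).comap σ = G') (n : ℕ) :
    PowerSeries.coeff n (occSeries Q G') = if 2 ≤ n + q then ((n.factorial : ℚ))⁻¹ else 0 := by
  rw [occSeries, PowerSeries.coeff_mk, hQ]
  split_ifs with h2
  · have : {G : SimpleGraph (Fin (n + q)) | 2 ≤ n + q ∧ G = lin (n + q)} = {lin (n + q)} := by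
      ext; simp [h2]
    rw [this, finsum_mem_singleton, occ_eq_descFactorial (h _)]
    have h3 := Nat.factorial_mul_descFactorial (Nat.le_add_left q n)
    rw [Nat.add_sub_cancel] at h3
    rw [← h3]
    have h4 : ((n + q).descFactorial q : ℚ) ≠ 0 := by
      rw [Nat.cast_ne_zero]
      intro h0
      rw [h0, mul_zero] at h3
      exact Nat.factorial_ne_zero _ h3.symm
    push_cast
    field_simp
  · have : {G : SimpleGraph (Fin (n + q)) | 2 ≤ n + q ∧ G = lin (n + q)} = ∅ := by
      ext; simp [h2]
    simp [this]

section Linear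

variable {Q : ∀ n : ℕ, Set (SimpleGraph (Fin n))} {lin : ∀ n, SimpleGraph (Fin n)}

/-- The lower bound of two children cuts the exponential series below degree 2 - q. So two terms
disappear for q = 0, one for q = 1, and none in the later case of at least two vertices. -/
theorem occSeries_linear_zero (hQ : ∀ n, Q n = {G | 2 ≤ n ∧ G = lin n}) :
    occSeries Q (⊥ : SimpleGraph (Fin 0)) = PowerSeries.exp ℚ - 1 - PowerSeries.X := by
  ext n
  rw [coeff_occSeries_linear hQ _ (fun m σ _ => Subsingleton.elim _ _)]
  match n with
  | 0 => simp
  | 1 => simp [PowerSeries.coeff_exp, PowerSeries.coeff_one, PowerSeries.coeff_X]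
  | n + 2 => simp [PowerSeries.coeff_exp, PowerSeries.coeff_one, PowerSeries.coeff_X]

theorem occSeries_linear_one (hQ : ∀ n, Q n = {G | 2 ≤ n ∧ G = lin n}) :
    occSeries Q (⊥ : SimpleGraph (Fin 1)) = PowerSeries.exp ℚ - 1 := by
  ext n
  rw [coeff_occSeries_linear hQ _ (fun m σ _ => Subsingleton.elim _ _)]
  match n with
  | 0 => simp
  | n + 1 => simp [PowerSeries.coeff_exp, PowerSeries.coeff_one]

theorem occSeries_linear_of_eq (hQ : ∀ n, Q n = {G | 2 ≤ n ∧ G = lin n}) {q : ℕ}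
    (h : ∀ m (σ : Fin (q + 2) → Fin m), Function.Injective σ → (lin m).comap σ = lin (q + 2)) :
    occSeries Q (lin (q + 2)) = PowerSeries.exp ℚ := by
  ext n
  rw [coeff_occSeries_linear hQ _ h, if_pos (by omega)]
  simp [PowerSeries.coeff_exp]

theorem occSeries_linear_of_ne (hQ : ∀ n, Q n = {G | 2 ≤ n ∧ G = lin n}) {q : ℕ}
    (h : ∀ m (σ : Fin (q + 2) → Fin m), Function.Injective σ → (lin m).comap σ = lin (q + 2))
    {G' : SimpleGraph (Fin (q + 2))} (hG : G' ≠ lin (q + 2)) :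
    occSeries Q G' = 0 := by
  ext n
  rw [occSeries, PowerSeries.coeff_mk]
  have : ∀ H ∈ Q (n + (q + 2)), (occ G' H : ℚ) = 0 := by
    intro H hH
    rw [hQ] at hH
    rw [hH.2, ← card_embeddings, Nat.cast_eq_zero, Finset.card_eq_zero]
    ext σ
    simp only [mem_embeddings, Finset.notMem_empty, iff_false, not_and]
    exact fun hi hc => hG (hc.symm.trans (h _ _ hi))
  rw [finsum_mem_congr rfl this]
  simp

end Linear

theorem comap_top_of_injective {q m : ℕ} {σ : Fin q → Fin m} (h : Function.Injective σ) :
    (⊤ : SimpleGraph (Fin m)).comap σ = ⊤ := SimpleGraph.comap_top h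

theorem comap_bot_eq {q m : ℕ} (σ : Fin q → Fin m) :
    (⊥ : SimpleGraph (Fin m)).comap σ = ⊥ := SimpleGraph.comap_bot σ

/-! ### Weighted series -/

theorem weightSeries_congr {w w' : STree → ℚ}
    (h : ∀ t : STree, t.WellFormed → t.IsDecomposition P → w t = w' t) :
    weightSeries P w = weightSeries P w' := by
  ext n
  rw [weightSeries, weightSeries, PowerSeries.coeff_mk, PowerSeries.coeff_mk]
  congr 1
  refine Finset.sum_congr rfl fun t ht => ?_
  rw [mem_treesOn] at ht
  exact h t ht.1.1 ht.2

theorem weightSeries_add (w w' : STree → ℚ) :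
    weightSeries P (fun t => w t + w' t) = weightSeries P w + weightSeries P w' := by
  ext n
  simp only [weightSeries, map_add, PowerSeries.coeff_mk, Finset.sum_add_distrib, add_div]

theorem weightSeries_sub (w w' : STree → ℚ) :
    weightSeries P (fun t => w t - w' t) = weightSeries P w - weightSeries P w' := by
  ext n
  simp only [weightSeries, map_sub, PowerSeries.coeff_mk, Finset.sum_sub_distrib, sub_div]

/-- The indicator function of the leaves. -/
def leafWeight : STree → ℚ
  | .leaf _ => 1
  | .node _ _ _ => 0

theorem labelFree_leafWeight : LabelFree leafWeight := fun f t => by cases t <;> rfl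

theorem weightSeries_leafWeight : weightSeries P leafWeight = PowerSeries.X := by
  ext n
  rw [weightSeries, PowerSeries.coeff_mk, PowerSeries.coeff_X]
  have h0 : ∀ t ∈ treesOn P (Finset.Icc 1 n), t ≠ leaf 1 → leafWeight t = 0 := by
    intro t ht hne
    cases t with
    | node k G ts => rfl
    | leaf a =>
      have := (mem_treesOn.1 ht).1.2
      have h1 : 1 ∈ Finset.Icc 1 n := by
        have ha : a ∈ Finset.Icc 1 n := this ▸ (by simp [labels])
        rw [Finset.mem_Icc] at ha ⊢
        omega
      rw [← this] at h1
      simp only [labels, Finset.mem_singleton] at h1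
      exact absurd (by rw [h1]) hne
  have hmem : leaf 1 ∈ treesOn P (Finset.Icc 1 n) ↔ n = 1 := by
    rw [mem_treesOn]
    constructor
    · rintro ⟨⟨-, h⟩, -⟩
      have := congrArg Finset.card h
      simpa [labels] using this.symm
    · rintro rfl
      exact ⟨⟨trivial, by simp [labels]⟩, trivial⟩
  split_ifs with hn
  · rw [Finset.sum_eq_single_of_mem _ (hmem.2 hn) h0, hn]
    simp [leafWeight]
  · rw [Finset.sum_eq_zero fun t ht => h0 t ht fun h => hn (hmem.1 (h ▸ ht))]
    simp

open scoped Classical in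
/-- The series of a weight restricted to the trees whose root is not decorated with `⊕`. -/
def notOplusSeries (P : ∀ n : ℕ, Set (SimpleGraph (Fin n))) (w : STree → ℚ) : ℚ⟦X⟧ :=
  weightSeries P fun t => if ¬ t.RootOplus then w t else 0

open scoped Classical in
/-- The series of a weight restricted to the trees whose root is not decorated with `⊖`. -/
def notOminusSeries (P : ∀ n : ℕ, Set (SimpleGraph (Fin n))) (w : STree → ℚ) : ℚ⟦X⟧ :=
  weightSeries P fun t => if ¬ t.RootOminus then w t else 0

theorem embeddings_one (m : ℕ) (G : SimpleGraph (Fin m)) (f : Fin m → ℚ) :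
    ∑ σ ∈ embeddings (⊥ : SimpleGraph (Fin 1)) G, ∏ j, f (σ j) = ∑ i, f i := by
  refine Finset.sum_bij' (fun σ _ => σ 0) (fun i _ _ => i) ?_ ?_ ?_ ?_ ?_
  · simp
  · intro i _
    exact mem_embeddings.2 ⟨Function.injective_of_subsingleton _, Subsingleton.elim _ _⟩
  · intro σ _
    funext j
    rw [Subsingleton.elim j 0]
  · simp
  · simp

/-- The occurrences of the one-vertex graph are the children themselves, so recursions that sum over
the children also fall under `weightSeries_rootWeight`. -/
theorem rootWeight_one {Q : ∀ n : ℕ, Set (SimpleGraph (Fin n))} (u : STree → ℚ) {n : ℕ}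
    {G : SimpleGraph (Fin (n + 2))} (hG : G ∈ Q (n + 2)) (ts : Fin (n + 2) → STree) :
    rootWeight Q (⊥ : SimpleGraph (Fin 1)) (fun _ => u) (node n G ts) = ∑ i, u (ts i) := by
  rw [rootWeight, if_pos hG, embeddings_one n.succ.succ G fun i => u (ts i)]

/-- The auxiliary weight `a` is `w` restricted to ⊕ roots. In the applications it is a combination
of root weights, whose series is known. -/
theorem weightSeries_eq_notOplusSeries_add (w a : STree → ℚ) (ha : ∀ x, a (leaf x) = 0)
    (hn : ∀ n G ts, G ≠ ⊤ → a (node n G ts) = 0)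
    (h : ∀ n ts, w (node n ⊤ ts) = a (node n ⊤ ts)) :
    weightSeries P w = notOplusSeries P w + weightSeries P a := by
  rw [notOplusSeries, ← weightSeries_add]
  refine weightSeries_congr fun t _ _ => ?_
  cases t with
  | leaf x => simp [RootOplus, ha]
  | node n G ts =>
    by_cases hG : G = ⊤
    · subst hG; simp [RootOplus, h]
    · simp [RootOplus, hG, hn]

theorem weightSeries_eq_notOminusSeries_add (w a : STree → ℚ) (ha : ∀ x, a (leaf x) = 0)
    (hn : ∀ n G ts, G ≠ ⊥ → a (node n G ts) = 0)
    (h : ∀ n ts, w (node n ⊥ ts) = a (node n ⊥ ts)) :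
    weightSeries P w = notOminusSeries P w + weightSeries P a := by
  rw [notOminusSeries, ← weightSeries_add]
  refine weightSeries_congr fun t _ _ => ?_
  cases t with
  | leaf x => simp [RootOminus, ha]
  | node n G ts =>
    by_cases hG : G = ⊥
    · subst hG; simp [RootOminus, h]
    · simp [RootOminus, hG, hn]

/-- A leaf or a prime root is neither ⊕ nor ⊖ and is counted twice on the left, a linear root once.
The excess is the weight `a`. -/
theorem notOplusSeries_add_notOminusSeries
    (hprime : ∀ (n : ℕ) (G : SimpleGraph (Fin n)), G ∈ P n → IsPrime G)
    (w a : STree → ℚ) (ha : ∀ x, w (leaf x) = a (leaf x))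
    (hn : ∀ n G ts, G ∉ P (n + 2) → a (node n G ts) = 0)
    (h : ∀ n G ts, G ∈ P (n + 2) → w (node n G ts) = a (node n G ts)) :
    notOplusSeries P w + notOminusSeries P w = weightSeries P w + weightSeries P a := by
  rw [notOplusSeries, notOminusSeries, ← weightSeries_add, ← weightSeries_add]
  refine weightSeries_congr fun t _ ht => ?_
  cases t with
  | leaf x => simp [RootOminus, RootOplus, ha]
  | node n G ts =>
    by_cases hG : G ∈ P (n + 2)
    · have := not_linear_of_mem hprime hG
      rw [not_or] at this
      simp [RootOminus, RootOplus, this, h n G ts hG]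
    · rw [hn n G ts hG]
      rcases ht.1 with rfl | rfl | h'
      · simp [RootOminus, RootOplus]
      · simp [RootOminus, RootOplus, bot_ne_top]
      · exact absurd h' hG

end

end ModDec

namespace ModDec

noncomputable section

open Finset STree

variable {P : ∀ n : ℕ, Set (SimpleGraph (Fin n))}

/-! ### The equations satisfied by weighted series -/

/-- `T`, as a weighted series. -/
abbrev treeSeries (P : ∀ n : ℕ, Set (SimpleGraph (Fin n))) : ℚ⟦X⟧ := weightSeries P fun _ => 1

theorem weightSeries_const_mul (c : ℚ) (w : STree → ℚ) :
    weightSeries P (fun t => c * w t) = PowerSeries.C c * weightSeries P w := by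
  ext n
  simp only [weightSeries, PowerSeries.coeff_C_mul, PowerSeries.coeff_mk]
  rw [← Finset.mul_sum, mul_div_assoc]

theorem hasSubst_weightSeries (w : STree → ℚ) : PowerSeries.HasSubst (weightSeries P w) :=
  PowerSeries.HasSubst.of_constantCoeff_zero' (constantCoeff_weightSeries w)

theorem subst_one_eq {U : ℚ⟦X⟧} (hU : PowerSeries.HasSubst U) : (1 : ℚ⟦X⟧).subst U = (1 : ℚ⟦X⟧) := by
  rw [← PowerSeries.coe_substAlgHom hU, map_one]

theorem top_mem_completeGraphs {n : ℕ} : ⊤ ∈ completeGraphs (n + 2) := by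
  simp [completeGraphs]

theorem bot_mem_edgelessGraphs {n : ℕ} : ⊥ ∈ edgelessGraphs (n + 2) := by
  simp [edgelessGraphs]

theorem rootWeight_of_mem {Q : ∀ n : ℕ, Set (SimpleGraph (Fin n))} {q : ℕ}
    {G' : SimpleGraph (Fin q)} {v : Fin q → STree → ℚ} {n : ℕ} {G : SimpleGraph (Fin (n + 2))}
    (hG : G ∈ Q (n + 2)) {ts : Fin (n + 2) → STree} :
    rootWeight Q G' v (node n G ts) = ∑ σ ∈ embeddings G' G, ∏ j, v j (ts (σ j)) := if_pos hG

theorem weightSeries_rootWeight_completeGraphs {q : ℕ} (G' : SimpleGraph (Fin q))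
    {v : Fin q → STree → ℚ} (hv : ∀ j, LabelFree (v j)) :
    weightSeries P (rootWeight completeGraphs G' v) =
      (∏ j, notOplusSeries P (v j)) * (occSeries completeGraphs G').subst (notOplusSeries P fun _ => 1) := by
  unfold notOplusSeries
  convert weightSeries_rootWeight rootClass_completeGraphs G' v hv

theorem weightSeries_rootWeight_edgelessGraphs {q : ℕ} (G' : SimpleGraph (Fin q))
    {v : Fin q → STree → ℚ} (hv : ∀ j, LabelFree (v j)) :
    weightSeries P (rootWeight edgelessGraphs G' v) =
      (∏ j, notOminusSeries P (v j)) * (occSeries edgelessGraphs G').subst (notOminusSeries P fun _ => 1) := by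
  unfold notOminusSeries
  convert weightSeries_rootWeight rootClass_edgelessGraphs G' v hv

/-- With U = T_not⊕, a tree either is counted by U or is an ⊕ root over a set of at least two trees
counted by U: T = U + (exp U − 1 − U). -/
theorem exp_subst_notOplusSeries :
    (PowerSeries.exp ℚ).subst (notOplusSeries P fun _ => 1) = 1 + treeSeries P := by
  have hsub : PowerSeries.HasSubst (notOplusSeries P fun _ => 1) := hasSubst_weightSeries _
  have h := weightSeries_eq_notOplusSeries_add (P := P) (fun _ => 1)
    (rootWeight completeGraphs (⊥ : SimpleGraph (Fin 0)) fun j => j.elim0) (fun _ => rfl)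
    (fun n G ts hG => by simp [rootWeight, completeGraphs, hG])
    (fun n ts => by
      rw [rootWeight_of_mem top_mem_completeGraphs]
      simp only [Finset.univ_eq_empty, Finset.prod_empty]
      rw [Finset.sum_const, card_embeddings,
        occ_eq_descFactorial (fun _ _ => Subsingleton.elim _ _)]
      simp)
  rw [weightSeries_rootWeight_completeGraphs _ fun j => j.elim0,
    occSeries_linear_zero (Q := completeGraphs) (lin := fun _ => ⊤) fun _ => rfl, Finset.univ_eq_empty,
    Finset.prod_empty, one_mul] at h
  rw [PowerSeries.subst_sub hsub, PowerSeries.subst_sub hsub, PowerSeries.subst_X hsub,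
    subst_one_eq hsub] at h
  rw [treeSeries, h]
  ring

/-- The same value as for ⊕. This is the origin of the symmetry between ⊕ and ⊖ in the final
formula, although `P` need not be closed under complement. -/
theorem exp_subst_notOminusSeries :
    (PowerSeries.exp ℚ).subst (notOminusSeries P fun _ => 1) = 1 + treeSeries P := by
  have hsub : PowerSeries.HasSubst (notOminusSeries P fun _ => 1) := hasSubst_weightSeries _
  have h := weightSeries_eq_notOminusSeries_add (P := P) (fun _ => 1)
    (rootWeight edgelessGraphs (⊥ : SimpleGraph (Fin 0)) fun j => j.elim0) (fun _ => rfl)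
    (fun n G ts hG => by simp [rootWeight, edgelessGraphs, hG])
    (fun n ts => by
      rw [rootWeight_of_mem bot_mem_edgelessGraphs]
      simp only [Finset.univ_eq_empty, Finset.prod_empty]
      rw [Finset.sum_const, card_embeddings,
        occ_eq_descFactorial (fun _ _ => Subsingleton.elim _ _)]
      simp)
  rw [weightSeries_rootWeight_edgelessGraphs _ fun j => j.elim0,
    occSeries_linear_zero (Q := edgelessGraphs) (lin := fun _ => ⊥) fun _ => rfl, Finset.univ_eq_empty,
    Finset.prod_empty, one_mul] at h
  rw [PowerSeries.subst_sub hsub, PowerSeries.subst_sub hsub, PowerSeries.subst_X hsub,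
    subst_one_eq hsub] at h
  rw [treeSeries, h]
  ring

-- One distinguished child of an ⊕ root leaves a nonempty set of siblings, with series exp − 1 = T;
-- an occurrence of `G'` leaves an arbitrary set, with series exp = 1 + T. A pattern that is not
-- complete never occurs in a complete graph.
open scoped Classical in
theorem weightSeries_eq_of_oplus {w u : STree → ℚ} (hu : LabelFree u) {q : ℕ}
    {G' : SimpleGraph (Fin (q + 2))} {v : Fin (q + 2) → STree → ℚ} (hv : ∀ j, LabelFree (v j))
    {c : ℚ}
    (h : ∀ n ts, w (node n ⊤ ts) =
      ∑ i, u (ts i) + c * ∑ σ ∈ embeddings G' ⊤, ∏ j, v j (ts (σ j))) :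
    weightSeries P w = notOplusSeries P w + treeSeries P * notOplusSeries P u +
      if G' = ⊤ then PowerSeries.C c * (1 + treeSeries P) * ∏ j, notOplusSeries P (v j)
      else 0 := by
  have hsub : PowerSeries.HasSubst (notOplusSeries P fun _ => 1) := hasSubst_weightSeries _
  have h1 := weightSeries_eq_notOplusSeries_add (P := P) w
    (fun t => rootWeight completeGraphs (⊥ : SimpleGraph (Fin 1)) (fun _ => u) t +
      c * rootWeight completeGraphs G' v t) (fun _ => by simp [rootWeight])
    (fun n G ts hG => by simp [rootWeight, completeGraphs, hG])
    (fun n ts => by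
      rw [rootWeight_one u top_mem_completeGraphs, h,
        rootWeight_of_mem top_mem_completeGraphs])
  rw [weightSeries_add, weightSeries_const_mul, weightSeries_rootWeight_completeGraphs _
    (fun _ => hu), weightSeries_rootWeight_completeGraphs _ hv] at h1
  rw [h1]
  rw [occSeries_linear_one (Q := completeGraphs) (lin := fun _ => ⊤) fun _ => rfl, PowerSeries.subst_sub hsub,
    subst_one_eq hsub, exp_subst_notOplusSeries, Fin.prod_univ_one]
  split_ifs with hG
  · rw [hG, occSeries_linear_of_eq (Q := completeGraphs) (lin := fun _ => ⊤) (fun _ => rfl)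
      (fun _ _ hσ => comap_top_of_injective hσ), exp_subst_notOplusSeries]
    ring
  · rw [occSeries_linear_of_ne (Q := completeGraphs) (lin := fun _ => ⊤) (fun _ => rfl)
      (fun _ _ hσ => comap_top_of_injective hσ) hG, ← PowerSeries.coe_substAlgHom hsub, map_zero]
    ring

open scoped Classical in
theorem weightSeries_eq_of_ominus {w u : STree → ℚ} (hu : LabelFree u) {q : ℕ}
    {G' : SimpleGraph (Fin (q + 2))} {v : Fin (q + 2) → STree → ℚ} (hv : ∀ j, LabelFree (v j))
    {c : ℚ}
    (h : ∀ n ts, w (node n ⊥ ts) =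
      ∑ i, u (ts i) + c * ∑ σ ∈ embeddings G' ⊥, ∏ j, v j (ts (σ j))) :
    weightSeries P w = notOminusSeries P w + treeSeries P * notOminusSeries P u +
      if G' = ⊥ then PowerSeries.C c * (1 + treeSeries P) * ∏ j, notOminusSeries P (v j)
      else 0 := by
  have hsub : PowerSeries.HasSubst (notOminusSeries P fun _ => 1) := hasSubst_weightSeries _
  have h1 := weightSeries_eq_notOminusSeries_add (P := P) w
    (fun t => rootWeight edgelessGraphs (⊥ : SimpleGraph (Fin 1)) (fun _ => u) t +
      c * rootWeight edgelessGraphs G' v t) (fun _ => by simp [rootWeight])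
    (fun n G ts hG => by simp [rootWeight, edgelessGraphs, hG])
    (fun n ts => by
      rw [rootWeight_one u bot_mem_edgelessGraphs, h,
        rootWeight_of_mem bot_mem_edgelessGraphs])
  rw [weightSeries_add, weightSeries_const_mul, weightSeries_rootWeight_edgelessGraphs _
    (fun _ => hu), weightSeries_rootWeight_edgelessGraphs _ hv] at h1
  rw [h1]
  rw [occSeries_linear_one (Q := edgelessGraphs) (lin := fun _ => ⊥) fun _ => rfl, PowerSeries.subst_sub hsub,
    subst_one_eq hsub, exp_subst_notOminusSeries, Fin.prod_univ_one]
  split_ifs with hG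
  · rw [hG, occSeries_linear_of_eq (Q := edgelessGraphs) (lin := fun _ => ⊥) (fun _ => rfl)
      (fun _ σ _ => comap_bot_eq σ), exp_subst_notOminusSeries]
    ring
  · rw [occSeries_linear_of_ne (Q := edgelessGraphs) (lin := fun _ => ⊥) (fun _ => rfl)
      (fun _ σ _ => comap_bot_eq σ) hG, ← PowerSeries.coe_substAlgHom hsub, map_zero]
    ring

/-- The third equation of the system. Under a prime root the children are unrestricted, so the full
series of `u` and `v j` appear, and `l` is the contribution of the one-leaf tree. -/
theorem notOplusSeries_add_notOminusSeries_eq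
    (hprime : ∀ (n : ℕ) (G : SimpleGraph (Fin n)), G ∈ P n → IsPrime G)
    (hstable : StableByRelabeling P)
    {w u : STree → ℚ} (hu : LabelFree u) {q : ℕ}
    {G' : SimpleGraph (Fin (q + 2))} {v : Fin (q + 2) → STree → ℚ} (hv : ∀ j, LabelFree (v j))
    {c l : ℚ} (hl : ∀ x, w (leaf x) = l)
    (h : ∀ n G ts, G ∈ P (n + 2) → w (node n G ts) =
      ∑ i, u (ts i) + c * ∑ σ ∈ embeddings G' G, ∏ j, v j (ts (σ j))) :
    notOplusSeries P w + notOminusSeries P w =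
      weightSeries P w + PowerSeries.C l * PowerSeries.X +
      (occSeries P (⊥ : SimpleGraph (Fin 1))).subst (treeSeries P) * weightSeries P u +
      PowerSeries.C c * (occSeries P G').subst (treeSeries P) * ∏ j, weightSeries P (v j) := by
  have h1 := notOplusSeries_add_notOminusSeries hprime w
    (fun t => l * leafWeight t + (rootWeight P (⊥ : SimpleGraph (Fin 1)) (fun _ => u) t +
      c * rootWeight P G' v t)) (fun x => by simp [rootWeight, hl, leafWeight])
    (fun n G ts hG => by simp [rootWeight, leafWeight, hG])
    (fun n G ts hG => by
      rw [rootWeight_one u hG, h n G ts hG, rootWeight_of_mem hG]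
      simp [leafWeight])
  rw [h1, weightSeries_add, weightSeries_add, weightSeries_const_mul, weightSeries_const_mul,
    weightSeries_leafWeight, weightSeries_rootWeight (rootClass_prime hprime hstable) _ _
    (fun _ => hu), weightSeries_rootWeight (rootClass_prime hprime hstable) _ _ hv]
  simp only [if_true, Fin.prod_univ_one]
  ring

end

end ModDec

namespace ModDec

noncomputable section

open Finset STree

variable {P : ∀ n : ℕ, Set (SimpleGraph (Fin n))}

/-! ### The weights counting marked leaves, replaceable blossoms and marked trees -/

/-- The number of leaves. -/
def sizeWeight (t : STree) : ℚ := t.size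

theorem size_relabel (f : ℕ → ℕ) (t : STree) : (t.relabel f).size = t.size := by
  induction t with
  | leaf a => rfl
  | node n G ts ih => simp only [relabel, size, ih]

theorem labelFree_sizeWeight : LabelFree sizeWeight := fun f t => by
  rw [sizeWeight, size_relabel, sizeWeight]

open scoped Classical in
/-- The number of leaves that have no parent decorated with `lin`. -/
def replaceableWeight (lin : ∀ n, SimpleGraph (Fin n)) : STree → ℚ
  | .leaf _ => 1
  | .node n G ts => ∑ i,
      if G = lin (n + 2) then replaceableWeight lin (ts i) - leafWeight (ts i)
      else replaceableWeight lin (ts i)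

theorem labelFree_replaceableWeight (lin : ∀ n, SimpleGraph (Fin n)) :
    LabelFree (replaceableWeight lin) := fun f t => by
  induction t with
  | leaf a => rfl
  | node n G ts ih => simp only [relabel, replaceableWeight, ih, labelFree_leafWeight f]

/-- The paths of `N` that go through the `i`-th child of the root. -/
def tailPaths (i : ℕ) (N : Set (List ℕ)) : Set (List ℕ) := {p | i :: p ∈ N}

open scoped Classical in
/-- The number of partial injections that mark the leaves of the first tree in such a way that the
induced tree is the second one and that the nodes with a non-linear origin are those of `N`. -/
def markingWeight : STree → STree → Set (List ℕ) → ℚ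
  | .leaf _, .leaf _, _ => 1
  | .leaf _, .node _ _ _, _ => 0
  | .node _ _ ts, .leaf a, N => ∑ i, markingWeight (ts i) (.leaf a) N
  | .node _ G ts, .node k G' τs, N =>
      ∑ i, markingWeight (ts i) (.node k G' τs) N +
        (if ([] ∈ N ↔ ¬ (G = ⊤ ∨ G = ⊥)) then 1 else 0) *
          ∑ σ ∈ embeddings G' G, ∏ j, markingWeight (ts (σ j)) (τs j) (tailPaths j N)

theorem labelFree_markingWeight (τ : STree) (N : Set (List ℕ)) :
    LabelFree fun t => markingWeight t τ N := fun f t => by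
  simp only
  induction t generalizing τ N with
  | leaf a => cases τ <;> rfl
  | node n G ts ih => cases τ <;> simp only [relabel, markingWeight, ih]

theorem markingWeight_leaf (t : STree) (a : ℕ) (N : Set (List ℕ)) :
    markingWeight t (leaf a) N = sizeWeight t := by
  induction t with
  | leaf b => simp [markingWeight, sizeWeight, size]
  | node n G ts ih =>
    simp only [markingWeight, ih, sizeWeight, size]
    push_cast
    rfl

/-- Distinguishing a leaf multiplies the coefficient of degree n by n, which is the operator z d/dz.
-/
theorem weightSeries_sizeWeight_mul (w : STree → ℚ) :
    weightSeries P (fun t => sizeWeight t * w t) =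
      PowerSeries.X * PowerSeries.derivative ℚ (weightSeries P w) := by
  ext n
  have h : ∀ t ∈ treesOn P (Finset.Icc 1 n), sizeWeight t * w t = n * w t := by
    intro t ht
    rw [sizeWeight, (mem_treesOn_Icc.1 ht).2]
  rw [weightSeries, PowerSeries.coeff_mk, Finset.sum_congr rfl h, ← Finset.mul_sum]
  cases n with
  | zero => simp
  | succ n =>
    rw [PowerSeries.coeff_succ_X_mul, PowerSeries.coeff_derivative, weightSeries,
      PowerSeries.coeff_mk]
    push_cast
    ring

theorem weightSeries_sizeWeight :
    weightSeries P sizeWeight = PowerSeries.X * PowerSeries.derivative ℚ (treeSeries P) := by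
  rw [← weightSeries_sizeWeight_mul]
  simp

theorem notOplusSeries_sizeWeight :
    notOplusSeries P sizeWeight =
      PowerSeries.X * PowerSeries.derivative ℚ (notOplusSeries P fun _ => 1) := by
  rw [notOplusSeries, notOplusSeries, ← weightSeries_sizeWeight_mul]
  simp

theorem notOplusSeries_sub (w w' : STree → ℚ) :
    notOplusSeries P (fun t => w t - w' t) = notOplusSeries P w - notOplusSeries P w' := by
  rw [notOplusSeries, notOplusSeries, notOplusSeries, ← weightSeries_sub]
  refine weightSeries_congr fun t _ _ => ?_
  split_ifs <;> simp

theorem notOminusSeries_sub (w w' : STree → ℚ) :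
    notOminusSeries P (fun t => w t - w' t) = notOminusSeries P w - notOminusSeries P w' := by
  rw [notOminusSeries, notOminusSeries, notOminusSeries, ← weightSeries_sub]
  refine weightSeries_congr fun t _ _ => ?_
  split_ifs <;> simp

theorem notOplusSeries_leafWeight : notOplusSeries P leafWeight = PowerSeries.X := by
  rw [notOplusSeries, ← weightSeries_leafWeight (P := P)]
  refine weightSeries_congr fun t _ _ => ?_
  by_cases h : t.RootOplus
  · rw [if_neg (not_not.2 h)]
    cases t with
    | leaf a => exact h.elim
    | node n G ts => rfl
  · rw [if_pos h]

theorem notOminusSeries_leafWeight : notOminusSeries P leafWeight = PowerSeries.X := by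
  rw [notOminusSeries, ← weightSeries_leafWeight (P := P)]
  refine weightSeries_congr fun t _ _ => ?_
  by_cases h : t.RootOminus
  · rw [if_neg (not_not.2 h)]
    cases t with
    | leaf a => exact h.elim
    | node n G ts => rfl
  · rw [if_pos h]

theorem one_add_treeSeries_ne_zero : 1 + treeSeries P ≠ 0 := by
  intro h
  have := congrArg PowerSeries.constantCoeff h
  rw [map_add, constantCoeff_weightSeries] at this
  simp at this

/-- The series `R` of the trees with a marked leaf that has no parent decorated with `⊕`. -/
abbrev replaceableSeries (P : ∀ n : ℕ, Set (SimpleGraph (Fin n))) : ℚ⟦X⟧ :=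
  weightSeries P (replaceableWeight fun _ => ⊤)

/-- The denominator of the rational expressions of the series of trees with a marked leaf. -/
def denominator (P : ∀ n : ℕ, Set (SimpleGraph (Fin n))) : ℚ⟦X⟧ :=
  2 - (1 + treeSeries P) -
    (occSeries P (⊥ : SimpleGraph (Fin 1))).subst (treeSeries P) * (1 + treeSeries P)

theorem sizeWeight_equations
    (hprime : ∀ (n : ℕ) (G : SimpleGraph (Fin n)), G ∈ P n → IsPrime G)
    (hstable : StableByRelabeling P) :
    weightSeries P sizeWeight = (1 + treeSeries P) * notOplusSeries P sizeWeight ∧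
    weightSeries P sizeWeight = (1 + treeSeries P) * notOminusSeries P sizeWeight ∧
    weightSeries P sizeWeight * denominator P = (1 + treeSeries P) * PowerSeries.X := by
  have hv : ∀ j : Fin 2, LabelFree ((fun _ => leafWeight : Fin 2 → STree → ℚ) j) :=
    fun _ => labelFree_leafWeight
  -- With `c = 0` the pattern plays no role; `G'` and the family of leaf weights are placeholders.
  have h1 := weightSeries_eq_of_oplus (P := P) (w := sizeWeight) (u := sizeWeight) (c := 0)
    (q := 0) (G' := ⊤) labelFree_sizeWeight hv
    (fun n ts => by simp only [sizeWeight, size]; push_cast; ring)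
  have h2 := weightSeries_eq_of_ominus (P := P) (w := sizeWeight) (u := sizeWeight) (c := 0)
    (q := 0) (G' := ⊤) labelFree_sizeWeight hv
    (fun n ts => by simp only [sizeWeight, size]; push_cast; ring)
  have h3 := notOplusSeries_add_notOminusSeries_eq hprime hstable (w := sizeWeight)
    (u := sizeWeight) (c := 0) (l := 1) (q := 0) (G' := ⊤) labelFree_sizeWeight hv
    (fun _ => by simp [sizeWeight, size])
    (fun n G ts _ => by simp only [sizeWeight, size]; push_cast; ring)
  simp only [map_zero, zero_mul, ite_self, add_zero, map_one, one_mul] at h1 h2 h3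
  refine ⟨by linear_combination h1, by linear_combination h2, ?_⟩
  rw [denominator]
  -- Elimination: multiply the third equation by 1 + T and replace both restricted series by means
  -- of the first two.
  linear_combination (1 + treeSeries P) * h3 + h1 + h2

/-- Directly under an ⊕ root a leaf is not replaceable, so the recursion there runs on the weight
minus the leaf indicator. This adds a source −TX to the source (1 + T)X of the one-leaf tree, and X
remains. -/
theorem replaceableWeight_top_equations
    (hprime : ∀ (n : ℕ) (G : SimpleGraph (Fin n)), G ∈ P n → IsPrime G)
    (hstable : StableByRelabeling P) :
    (1 + treeSeries P) * (notOplusSeries P (replaceableWeight fun _ => ⊤) - PowerSeries.X) =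
      replaceableSeries P - PowerSeries.X ∧
    replaceableSeries P =
      (1 + treeSeries P) * notOminusSeries P (replaceableWeight fun _ => ⊤) ∧
    replaceableSeries P * denominator P = PowerSeries.X := by
  have hv : ∀ j : Fin 2, LabelFree ((fun _ => leafWeight : Fin 2 → STree → ℚ) j) :=
    fun _ => labelFree_leafWeight
  have hR := labelFree_replaceableWeight fun _ => ⊤
  have h1 := weightSeries_eq_of_oplus (P := P) (w := replaceableWeight fun _ => ⊤)
    (u := fun t => replaceableWeight (fun _ => ⊤) t - leafWeight t) (c := 0)
    (q := 0) (G' := ⊤) (fun f t => by simp only [hR f, labelFree_leafWeight f]) hv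
    (fun n ts => by simp [replaceableWeight])
  have h2 := weightSeries_eq_of_ominus (P := P) (w := replaceableWeight fun _ => ⊤)
    (u := replaceableWeight fun _ => ⊤) (c := 0)
    (q := 0) (G' := ⊤) hR hv
    (fun n ts => by simp [replaceableWeight, (top_ne_bot_fin _).symm])
  have h3 := notOplusSeries_add_notOminusSeries_eq hprime hstable
    (w := replaceableWeight fun _ => ⊤) (u := replaceableWeight fun _ => ⊤) (c := 0) (l := 1)
    (q := 0) (G' := ⊤) hR hv (fun _ => by simp [replaceableWeight])
    (fun n G ts hG => by
      have := not_linear_of_mem hprime hG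
      rw [not_or] at this
      simp [replaceableWeight, this])
  rw [notOplusSeries_sub, notOplusSeries_leafWeight] at h1
  simp only [map_zero, zero_mul, ite_self, add_zero, map_one, one_mul] at h1 h2 h3
  refine ⟨by linear_combination -h1, by linear_combination h2, ?_⟩
  rw [denominator]
  linear_combination (1 + treeSeries P) * h3 + h1 + h2

/-- The mirror image. The same `denominator` and the same source X appear, so the series of
⊖-replaceable leaves equals that of ⊕-replaceable ones. -/
theorem replaceableWeight_bot_equations
    (hprime : ∀ (n : ℕ) (G : SimpleGraph (Fin n)), G ∈ P n → IsPrime G)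
    (hstable : StableByRelabeling P) :
    (1 + treeSeries P) * (notOminusSeries P (replaceableWeight fun _ => ⊥) - PowerSeries.X) =
      weightSeries P (replaceableWeight fun _ => ⊥) - PowerSeries.X ∧
    weightSeries P (replaceableWeight fun _ => ⊥) =
      (1 + treeSeries P) * notOplusSeries P (replaceableWeight fun _ => ⊥) ∧
    weightSeries P (replaceableWeight fun _ => ⊥) * denominator P = PowerSeries.X := by
  have hv : ∀ j : Fin 2, LabelFree ((fun _ => leafWeight : Fin 2 → STree → ℚ) j) :=
    fun _ => labelFree_leafWeight
  have hR := labelFree_replaceableWeight fun _ => ⊥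
  have h1 := weightSeries_eq_of_ominus (P := P) (w := replaceableWeight fun _ => ⊥)
    (u := fun t => replaceableWeight (fun _ => ⊥) t - leafWeight t) (c := 0)
    (q := 0) (G' := ⊤) (fun f t => by simp only [hR f, labelFree_leafWeight f]) hv
    (fun n ts => by simp [replaceableWeight])
  have h2 := weightSeries_eq_of_oplus (P := P) (w := replaceableWeight fun _ => ⊥)
    (u := replaceableWeight fun _ => ⊥) (c := 0)
    (q := 0) (G' := ⊤) hR hv
    (fun n ts => by simp [replaceableWeight])
  have h3 := notOplusSeries_add_notOminusSeries_eq hprime hstable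
    (w := replaceableWeight fun _ => ⊥) (u := replaceableWeight fun _ => ⊥) (c := 0) (l := 1)
    (q := 0) (G' := ⊤) hR hv (fun _ => by simp [replaceableWeight])
    (fun n G ts hG => by
      have := not_linear_of_mem hprime hG
      rw [not_or] at this
      simp [replaceableWeight, this])
  rw [notOminusSeries_sub, notOminusSeries_leafWeight] at h1
  simp only [map_zero, zero_mul, ite_self, add_zero, map_one, one_mul] at h1 h2 h3
  refine ⟨by linear_combination -h1, by linear_combination h2, ?_⟩
  rw [denominator]
  linear_combination (1 + treeSeries P) * h3 + h1 + h2

open scoped Classical in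
/-- The equations for the series of the trees with an induced tree `node k G' τs`. -/
theorem markingWeight_equations
    (hprime : ∀ (n : ℕ) (G : SimpleGraph (Fin n)), G ∈ P n → IsPrime G)
    (hstable : StableByRelabeling P)
    {k : ℕ} (G' : SimpleGraph (Fin (k + 2)))
    (τs : Fin (k + 2) → STree) (N : Set (List ℕ)) :
    let w := fun t => markingWeight t (node k G' τs) N
    let v := fun (j : Fin (k + 2)) t => markingWeight t (τs j) (tailPaths j N)
    weightSeries P w = (1 + treeSeries P) * notOplusSeries P w +
      (if [] ∉ N ∧ G' = ⊤ then (1 + treeSeries P) * ∏ j, notOplusSeries P (v j) else 0) ∧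
    weightSeries P w = (1 + treeSeries P) * notOminusSeries P w +
      (if [] ∉ N ∧ G' = ⊥ then (1 + treeSeries P) * ∏ j, notOminusSeries P (v j) else 0) ∧
    notOplusSeries P w + notOminusSeries P w = weightSeries P w +
      (occSeries P (⊥ : SimpleGraph (Fin 1))).subst (treeSeries P) * weightSeries P w +
      if [] ∈ N then (occSeries P G').subst (treeSeries P) * ∏ j, weightSeries P (v j)
      else 0 := by
  intro w v
  have hw : LabelFree w := labelFree_markingWeight _ _
  have hv : ∀ j, LabelFree (v j) := fun j => labelFree_markingWeight _ _
  -- A linear root can be the origin of the root of the induced tree only if `[]` is not in `N`; for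
  -- the prime roots of `h3` the condition on `N` is reversed.
  have h1 := weightSeries_eq_of_oplus (P := P) (w := w) (u := w) (G' := G') (v := v)
    (c := if [] ∉ N then 1 else 0) hw hv
    (fun n ts => by simp [w, v, markingWeight])
  have h2 := weightSeries_eq_of_ominus (P := P) (w := w) (u := w) (G' := G') (v := v)
    (c := if [] ∉ N then 1 else 0) hw hv
    (fun n ts => by simp [w, v, markingWeight])
  have h3 := notOplusSeries_add_notOminusSeries_eq hprime hstable (w := w) (u := w) (G' := G')
    (v := v) (c := if [] ∈ N then 1 else 0) (l := 0) hw hv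
    (fun _ => by simp [w, markingWeight])
    (fun n G ts hG => by
      have := not_linear_of_mem hprime hG
      simp only [w, v, markingWeight, this, not_false_eq_true, iff_true])
  refine ⟨?_, ?_, ?_⟩
  · by_cases hN : [] ∈ N <;> by_cases hG : G' = ⊤ <;>
      simp only [hN, hG, not_true_eq_false, not_false_eq_true, if_true, if_false, and_true,
        and_false, and_self, map_one, map_zero, zero_mul, one_mul, add_zero] at h1 ⊢ <;>
      linear_combination h1
  · by_cases hN : [] ∈ N <;> by_cases hG : G' = ⊥ <;>
      simp only [hN, hG, not_true_eq_false, not_false_eq_true, if_true, if_false, and_true,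
        and_false, and_self, map_one, map_zero, zero_mul, one_mul, add_zero] at h2 ⊢ <;>
      linear_combination h2
  · by_cases hN : [] ∈ N <;>
      simp only [hN, if_true, if_false, map_one, map_zero, zero_mul, one_mul, add_zero] at h3 ⊢ <;>
      linear_combination h3

end

end ModDec

namespace ModDec

noncomputable section

open Finset STree

/-! ### Nodes of a tree and of its subtrees -/

namespace STree

section Nodes

variable {n : ℕ} (G : SimpleGraph (Fin (n + 2))) (ts : Fin (n + 2) → STree)

theorem subtreeAt_nil (t : STree) : t.subtreeAt [] = some t := by cases t <;> rfl

theorem subtreeAt_cons (i : Fin (n + 2)) (p : List ℕ) :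
    (node n G ts).subtreeAt ((i : ℕ) :: p) = (ts i).subtreeAt p := by
  simp [subtreeAt]

theorem subtreeAt_cons_of_le {i : ℕ} (hi : ¬ i < n + 2) (p : List ℕ) :
    (node n G ts).subtreeAt (i :: p) = none := by
  simp [subtreeAt, hi]

theorem cons_mem_internalNodes (i : Fin (n + 2)) (p : List ℕ) :
    (i : ℕ) :: p ∈ (node n G ts).internalNodes ↔ p ∈ (ts i).internalNodes := by
  simp only [internalNodes, Set.mem_ofPred_eq, subtreeAt_cons]

theorem cons_mem_oplusNodes (i : Fin (n + 2)) (p : List ℕ) :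
    (i : ℕ) :: p ∈ (node n G ts).oplusNodes ↔ p ∈ (ts i).oplusNodes := by
  simp only [oplusNodes, Set.mem_ofPred_eq, subtreeAt_cons]

theorem cons_mem_ominusNodes (i : Fin (n + 2)) (p : List ℕ) :
    (i : ℕ) :: p ∈ (node n G ts).ominusNodes ↔ p ∈ (ts i).ominusNodes := by
  simp only [ominusNodes, Set.mem_ofPred_eq, subtreeAt_cons]

theorem cons_mem_leafNodes (i : Fin (n + 2)) (p : List ℕ) :
    (i : ℕ) :: p ∈ (node n G ts).leafNodes ↔ p ∈ (ts i).leafNodes := by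
  simp only [leafNodes, Set.mem_ofPred_eq, subtreeAt_cons]

theorem cons_mem_nonlinearNodes (i : Fin (n + 2)) (p : List ℕ) :
    (i : ℕ) :: p ∈ (node n G ts).nonlinearNodes ↔ p ∈ (ts i).nonlinearNodes := by
  simp only [nonlinearNodes, Set.mem_sdiff, Set.mem_union, cons_mem_internalNodes,
    cons_mem_oplusNodes, cons_mem_ominusNodes]

theorem dec_cons (i : Fin (n + 2)) (p : List ℕ) :
    (node n G ts).dec ((i : ℕ) :: p) = (ts i).dec p := by
  simp only [dec, subtreeAt_cons]

theorem lt_of_cons_mem_internalNodes {i : ℕ} {p : List ℕ}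
    (h : i :: p ∈ (node n G ts).internalNodes) : i < n + 2 := by
  by_contra hi
  obtain ⟨_, _, _, h⟩ := h
  rw [subtreeAt_cons_of_le G ts hi] at h
  cases h

theorem nil_mem_internalNodes : [] ∈ (node n G ts).internalNodes :=
  ⟨n, G, ts, subtreeAt_nil _⟩

theorem nil_mem_oplusNodes : [] ∈ (node n G ts).oplusNodes ↔ G = ⊤ := by
  simp [oplusNodes, subtreeAt_nil, RootOplus]

theorem nil_mem_ominusNodes : [] ∈ (node n G ts).ominusNodes ↔ G = ⊥ := by
  simp [ominusNodes, subtreeAt_nil, RootOminus]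

theorem nil_mem_nonlinearNodes : [] ∈ (node n G ts).nonlinearNodes ↔ ¬ (G = ⊤ ∨ G = ⊥) := by
  simp only [nonlinearNodes, Set.mem_sdiff, nil_mem_internalNodes, true_and, Set.mem_union,
    nil_mem_oplusNodes, nil_mem_ominusNodes]

theorem internalNodes_leaf (a : ℕ) : (leaf a).internalNodes = ∅ := by
  ext p
  simp only [internalNodes, Set.mem_ofPred_eq, Set.mem_empty_iff_false, iff_false]
  rintro ⟨n, G, ts, h⟩
  cases p <;> cases h

end Nodes

/-! ### Marks and induced trees -/

theorem mem_marks {I : ℕ ≃. ℕ} {t : STree} {b : ℕ} :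
    b ∈ marks I t ↔ ∃ a ∈ t.labels, b ∈ I a := by
  simp [marks]

theorem marks_node (I : ℕ ≃. ℕ) {n : ℕ} (G : SimpleGraph (Fin (n + 2)))
    (ts : Fin (n + 2) → STree) :
    marks I (node n G ts) = Finset.univ.biUnion fun i => marks I (ts i) := by
  ext b
  simp only [mem_marks, labels, Finset.mem_biUnion, Finset.mem_univ, true_and]
  exact ⟨fun ⟨a, ⟨i, hi⟩, h⟩ => ⟨i, a, hi, h⟩, fun ⟨i, a, hi, h⟩ => ⟨a, ⟨i, hi⟩, h⟩⟩

theorem marks_congr {I I' : ℕ ≃. ℕ} {t : STree} (h : ∀ a ∈ t.labels, I a = I' a) :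
    marks I t = marks I' t := by
  ext b
  simp only [mem_marks]
  exact exists_congr fun a => and_congr_right fun ha => by rw [h a ha]

theorem disjoint_marks {I : ℕ ≃. ℕ} {t t' : STree} (h : Disjoint t.labels t'.labels) :
    Disjoint (marks I t) (marks I t') := by
  rw [Finset.disjoint_left]
  intro b hb hb'
  obtain ⟨a, ha, h1⟩ := mem_marks.1 hb
  obtain ⟨a', ha', h2⟩ := mem_marks.1 hb'
  exact Finset.disjoint_left.1 h ha (I.inj h1 h2 ▸ ha')

theorem mem_markedChildren {I : ℕ ≃. ℕ} {m : ℕ} {ts : Fin m → STree} {i : Fin m} :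
    i ∈ markedChildren I ts ↔ (marks I (ts i)).Nonempty := by
  simp [markedChildren]

/-- `σ` enumerates the marked trees of the family `ts` by increasing minimal mark. -/
structure IsMarkedOrder (I : ℕ ≃. ℕ) {m : ℕ} (ts : Fin m → STree) {k : ℕ} (σ : Fin k → Fin m) :
    Prop where
  mem_range : ∀ i, (∃ j, σ j = i) ↔ (marks I (ts i)).Nonempty
  strictMono : StrictMono fun j => (marks I (ts (σ j))).min

section MarkedOrder

variable {I : ℕ ≃. ℕ} {m : ℕ} {ts : Fin m → STree} {k : ℕ} {σ σ' : Fin k → Fin m}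

theorem IsMarkedOrder.injective (h : IsMarkedOrder I ts σ) : Function.Injective σ :=
  fun i j hij => h.strictMono.injective (by simp only [hij])

theorem IsMarkedOrder.card_eq (h : IsMarkedOrder I ts σ) : (markedChildren I ts).card = k := by
  have : markedChildren I ts = Finset.univ.image σ := by
    ext i
    rw [mem_markedChildren, ← h.mem_range]
    simp
  rw [this, Finset.card_image_of_injective _ h.injective]
  simp

/-- Distinct children have disjoint, nonempty sets of marks when they are enumerated, hence distinct
minimal marks, and there is only one increasing enumeration. -/
theorem IsMarkedOrder.eq (hd : ∀ i j, i ≠ j → Disjoint (ts i).labels (ts j).labels)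
    (h : IsMarkedOrder I ts σ) (h' : IsMarkedOrder I ts σ') : σ = σ' := by
  have hr : Set.range σ = Set.range σ' := by
    ext i
    exact (h.mem_range i).trans (h'.mem_range i).symm
  have hf : (fun j => (marks I (ts (σ j))).min) = fun j => (marks I (ts (σ' j))).min := by
    rw [← StrictMono.range_inj h.strictMono h'.strictMono]
    have := congrArg (fun s => (fun i => (marks I (ts i)).min) '' s) hr
    rwa [← Set.range_comp, ← Set.range_comp] at this
  funext j
  by_contra hne
  exact min_ne_min_of_disjoint ((h.mem_range _).1 ⟨j, rfl⟩) (disjoint_marks (hd _ _ hne))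
    (congrFun hf j)

theorem isMarkedOrder_markedOrder (hd : ∀ i j, i ≠ j → Disjoint (ts i).labels (ts j).labels)
    (h : (markedChildren I ts).card = k) : IsMarkedOrder I ts (markedOrder I ts h) where
  mem_range i := by
    rw [← mem_markedChildren]
    constructor
    · rintro ⟨j, rfl⟩
      exact Finset.orderEmbOfFin_mem _ h _
    · intro hi
      obtain ⟨j, rfl⟩ : i ∈ Set.range ((markedChildren I ts).orderEmbOfFin h) := by
        rw [Finset.range_orderEmbOfFin]
        exact hi
      refine ⟨(Tuple.sort fun j => (marks I (ts ((markedChildren I ts).orderEmbOfFin h j))).min).symm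
        j, ?_⟩
      simp [markedOrder]
  strictMono := by
    set e := (markedChildren I ts).orderEmbOfFin h with he
    have hinj : Function.Injective fun j => (marks I (ts (e j))).min := fun i j hij => by
      by_contra hne
      exact min_ne_min_of_disjoint (mem_markedChildren.1 (Finset.orderEmbOfFin_mem _ h _))
        (disjoint_marks (hd _ _ fun h => hne (e.injective h))) hij
    exact (Tuple.monotone_sort fun j => (marks I (ts (e j))).min).strictMono_of_injective
      (hinj.comp (Tuple.sort _).injective)

end MarkedOrder

/-! ### Induced trees and origins, child by child -/

section Induced

variable {I : ℕ ≃. ℕ} {n : ℕ} {G : SimpleGraph (Fin (n + 2))} {ts : Fin (n + 2) → STree}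

/-- Any enumeration by increasing minimal mark may stand for `markedOrder`, with a plain arity `k +
2` instead of a cardinal from which 2 is subtracted and added back. -/
theorem induced_node {k : ℕ} {σ : Fin (k + 2) → Fin (n + 2)} (hw : (node n G ts).WellFormed)
    (h : IsMarkedOrder I ts σ) :
    (node n G ts).induced I = node k (G.comap σ) fun j => (ts (σ j)).induced I := by
  have hc := h.card_eq
  -- The arity is generalized to a variable `c`, so that it can be identified with `k` without
  -- transport between dependent types.
  have key : ∀ c (hc' : (markedChildren I ts).card = c + 2),
      node c (G.comap (markedOrder I ts hc')) (fun j => (ts (markedOrder I ts hc' j)).induced I) =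
        node k (G.comap σ) fun j => (ts (σ j)).induced I := by
    intro c hc'
    obtain rfl : c = k := by omega
    rw [(isMarkedOrder_markedOrder hw.1 hc').eq hw.1 h]
  rw [induced, dif_pos (by omega)]
  exact key _ (by omega)

theorem phi_node_nil {k : ℕ} {σ : Fin (k + 2) → Fin (n + 2)}
    (h : IsMarkedOrder I ts σ) : (node n G ts).phi I [] = [] := by
  have hc := h.card_eq
  rw [phi]
  beta_reduce
  rw [dif_pos (by omega)]

theorem phi_node_cons {k : ℕ} {σ : Fin (k + 2) → Fin (n + 2)} (hw : (node n G ts).WellFormed)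
    (h : IsMarkedOrder I ts σ) (j : Fin (k + 2)) (p : List ℕ) :
    (node n G ts).phi I ((j : ℕ) :: p) = (σ j : ℕ) :: (ts (σ j)).phi I p := by
  have hc := h.card_eq
  have key : ∀ c (hc' : (markedChildren I ts).card = c + 2),
      (if hj : (j : ℕ) < c + 2 then
        ((markedOrder I ts hc' ⟨j, hj⟩ : ℕ) :: (ts (markedOrder I ts hc' ⟨j, hj⟩)).phi I p)
        else []) = (σ j : ℕ) :: (ts (σ j)).phi I p := by
    intro c hc'
    obtain rfl : c = k := by omega
    rw [(isMarkedOrder_markedOrder hw.1 hc').eq hw.1 h, dif_pos j.2]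
  rw [phi]
  beta_reduce
  rw [dif_pos (by omega)]
  exact key _ (by omega)

theorem card_markedChildren_eq_one {i : Fin (n + 2)}
    (h : ∀ j, (marks I (ts j)).Nonempty ↔ j = i) : markedChildren I ts = {i} := by
  ext j
  rw [mem_markedChildren, h, Finset.mem_singleton]

theorem min_singleton_of_eq {α : Type*} [LinearOrder α] {s : Finset α} {i : α} (h : s = {i})
    (hs : s.Nonempty) : s.min' hs = i := by
  subst h
  simp

theorem induced_node_single {i : Fin (n + 2)} (h : ∀ j, (marks I (ts j)).Nonempty ↔ j = i) :
    (node n G ts).induced I = (ts i).induced I := by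
  have hm := card_markedChildren_eq_one h
  rw [induced, dif_neg (by rw [hm]; simp), dif_pos (by rw [hm]; simp), min_singleton_of_eq hm]

theorem phi_node_single {i : Fin (n + 2)} (h : ∀ j, (marks I (ts j)).Nonempty ↔ j = i)
    (p : List ℕ) : (node n G ts).phi I p = (i : ℕ) :: (ts i).phi I p := by
  have hm := card_markedChildren_eq_one h
  rw [phi]
  beta_reduce
  rw [dif_neg (by rw [hm]; simp), dif_pos (by rw [hm]; simp), min_singleton_of_eq hm]

/-- The alternative behind every induction on marked trees: all marks lie below one child, or the
root is a first common ancestor of marked leaves. -/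
theorem exists_single_or_isMarkedOrder (hw : (node n G ts).WellFormed)
    (h : (marks I (node n G ts)).Nonempty) :
    (∃ i, ∀ j, (marks I (ts j)).Nonempty ↔ j = i) ∨
      ∃ k, ∃ σ : Fin (k + 2) → Fin (n + 2), IsMarkedOrder I ts σ := by
  rcases lt_or_ge (markedChildren I ts).card 2 with hc | hc
  · left
    have hne : (markedChildren I ts).Nonempty := by
      obtain ⟨b, hb⟩ := h
      rw [marks_node, Finset.mem_biUnion] at hb
      obtain ⟨i, -, hi⟩ := hb
      exact ⟨i, mem_markedChildren.2 ⟨b, hi⟩⟩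
    have := Finset.card_pos.2 hne
    obtain ⟨i, hi⟩ := Finset.card_eq_one.1 (show (markedChildren I ts).card = 1 by omega)
    exact ⟨i, fun j => by rw [← mem_markedChildren, hi, Finset.mem_singleton]⟩
  · right
    exact ⟨(markedChildren I ts).card - 2, _,
      isMarkedOrder_markedOrder hw.1 (show (markedChildren I ts).card = _ by omega)⟩

theorem nonlinearOrigin_node_single {i : Fin (n + 2)}
    (h : ∀ j, (marks I (ts j)).Nonempty ↔ j = i) :
    (node n G ts).nonlinearOrigin I = (ts i).nonlinearOrigin I := by
  ext p
  simp only [nonlinearOrigin, Set.mem_ofPred_eq, induced_node_single h, phi_node_single h,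
    cons_mem_nonlinearNodes]

theorem nil_mem_nonlinearOrigin_node {k : ℕ} {σ : Fin (k + 2) → Fin (n + 2)}
    (hw : (node n G ts).WellFormed) (h : IsMarkedOrder I ts σ) :
    [] ∈ (node n G ts).nonlinearOrigin I ↔ ¬ (G = ⊤ ∨ G = ⊥) := by
  simp only [nonlinearOrigin, Set.mem_ofPred_eq, induced_node hw h, phi_node_nil h,
    nil_mem_internalNodes, true_and, nil_mem_nonlinearNodes]

theorem tailPaths_nonlinearOrigin_node {k : ℕ} {σ : Fin (k + 2) → Fin (n + 2)}
    (hw : (node n G ts).WellFormed) (h : IsMarkedOrder I ts σ) (j : Fin (k + 2)) :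
    tailPaths j ((node n G ts).nonlinearOrigin I) = (ts (σ j)).nonlinearOrigin I := by
  ext p
  simp only [tailPaths, nonlinearOrigin, Set.mem_ofPred_eq, induced_node hw h,
    phi_node_cons hw h, cons_mem_internalNodes, cons_mem_nonlinearNodes]

/-- It recovers the marks of a subtree from its induced tree. The disjointness and the order of the
labels of τ thereby pass to the marks. -/
theorem labels_induced {t : STree} (hw : t.WellFormed) (h : (marks I t).Nonempty) :
    (t.induced I).labels = marks I t := by
  induction t with
  | leaf a =>
    obtain ⟨b, hb⟩ := h
    obtain ⟨a', ha', hb'⟩ := mem_marks.1 hb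
    obtain rfl : a' = a := by simpa [labels] using ha'
    rw [Option.mem_def] at hb'
    simp [induced, labels, marks, hb']
  | node n G ts ih =>
    rcases exists_single_or_isMarkedOrder hw h with ⟨i, hi⟩ | ⟨k, σ, hσ⟩
    · rw [induced_node_single hi, ih i (hw.2.2 i) ((hi i).2 rfl), marks_node]
      ext b
      simp only [Finset.mem_biUnion, Finset.mem_univ, true_and]
      exact ⟨fun hb => ⟨i, hb⟩, fun ⟨j, hj⟩ => (hi j).1 ⟨b, hj⟩ ▸ hj⟩
    · rw [induced_node hw hσ, labels, marks_node]
      ext b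
      simp only [Finset.mem_biUnion, Finset.mem_univ, true_and]
      constructor
      · rintro ⟨j, hj⟩
        rw [ih _ (hw.2.2 _) ((hσ.mem_range _).1 ⟨j, rfl⟩)] at hj
        exact ⟨_, hj⟩
      · rintro ⟨i, hi⟩
        obtain ⟨j, rfl⟩ := (hσ.mem_range i).2 ⟨b, hi⟩
        exact ⟨j, by rwa [ih _ (hw.2.2 _) ((hσ.mem_range _).1 ⟨j, rfl⟩)]⟩

/-- Locality: a subtree sees only the marks of its own leaves, so that a marking can be restricted
to the children and glued back. -/
theorem induced_congr {I' : ℕ ≃. ℕ} {t : STree} (hw : t.WellFormed) (hne : (marks I t).Nonempty)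
    (h : ∀ a ∈ t.labels, I a = I' a) :
    t.induced I = t.induced I' ∧ ∀ p ∈ (t.induced I).internalNodes, t.phi I p = t.phi I' p := by
  induction t with
  | leaf a => exact ⟨by simp [induced, h a (by simp [labels])], fun p _ => rfl⟩
  | node n G ts ih =>
    have hm : ∀ i, marks I (ts i) = marks I' (ts i) := fun i =>
      marks_congr fun a ha => h a (labels_subset_node G ts i ha)
    have hi : ∀ i, ∀ a ∈ (ts i).labels, I a = I' a := fun i a ha =>
      h a (labels_subset_node G ts i ha)
    rcases exists_single_or_isMarkedOrder hw hne with ⟨i, hs⟩ | ⟨k, σ, hσ⟩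
    · have hs' : ∀ j, (marks I' (ts j)).Nonempty ↔ j = i := fun j => by rw [← hm, hs]
      have := ih i (hw.2.2 i) ((hs i).2 rfl) (hi i)
      rw [induced_node_single hs, induced_node_single hs']
      refine ⟨this.1, fun p hp => ?_⟩
      rw [phi_node_single hs, phi_node_single hs', this.2 p hp]
    · have hσ' : IsMarkedOrder I' ts σ :=
        ⟨fun i => by rw [hσ.mem_range, hm], by simpa only [hm] using hσ.strictMono⟩
      have := fun j => ih (σ j) (hw.2.2 _) ((hσ.mem_range _).1 ⟨j, rfl⟩) (hi _)
      rw [induced_node hw hσ, induced_node hw hσ']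
      refine ⟨by simp only [(this _).1], fun p hp => ?_⟩
      cases p with
      | nil => rw [phi_node_nil hσ, phi_node_nil hσ']
      | cons j p =>
        lift j to Fin (k + 2) using lt_of_cons_mem_internalNodes _ _ hp
        rw [cons_mem_internalNodes] at hp
        rw [phi_node_cons hw hσ, phi_node_cons hw hσ', (this j).2 p hp]

theorem nonlinearOrigin_congr {I' : ℕ ≃. ℕ} {t : STree} (hw : t.WellFormed)
    (hne : (marks I t).Nonempty) (h : ∀ a ∈ t.labels, I a = I' a) :
    t.nonlinearOrigin I = t.nonlinearOrigin I' := by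
  obtain ⟨h1, h2⟩ := induced_congr hw hne h
  ext p
  simp only [nonlinearOrigin, Set.mem_ofPred_eq, ← h1]
  exact and_congr_right fun hp => by rw [h2 p hp]

end Induced

end STree

end

end ModDec

namespace ModDec

noncomputable section

open Finset STree

/-! ### The number of markings of a tree -/

/-- `s` is a finite set with `c` elements. -/
def HasCard {α : Type*} (s : Set α) (c : ℚ) : Prop := ∃ F : Finset α, (F : Set α) = s ∧ (F.card : ℚ) = c

theorem HasCard.ncard_eq {α : Type*} {s : Set α} {c : ℚ} (h : HasCard s c) : (s.ncard : ℚ) = c := by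
  obtain ⟨F, rfl, rfl⟩ := h
  rw [Set.ncard_coe_finset]

theorem HasCard.finite {α : Type*} {s : Set α} {c : ℚ} (h : HasCard s c) : s.Finite := by
  obtain ⟨F, rfl, rfl⟩ := h
  exact F.finite_toSet

theorem hasCard_empty {α : Type*} : HasCard (∅ : Set α) 0 := ⟨∅, by simp⟩

theorem hasCard_singleton {α : Type*} (a : α) : HasCard {a} 1 := ⟨{a}, by simp⟩

theorem HasCard.biUnion {ι α : Type*} {J : Finset ι} {s : ι → Set α} {c : ι → ℚ}
    (h : ∀ i ∈ J, HasCard (s i) (c i)) (hd : ∀ i ∈ J, ∀ j ∈ J, i ≠ j → Disjoint (s i) (s j)) :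
    HasCard (⋃ i ∈ J, s i) (∑ i ∈ J, c i) := by
  classical
  choose! F hF hc using h
  refine ⟨J.biUnion F, ?_, ?_⟩
  · rw [Finset.coe_biUnion]
    exact Set.iUnion₂_congr fun i hi => hF i hi
  · rw [Finset.card_biUnion fun i hi j hj hij => ?_]
    · push_cast
      exact Finset.sum_congr rfl hc
    · have := hd i hi j hj hij
      rwa [← hF i hi, ← hF j hj, Finset.disjoint_coe] at this

theorem HasCard.union {α : Type*} {s t : Set α} {c d : ℚ} (hs : HasCard s c) (ht : HasCard t d)
    (hd : Disjoint s t) : HasCard (s ∪ t) (c + d) := by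
  classical
  obtain ⟨F, rfl, rfl⟩ := hs
  obtain ⟨F', rfl, rfl⟩ := ht
  refine ⟨F ∪ F', by simp, ?_⟩
  rw [Finset.card_union_of_disjoint (Finset.disjoint_coe.1 hd)]
  push_cast
  rfl

theorem HasCard.pi {ι : Type*} [Fintype ι] {α : Type*} {s : ι → Set α} {c : ι → ℚ}
    (h : ∀ i, HasCard (s i) (c i)) : HasCard (Set.univ.pi s) (∏ i, c i) := by
  classical
  choose F hF hc using h
  refine ⟨Fintype.piFinset F, ?_, ?_⟩
  · rw [Fintype.coe_piFinset]
    simp only [hF]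
  · rw [Fintype.card_piFinset]
    push_cast
    exact Finset.prod_congr rfl fun i _ => hc i

theorem HasCard.of_bijOn {α β : Type*} {f : α → β} {s : Set α} {t : Set β} {c : ℚ}
    (h : HasCard t c) (hf : Set.BijOn f s t) : HasCard s c := by
  have hfin : s.Finite := hf.finite_iff_finite.2 h.finite
  refine ⟨hfin.toFinset, hfin.coe_toFinset, ?_⟩
  rw [← h.ncard_eq, ← hf.image_eq, hf.injOn.ncard_image, Set.ncard_eq_toFinset_card s hfin]

theorem exists_pequiv {R : ℕ → ℕ → Prop} (h1 : ∀ a b b', R a b → R a b' → b = b')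
    (h2 : ∀ a a' b, R a b → R a' b → a = a') : ∃ I : ℕ ≃. ℕ, ∀ a b, b ∈ I a ↔ R a b := by
  classical
  have key : ∀ {S : ℕ → ℕ → Prop}, (∀ a b b', S a b → S a b' → b = b') → ∀ a b,
      b ∈ (if h : ∃ b, S a b then some h.choose else none) ↔ S a b := by
    intro S hS a b
    split_ifs with h
    · rw [Option.mem_some_iff]
      exact ⟨fun hb => hb ▸ h.choose_spec, fun hb => hS a _ _ h.choose_spec hb⟩
    · simp only [Option.not_mem_none, false_iff]
      exact fun hb => h ⟨b, hb⟩
  refine ⟨⟨fun a => if h : ∃ b, R a b then some h.choose else none,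
    fun b => if h : ∃ a, R a b then some h.choose else none, fun a b => ?_⟩, fun a b => key h1 a b⟩
  exact (key (S := fun b a => R a b) (fun b a a' h h' => h2 a a' b h h') b a).trans
    (key h1 a b).symm

open scoped Classical in
/-- The restriction of a partial injection to a set of labels. -/
def restrict (A : Finset ℕ) (I : ℕ ≃. ℕ) : ℕ ≃. ℕ := (PEquiv.ofSet (A : Set ℕ)).trans I

theorem mem_restrict {A : Finset ℕ} {I : ℕ ≃. ℕ} {a b : ℕ} :
    b ∈ restrict A I a ↔ a ∈ A ∧ b ∈ I a := by
  classical
  rw [restrict, PEquiv.mem_trans]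
  constructor
  · rintro ⟨c, hc, hb⟩
    rw [PEquiv.mem_ofSet_iff] at hc
    obtain ⟨rfl, hc⟩ := hc
    exact ⟨hc, hb⟩
  · rintro ⟨ha, hb⟩
    exact ⟨a, PEquiv.mem_ofSet_iff.2 ⟨rfl, ha⟩, hb⟩

theorem restrict_apply {A : Finset ℕ} {I : ℕ ≃. ℕ} {a : ℕ} (ha : a ∈ A) : restrict A I a = I a := by
  ext b
  exact mem_restrict.trans (and_iff_right ha)

/-- The markings of `t` with induced tree `τ`, such that the nodes with a non-linear origin are
those of `N`. -/
def markings (t τ : STree) (N : Set (List ℕ)) : Set (ℕ ≃. ℕ) :=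
  {I | (∀ a, (I a).isSome → a ∈ t.labels) ∧ (marks I t).Nonempty ∧ t.induced I = τ ∧
    t.nonlinearOrigin I = N}

theorem marks_eq_of_mem_markings {t τ : STree} {N : Set (List ℕ)} (hw : t.WellFormed)
    {I : ℕ ≃. ℕ} (h : I ∈ markings t τ N) : marks I t = τ.labels := by
  rw [← h.2.2.1, labels_induced hw h.2.1]

/-! ### Markings of a tree from markings of the children of its root -/

section Node

variable {n : ℕ} {G : SimpleGraph (Fin (n + 2))} {ts : Fin (n + 2) → STree}

theorem mem_markings_child_iff (hw : (node n G ts).WellFormed) (i : Fin (n + 2)) (τ : STree)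
    (N : Set (List ℕ)) (I : ℕ ≃. ℕ) :
    I ∈ markings (ts i) τ N ↔ I ∈ markings (node n G ts) τ N ∧
      ∀ j, (marks I (ts j)).Nonempty ↔ j = i := by
  constructor
  · rintro ⟨h1, h2, h3, h4⟩
    have hs : ∀ j, (marks I (ts j)).Nonempty ↔ j = i := by
      intro j
      refine ⟨?_, fun h => h ▸ h2⟩
      rintro ⟨b, hb⟩
      obtain ⟨a, ha, hab⟩ := mem_marks.1 hb
      by_contra hne
      exact Finset.disjoint_left.1 (hw.1 j i hne) ha
        (h1 a (Option.isSome_iff_exists.2 ⟨b, hab⟩))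
    refine ⟨⟨fun a ha => labels_subset_node G ts i (h1 a ha), ?_, ?_, ?_⟩, hs⟩
    · rw [marks_node]
      obtain ⟨b, hb⟩ := h2
      exact ⟨b, Finset.mem_biUnion.2 ⟨i, Finset.mem_univ i, hb⟩⟩
    · rw [induced_node_single hs, h3]
    · rw [nonlinearOrigin_node_single hs, h4]
  · rintro ⟨⟨h1, h2, h3, h4⟩, hs⟩
    refine ⟨fun a ha => ?_, (hs i).2 rfl, ?_, ?_⟩
    · obtain ⟨j, -, hj⟩ := Finset.mem_biUnion.1 (h1 a ha)
      obtain ⟨b, hb⟩ := Option.isSome_iff_exists.1 ha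
      rwa [← (hs j).1 ⟨b, mem_marks.2 ⟨a, hj, hb⟩⟩]
    · rw [← h3, induced_node_single hs]
    · rw [← h4, nonlinearOrigin_node_single hs]

theorem hasCard_markings_single (hw : (node n G ts).WellFormed) (τ : STree)
    (N : Set (List ℕ)) (h : ∀ i, HasCard (markings (ts i) τ N) (markingWeight (ts i) τ N)) :
    HasCard {I | I ∈ markings (node n G ts) τ N ∧ ∃ i, ∀ j, (marks I (ts j)).Nonempty ↔ j = i}
      (∑ i, markingWeight (ts i) τ N) := by
  have := HasCard.biUnion (J := Finset.univ) (s := fun i => markings (ts i) τ N)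
    (fun i _ => h i) (fun i _ j _ hij => ?_)
  · convert this using 1
    ext I
    simp only [Set.mem_ofPred_eq, Finset.mem_univ, Set.iUnion_true, Set.mem_iUnion,
      mem_markings_child_iff hw]
    exact ⟨fun ⟨h, i, hi⟩ => ⟨i, h, hi⟩, fun ⟨i, h, hi⟩ => ⟨h, i, hi⟩⟩
  · rw [Set.disjoint_left]
    intro I hi hj
    rw [mem_markings_child_iff hw] at hi hj
    exact hij ((hj.2 i).1 ((hi.2 i).2 rfl))

/-- The markings of a tree such that the children of the root of the induced tree come from the
children `σ j` of the root. -/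
def markingsVia (ts : Fin (n + 2) → STree) {k : ℕ} (τs : Fin (k + 2) → STree)
    (N : Set (List ℕ)) (σ : Fin (k + 2) → Fin (n + 2)) : Set (ℕ ≃. ℕ) :=
  {I | (∀ a, (I a).isSome → ∃ j, a ∈ (ts (σ j)).labels) ∧
    (∀ j, (marks I (ts (σ j))).Nonempty) ∧
    ∀ j, (ts (σ j)).induced I = τs j ∧ (ts (σ j)).nonlinearOrigin I = tailPaths j N}

theorem restrict_mem_markings {t τ : STree} {N : Set (List ℕ)} {I : ℕ ≃. ℕ} (hw : t.WellFormed)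
    (h1 : (marks I t).Nonempty) (h2 : t.induced I = τ) (h3 : t.nonlinearOrigin I = N) :
    restrict t.labels I ∈ markings t τ N := by
  have h : ∀ a ∈ t.labels, I a = restrict t.labels I a := fun a ha => (restrict_apply ha).symm
  refine ⟨fun a ha => ?_, marks_congr h ▸ h1, ?_, ?_⟩
  · obtain ⟨b, hb⟩ := Option.isSome_iff_exists.1 ha
    exact (mem_restrict.1 hb).1
  · rw [← (induced_congr hw h1 h).1, h2]
  · rw [← nonlinearOrigin_congr hw h1 h, h3]

/-- Markings of the chosen children glue to a partial injection: their domains are disjoint because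
the subtrees of `t` have disjoint labels, and their images are disjoint because the subtrees of τ
do. -/
theorem bijOn_markingsVia (hw : (node n G ts).WellFormed) {k : ℕ} {G' : SimpleGraph (Fin (k + 2))}
    {τs : Fin (k + 2) → STree} (hτ : (node k G' τs).WellFormed) (N : Set (List ℕ))
    {σ : Fin (k + 2) → Fin (n + 2)} (hσ : Function.Injective σ) :
    Set.BijOn (fun I j => restrict (ts (σ j)).labels I) (markingsVia ts τs N σ)
      (Set.univ.pi fun j => markings (ts (σ j)) (τs j) (tailPaths j N)) := by
  refine ⟨fun I hI j _ => restrict_mem_markings (hw.2.2 _) (hI.2.1 j) (hI.2.2 j).1 (hI.2.2 j).2,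
    fun I hI I' hI' he => ?_, fun Is hIs => ?_⟩
  · have key : ∀ {I I' : ℕ ≃. ℕ}, I ∈ markingsVia ts τs N σ →
        (fun j => restrict (ts (σ j)).labels I) = (fun j => restrict (ts (σ j)).labels I') →
        ∀ a b, b ∈ I a → b ∈ I' a := by
      intro I I' hI he a b hb
      obtain ⟨j, hj⟩ := hI.1 a (Option.isSome_iff_exists.2 ⟨b, hb⟩)
      have : restrict (ts (σ j)).labels I = restrict (ts (σ j)).labels I' := congrFun he j
      have h2 : b ∈ restrict (ts (σ j)).labels I a := mem_restrict.2 ⟨hj, hb⟩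
      rw [this] at h2
      exact (mem_restrict.1 h2).2
    ext a b
    exact ⟨key hI he a b, key hI' he.symm a b⟩
  · have hIs' : ∀ j, Is j ∈ markings (ts (σ j)) (τs j) (tailPaths j N) := fun j => hIs j trivial
    have hlab : ∀ {j a b}, b ∈ Is j a → a ∈ (ts (σ j)).labels := fun {j a b} hb =>
      (hIs' j).1 a (Option.isSome_iff_exists.2 ⟨b, hb⟩)
    have hmark : ∀ {j a b}, b ∈ Is j a → b ∈ (τs j).labels := fun {j a b} hb => by
      rw [← marks_eq_of_mem_markings (hw.2.2 _) (hIs' j)]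
      exact mem_marks.2 ⟨a, hlab hb, hb⟩
    have hj : ∀ {i j a}, a ∈ (ts (σ i)).labels → a ∈ (ts (σ j)).labels → i = j :=
      fun {i j a} hi hj => by
        by_contra hne
        exact Finset.disjoint_left.1 (hw.1 _ _ fun h => hne (hσ h)) hi hj
    obtain ⟨I, hI⟩ := exists_pequiv (R := fun a b => ∃ j, b ∈ Is j a)
      (fun a b b' ⟨j, hb⟩ ⟨j', hb'⟩ => by
        obtain rfl := hj (hlab hb) (hlab hb')
        exact Option.mem_unique hb hb')
      (fun a a' b ⟨j, hb⟩ ⟨j', hb'⟩ => by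
        have : j = j' := by
          by_contra hne
          exact Finset.disjoint_left.1 (hτ.1 _ _ hne) (hmark hb) (hmark hb')
        subst this
        exact (Is j).inj hb hb')
    have hIj : ∀ j, ∀ a ∈ (ts (σ j)).labels, Is j a = I a := by
      intro j a ha
      ext b
      constructor
      · exact fun h => (hI a b).2 ⟨j, h⟩
      · intro h
        obtain ⟨i, hi⟩ := (hI a b).1 h
        exact hj (hlab hi) ha ▸ hi
    refine ⟨I, ⟨fun a ha => ?_, fun j => ?_, fun j => ⟨?_, ?_⟩⟩, ?_⟩
    · obtain ⟨b, hb⟩ := Option.isSome_iff_exists.1 ha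
      obtain ⟨j, hj⟩ := (hI a b).1 hb
      exact ⟨j, hlab hj⟩
    · rw [← marks_congr (hIj j)]
      exact (hIs' j).2.1
    · rw [← (induced_congr (hw.2.2 _) (hIs' j).2.1 (hIj j)).1, (hIs' j).2.2.1]
    · rw [← nonlinearOrigin_congr (hw.2.2 _) (hIs' j).2.1 (hIj j), (hIs' j).2.2.2]
    · funext j
      ext a b
      refine Iff.trans mem_restrict ?_
      constructor
      · rintro ⟨ha, hb⟩
        rwa [hIj j a ha]
      · intro hb
        exact ⟨hlab hb, (hI a b).2 ⟨j, hb⟩⟩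

/-- The marks below `σ j` are the labels of `τs j`, whose minima increase since τ is well formed. So
σ is determined by the marking, and different occurrences never produce the same one. -/
theorem isMarkedOrder_of_mem_markingsVia (hw : (node n G ts).WellFormed) {k : ℕ}
    {G' : SimpleGraph (Fin (k + 2))} {τs : Fin (k + 2) → STree}
    (hτ : (node k G' τs).WellFormed) {N : Set (List ℕ)} {σ : Fin (k + 2) → Fin (n + 2)}
    {I : ℕ ≃. ℕ} (hI : I ∈ markingsVia ts τs N σ) : IsMarkedOrder I ts σ where
  mem_range i := by
    constructor
    · rintro ⟨j, rfl⟩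
      exact hI.2.1 j
    · rintro ⟨b, hb⟩
      obtain ⟨a, ha, hab⟩ := mem_marks.1 hb
      obtain ⟨j, hj⟩ := hI.1 a (Option.isSome_iff_exists.2 ⟨b, hab⟩)
      refine ⟨j, ?_⟩
      by_contra hne
      exact Finset.disjoint_left.1 (hw.1 _ _ hne) hj ha
  strictMono := by
    have : ∀ j, marks I (ts (σ j)) = (τs j).labels := fun j => by
      rw [← (hI.2.2 j).1, labels_induced (hw.2.2 _) (hI.2.1 j)]
    simp only [this]
    exact hτ.2.1

theorem eq_iff_tailPaths {k : ℕ} {G' : SimpleGraph (Fin (k + 2))} {τs : Fin (k + 2) → STree}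
    {M N : Set (List ℕ)} (hM : M ⊆ (node k G' τs).internalNodes)
    (hN : N ⊆ (node k G' τs).internalNodes) :
    M = N ↔ ([] ∈ N ↔ [] ∈ M) ∧ ∀ j : Fin (k + 2), tailPaths j M = tailPaths j N := by
  constructor
  · rintro rfl
    exact ⟨Iff.rfl, fun _ => rfl⟩
  · rintro ⟨h1, h2⟩
    ext p
    cases p with
    | nil => exact h1.symm
    | cons j p =>
      have key : ∀ j : Fin (k + 2), (j : ℕ) :: p ∈ M ↔ (j : ℕ) :: p ∈ N := fun j =>
        Set.ext_iff.1 (h2 j) p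
      constructor
      · intro h
        -- The tails are compared only for j < k + 2; a path of `M` is internal in τ, so its first
        -- step lies in this range.
        exact (key ⟨j, lt_of_cons_mem_internalNodes _ _ (hM h)⟩).1 h
      · intro h
        exact (key ⟨j, lt_of_cons_mem_internalNodes _ _ (hN h)⟩).2 h

theorem markings_multi (hw : (node n G ts).WellFormed) {k : ℕ} {G' : SimpleGraph (Fin (k + 2))}
    {τs : Fin (k + 2) → STree} (hτ : (node k G' τs).WellFormed) {N : Set (List ℕ)}
    (hN : N ⊆ (node k G' τs).internalNodes) (I : ℕ ≃. ℕ) :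
    (I ∈ markings (node n G ts) (node k G' τs) N ∧
      ∃ k, ∃ σ : Fin (k + 2) → Fin (n + 2), IsMarkedOrder I ts σ) ↔
      ([] ∈ N ↔ ¬ (G = ⊤ ∨ G = ⊥)) ∧ ∃ σ ∈ embeddings G' G, I ∈ markingsVia ts τs N σ := by
  constructor
  · rintro ⟨⟨h1, h2, h3, h4⟩, k', σ, hσ⟩
    rw [induced_node hw hσ, STree.node.injEq] at h3
    obtain ⟨rfl, h3, h5⟩ := h3
    have h6 := congrFun (eq_of_heq h5)
    rw [← h4, nil_mem_nonlinearOrigin_node hw hσ]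
    refine ⟨Iff.rfl, σ, mem_embeddings.2 ⟨hσ.injective, eq_of_heq h3⟩, fun a ha => ?_,
      fun j => (hσ.mem_range _).1 ⟨j, rfl⟩, fun j => ⟨h6 j, ?_⟩⟩
    · obtain ⟨i, -, hi⟩ := Finset.mem_biUnion.1 (h1 a ha)
      obtain ⟨b, hb⟩ := Option.isSome_iff_exists.1 ha
      obtain ⟨j, rfl⟩ := (hσ.mem_range i).2 ⟨b, mem_marks.2 ⟨a, hi, hb⟩⟩
      exact ⟨j, hi⟩
    · rw [tailPaths_nonlinearOrigin_node hw hσ]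
  · rintro ⟨h1, σ, hσ, hI⟩
    have hI' := isMarkedOrder_of_mem_markingsVia hw hτ hI
    obtain ⟨hσ1, hσ2⟩ := mem_embeddings.1 hσ
    have hind : (node n G ts).induced I = node k G' τs := by
      rw [induced_node hw hI', hσ2]
      congr 1
      exact funext fun j => (hI.2.2 j).1
    refine ⟨⟨fun a ha => ?_, ?_, hind, ?_⟩, k, σ, hI'⟩
    · obtain ⟨j, hj⟩ := hI.1 a ha
      exact labels_subset_node G ts _ hj
    · rw [marks_node]
      obtain ⟨b, hb⟩ := hI.2.1 0
      exact ⟨b, Finset.mem_biUnion.2 ⟨σ 0, Finset.mem_univ _, hb⟩⟩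
    · rw [eq_iff_tailPaths (fun p hp => hind ▸ hp.1) hN, nil_mem_nonlinearOrigin_node hw hI']
      exact ⟨h1, fun j => by rw [tailPaths_nonlinearOrigin_node hw hI', (hI.2.2 j).2]⟩

theorem hasCard_markings_multi (hw : (node n G ts).WellFormed) {k : ℕ}
    {G' : SimpleGraph (Fin (k + 2))} {τs : Fin (k + 2) → STree}
    (hτ : (node k G' τs).WellFormed) {N : Set (List ℕ)}
    (hN : N ⊆ (node k G' τs).internalNodes)
    (h : ∀ i j, HasCard (markings (ts i) (τs j) (tailPaths j N))
      (markingWeight (ts i) (τs j) (tailPaths j N))) :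
    HasCard {I | I ∈ markings (node n G ts) (node k G' τs) N ∧
      ∃ k, ∃ σ : Fin (k + 2) → Fin (n + 2), IsMarkedOrder I ts σ} (open scoped Classical in
      (if ([] ∈ N ↔ ¬ (G = ⊤ ∨ G = ⊥)) then 1 else 0) *
          ∑ σ ∈ embeddings G' G, ∏ j, markingWeight (ts (σ j)) (τs j) (tailPaths j N)) := by
  simp only [markings_multi hw hτ hN]
  split_ifs with hc
  · have := HasCard.biUnion (J := embeddings G' G) (s := markingsVia ts τs N)
      (fun σ hσ => (HasCard.pi fun j => h (σ j) j).of_bijOn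
        (bijOn_markingsVia hw hτ N (mem_embeddings.1 hσ).1)) (fun σ hσ σ' hσ' hne => ?_)
    · rw [one_mul]
      convert this using 1
      ext I
      simp [hc]
    · rw [Set.disjoint_left]
      intro I hI hI'
      exact hne ((isMarkedOrder_of_mem_markingsVia hw hτ hI).eq hw.1
        (isMarkedOrder_of_mem_markingsVia hw hτ hI'))
  · rw [zero_mul]
    convert hasCard_empty (α := ℕ ≃. ℕ)
    ext I
    simp only [hc, false_and, Set.mem_ofPred_eq, Set.mem_empty_iff_false]

end Node

/-- Induction on `t`, since τ stays unchanged when all marks lie below one child. The two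
alternatives at the root are disjoint and match the two summands of `markingWeight`. -/
theorem hasCard_markings (t : STree) (ht : t.WellFormed) (τ : STree) (hτ : τ.WellFormed)
    (N : Set (List ℕ)) (hN : N ⊆ τ.internalNodes) :
    HasCard (markings t τ N) (markingWeight t τ N) := by
  induction t generalizing τ N with
  | leaf a =>
    cases τ with
    | leaf b =>
      -- On two leaves `markingWeight` is 1 whatever `N` is; the inclusion of `N` in the internal
      -- nodes makes this value correct.
      have hN' : N = ∅ := by
        rw [internalNodes_leaf] at hN
        exact Set.subset_empty_iff.1 hN
      have hone : ∀ I : ℕ ≃. ℕ, (leaf a).nonlinearOrigin I = ∅ := by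
        intro I
        rw [nonlinearOrigin, induced, internalNodes_leaf]
        simp
      rw [markingWeight]
      convert hasCard_singleton (PEquiv.single a b) using 1
      ext I
      simp only [Set.mem_singleton_iff]
      constructor
      · rintro ⟨h1, ⟨b', hb⟩, h3, -⟩
        obtain ⟨a', ha', hb'⟩ := mem_marks.1 hb
        obtain rfl : a' = a := by simpa [labels] using ha'
        have hb'' : I a' = some b' := hb'
        simp only [induced, hb'', Option.getD_some, STree.leaf.injEq] at h3
        subst h3
        refine PEquiv.ext fun c => ?_
        by_cases hc : c = a'
        · rw [hc, hb'', PEquiv.single_apply]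
        · rw [PEquiv.single_apply_of_ne (Ne.symm hc), ← Option.not_isSome_iff_eq_none]
          exact fun h => hc (by simpa [labels] using h1 c h)
      · rintro rfl
        refine ⟨fun c hc => ?_, ⟨b, mem_marks.2 ⟨a, by simp [labels], by simp⟩⟩, by simp [induced],
          by rw [hone, hN']⟩
        by_contra hne
        rw [PEquiv.single_apply_of_ne fun h => hne (by simp [labels, h])] at hc
        simp at hc
    | node k G' τs =>
      rw [markingWeight]
      convert hasCard_empty (α := ℕ ≃. ℕ)
      ext I
      simp only [Set.mem_empty_iff_false, iff_false]
      rintro ⟨-, -, h, -⟩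
      cases h
  | node n G ts ih =>
    cases τ with
    | leaf b =>
      rw [markingWeight]
      convert hasCard_markings_single ht (leaf b) N fun i => ih i (ht.2.2 i) _ hτ N hN using 1
      ext I
      simp only [Set.mem_ofPred_eq]
      refine ⟨fun h => ⟨h, ?_⟩, fun h => h.1⟩
      rcases exists_single_or_isMarkedOrder ht h.2.1 with h' | ⟨k, σ, h'⟩
      · exact h'
      · have := h.2.2.1
        rw [induced_node ht h'] at this
        cases this
    | node k G' τs =>
      rw [markingWeight]
      have hNj : ∀ j : Fin (k + 2), tailPaths j N ⊆ (τs j).internalNodes := fun j p hp =>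
        (cons_mem_internalNodes G' τs j p).1 (hN hp)
      convert (hasCard_markings_single ht (node k G' τs) N
        fun i => ih i (ht.2.2 i) _ hτ N hN).union
        (hasCard_markings_multi ht hτ hN fun i j => ih i (ht.2.2 i) _ (hτ.2.2 j) _ (hNj j)) ?_
        using 1
      · ext I
        simp only [Set.mem_union, Set.mem_ofPred_eq, ← and_or_left]
        refine ⟨fun h => ⟨h, exists_single_or_isMarkedOrder ht h.2.1⟩, fun h => h.1⟩
      · rw [Set.disjoint_left]
        rintro I ⟨-, i, hi⟩ ⟨-, k, σ, hσ⟩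
        have h0 := (hi _).1 ((hσ.mem_range (σ 0)).1 ⟨0, rfl⟩)
        have h1 := (hi _).1 ((hσ.mem_range (σ 1)).1 ⟨1, rfl⟩)
        have := hσ.injective (h0.trans h1.symm)
        simp at this

theorem serTtau_eq_weightSeries (P : ∀ n : ℕ, Set (SimpleGraph (Fin n))) {τ : STree}
    (hτ : τ.WellFormed) (hsize : 2 ≤ τ.size) {N : Set (List ℕ)} (hN : N ⊆ τ.internalNodes) :
    serTtau P τ N = weightSeries P fun t => markingWeight t τ N := by
  ext n
  rw [serTtau, egf, weightSeries, PowerSeries.coeff_mk, PowerSeries.coeff_mk]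
  congr 1
  have h := HasCard.biUnion (J := treesOn P (Finset.Icc 1 n))
    (s := fun t => Prod.mk t '' markings t τ N) (c := fun t => markingWeight t τ N)
    (fun t ht => ?_) (fun t _ t' _ hne => ?_)
  · rw [← h.ncard_eq]
    congr 2
    ext ⟨t, I⟩
    simp only [Set.mem_ofPred_eq, markedTreeClass, Set.mem_iUnion, Set.mem_image, Prod.mk.injEq,
      exists_prop]
    constructor
    · rintro ⟨⟨h1, h2, h3, h4⟩, h5⟩
      have ht := mem_treesOn_Icc.2 ⟨h1, h5⟩
      refine ⟨t, ht, I, ⟨h2, ?_, h3, h4⟩, rfl, rfl⟩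
      -- Without any mark the induced tree takes the default value `leaf 0`, which has size 1; the
      -- bound on the size of τ rules this out.
      by_contra hne
      have hne' : ∀ s : STree, s.labels ⊆ t.labels → marks I s = ∅ := fun s hs => by
        rw [Finset.not_nonempty_iff_eq_empty] at hne
        rw [Finset.eq_empty_iff_forall_notMem] at hne ⊢
        intro b hb
        obtain ⟨a, ha, hab⟩ := mem_marks.1 hb
        exact hne b (mem_marks.2 ⟨a, hs ha, hab⟩)
      have : t.induced I = leaf 0 := by
        cases t with
        | leaf a =>
          have : I a = none := by
            rw [← Option.not_isSome_iff_eq_none, Option.isSome_iff_exists]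
            rintro ⟨b, hb⟩
            exact hne ⟨b, mem_marks.2 ⟨a, by simp [labels], hb⟩⟩
          simp [induced, this]
        | node m G ts =>
          have hm : markedChildren I ts = ∅ := by
            ext i
            simp [mem_markedChildren, hne' (ts i) (labels_subset_node G ts i)]
          rw [induced, dif_neg (by simp [hm]), dif_neg (by simp [hm])]
      rw [this] at h3
      rw [← h3] at hsize
      simp [size] at hsize
    · rintro ⟨t', ht, I', ⟨h1, -, h3, h4⟩, rfl, rfl⟩
      obtain ⟨h5, h6⟩ := mem_treesOn_Icc.1 ht
      exact ⟨⟨h5, h1, h3, h4⟩, h6⟩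
  · refine HasCard.of_bijOn (f := Prod.snd)
      (hasCard_markings t (mem_treesOn.1 ht).1.1 τ hτ N hN) ⟨?_, ?_, ?_⟩
    · rintro _ ⟨I, hI, rfl⟩
      exact hI
    · rintro _ ⟨I, hI, rfl⟩ _ ⟨I', hI', rfl⟩ h
      exact congrArg (Prod.mk t) h
    · intro I hI
      exact ⟨(t, I), ⟨I, hI, rfl⟩, rfl⟩
  · rw [Set.disjoint_left]
    rintro _ ⟨I, hI, rfl⟩ ⟨I', hI', h⟩
    exact hne (congrArg Prod.fst h).symm

end

end ModDec

namespace ModDec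

noncomputable section

open Finset STree

/-! ### Blossomed trees -/

namespace BTree

/-- The root is an internal node decorated with `⊖`. -/
def RootOminus : BTree → Prop
  | blossom => False
  | node _ G _ _ => G = ⊥

/-- The conditions on labels satisfied by the trees obtained by blossoming. -/
def WellFormed : BTree → Prop
  | blossom => True
  | node _ _ b ts =>
      (∀ i, Disjoint b.labels (ts i).labels) ∧
      (∀ i j, i ≠ j → Disjoint (ts i).labels (ts j).labels) ∧
      StrictMono (fun i => (ts i).labels.min) ∧ b.WellFormed ∧ ∀ i, (ts i).WellFormed

/-- The conditions on decorations satisfied by the trees obtained by blossoming. -/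
def IsDecomposition (P : ∀ n : ℕ, Set (SimpleGraph (Fin n))) : BTree → Prop
  | blossom => True
  | node n G b ts =>
      (G = ⊤ ∨ G = ⊥ ∨ G.comap (finSuccEquiv' 0) ∈ P (n + 2)) ∧
      (G = ⊤ → ¬ b.RootOplus ∧ ∀ i, ¬ (ts i).RootOplus) ∧
      (G = ⊥ → ¬ b.RootOminus ∧ ∀ i, ¬ (ts i).RootOminus) ∧
      b.IsDecomposition P ∧ ∀ i, (ts i).IsDecomposition P

theorem labels_subset_node {n : ℕ} (G : SimpleGraph (Option (Fin (n + 1)))) (b : BTree)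
    (ts : Fin (n + 1) → STree) : b.labels ⊆ (node n G b ts).labels :=
  Finset.subset_union_left

theorem labels_child_subset_node {n : ℕ} (G : SimpleGraph (Option (Fin (n + 1)))) (b : BTree)
    (ts : Fin (n + 1) → STree) (i : Fin (n + 1)) : (ts i).labels ⊆ (node n G b ts).labels :=
  (Finset.subset_biUnion_of_mem (fun i => (ts i).labels) (Finset.mem_univ i)).trans
    Finset.subset_union_right

theorem WellFormed.card_labels {b : BTree} (h : b.WellFormed) : b.labels.card = b.size := by
  induction b with
  | blossom => rfl
  | node n G b ts ih =>
    rw [labels, size, Finset.card_union_of_disjoint, ih h.2.2.2.1,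
      Finset.card_biUnion fun i _ j _ hij => h.2.1 i j hij]
    · congr 1
      exact Finset.sum_congr rfl fun i _ => (h.2.2.2.2 i).card_labels
    · exact (Finset.disjoint_biUnion_right _ _ _).2 fun i _ => h.1 i

theorem labels_relabel (f : ℕ → ℕ) (b : BTree) : (b.relabel f).labels = b.labels.image f := by
  induction b with
  | blossom => simp [labels, relabel]
  | node n G b ts ih =>
    simp only [labels, relabel, ih, STree.labels_relabel]
    rw [Finset.image_union, Finset.biUnion_image]

theorem relabel_relabel (f g : ℕ → ℕ) (b : BTree) :
    (b.relabel f).relabel g = b.relabel fun x => g (f x) := by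
  induction b with
  | blossom => rfl
  | node n G b ts ih => simp only [relabel, ih, STree.relabel_relabel]

theorem relabel_eq_self {f : ℕ → ℕ} {b : BTree} (h : ∀ a ∈ b.labels, f a = a) :
    b.relabel f = b := by
  induction b with
  | blossom => rfl
  | node n G b ts ih =>
    simp only [relabel]
    congr 1
    · exact ih fun a ha => h a (labels_subset_node G b ts ha)
    · funext i
      exact STree.relabel_eq_self fun a ha => h a (labels_child_subset_node G b ts i ha)

theorem disjoint_image_of_injOn {f : ℕ → ℕ} {U s t : Finset ℕ} (hf : Set.InjOn f U)
    (hs : s ⊆ U) (ht : t ⊆ U) (h : Disjoint s t) : Disjoint (s.image f) (t.image f) := by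
  rw [Finset.disjoint_left]
  intro x hx hx'
  obtain ⟨a, ha, rfl⟩ := Finset.mem_image.1 hx
  obtain ⟨b, hb, hab⟩ := Finset.mem_image.1 hx'
  have := hf (ht hb) (hs ha) hab
  exact Finset.disjoint_left.1 h ha (this ▸ hb)

theorem WellFormed.relabel {f : ℕ → ℕ} {b : BTree} (h : b.WellFormed)
    (hf : StrictMonoOn f b.labels) : (b.relabel f).WellFormed := by
  induction b with
  | blossom => trivial
  | node n G b ts ih =>
    have hb := labels_subset_node G b ts
    have hi := labels_child_subset_node G b ts
    refine ⟨fun i => ?_, fun i j hij => ?_, fun i j hij => ?_, ih h.2.2.2.1 (hf.mono ?_),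
      fun i => (h.2.2.2.2 i).relabel (hf.mono ?_)⟩
    · rw [labels_relabel, STree.labels_relabel]
      exact disjoint_image_of_injOn hf.injOn hb (hi i) (h.1 i)
    · rw [STree.labels_relabel, STree.labels_relabel]
      exact disjoint_image_of_injOn hf.injOn (hi i) (hi j) (h.2.1 i j hij)
    · simp only [STree.labels_relabel]
      exact min_image_lt_min_image hf (hi i) (hi j) (labels_nonempty _) (h.2.2.1 hij)
    · exact_mod_cast hb
    · exact_mod_cast hi i

theorem rootOplus_relabel (f : ℕ → ℕ) (b : BTree) : (b.relabel f).RootOplus ↔ b.RootOplus := by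
  cases b <;> rfl

theorem rootOminus_relabel (f : ℕ → ℕ) (b : BTree) :
    (b.relabel f).RootOminus ↔ b.RootOminus := by
  cases b <;> rfl

theorem isDecomposition_relabel (P : ∀ n : ℕ, Set (SimpleGraph (Fin n))) (f : ℕ → ℕ) (b : BTree) :
    (b.relabel f).IsDecomposition P ↔ b.IsDecomposition P := by
  induction b with
  | blossom => rfl
  | node n G b ts ih =>
    simp only [relabel, IsDecomposition, ih, rootOplus_relabel, rootOminus_relabel,
      STree.rootOplus_relabel, STree.rootOminus_relabel, STree.isDecomposition_relabel]

theorem relabel_eq_blossom_iff {f : ℕ → ℕ} {b : BTree} : b.relabel f = blossom ↔ b = blossom := by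
  cases b <;> simp [relabel]

theorem oplusReplaceable_node {n : ℕ} (G : SimpleGraph (Option (Fin (n + 1)))) (b : BTree)
    (ts : Fin (n + 1) → STree) : (node n G b ts).OplusReplaceable ↔
      (b = blossom ∧ G ≠ ⊤) ∨ (b ≠ blossom ∧ b.OplusReplaceable) := by
  cases b <;> simp [OplusReplaceable]

theorem ominusReplaceable_node {n : ℕ} (G : SimpleGraph (Option (Fin (n + 1)))) (b : BTree)
    (ts : Fin (n + 1) → STree) : (node n G b ts).OminusReplaceable ↔
      (b = blossom ∧ G ≠ ⊥) ∨ (b ≠ blossom ∧ b.OminusReplaceable) := by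
  cases b <;> simp [OminusReplaceable]

theorem oplusReplaceable_relabel (f : ℕ → ℕ) (b : BTree) :
    (b.relabel f).OplusReplaceable ↔ b.OplusReplaceable := by
  induction b with
  | blossom => rfl
  | node n G b ts ih =>
    rw [relabel, oplusReplaceable_node, oplusReplaceable_node, ih]
    simp only [ne_eq, relabel_eq_blossom_iff]

theorem ominusReplaceable_relabel (f : ℕ → ℕ) (b : BTree) :
    (b.relabel f).OminusReplaceable ↔ b.OminusReplaceable := by
  induction b with
  | blossom => rfl
  | node n G b ts ih =>
    rw [relabel, ominusReplaceable_node, ominusReplaceable_node, ih]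
    simp only [ne_eq, relabel_eq_blossom_iff]

end BTree

/-! ### Blossoming is injective and surjective -/

namespace STree

/-- Only one child contains `a`, so the minimum taken in the definition of `blossomAt` is the
position of that child. -/
theorem blossomAt_node {n : ℕ} {G : SimpleGraph (Fin (n + 2))} {ts : Fin (n + 2) → STree}
    (hd : ∀ i j, i ≠ j → Disjoint (ts i).labels (ts j).labels) {a : ℕ} {i : Fin (n + 2)}
    (ha : a ∈ (ts i).labels) :
    (node n G ts).blossomAt a = .node n (G.comap (finSuccEquiv' i).symm) ((ts i).blossomAt a)
      fun j => ts (i.succAbove j) := by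
  have hs : (Finset.univ.filter fun i => a ∈ (ts i).labels) = {i} := by
    ext j
    simp only [Finset.mem_filter, Finset.mem_univ, true_and, Finset.mem_singleton]
    refine ⟨fun hj => ?_, fun h => h ▸ ha⟩
    by_contra hne
    exact Finset.disjoint_left.1 (hd j i hne) hj ha
  have hne : (Finset.univ.filter fun i => a ∈ (ts i).labels).Nonempty := by simp [hs]
  rw [blossomAt, dif_pos hne]
  simp only [min_singleton_of_eq hs hne]

theorem exists_mem_child {n : ℕ} {G : SimpleGraph (Fin (n + 2))} {ts : Fin (n + 2) → STree}
    {a : ℕ} (ha : a ∈ (node n G ts).labels) : ∃ i, a ∈ (ts i).labels := by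
  simpa [labels] using ha

theorem labels_blossomAt {t : STree} (hw : t.WellFormed) {a : ℕ} (ha : a ∈ t.labels) :
    (t.blossomAt a).labels = t.labels.erase a := by
  induction t with
  | leaf b =>
    obtain rfl : a = b := by simpa [labels] using ha
    simp [blossomAt, BTree.labels, labels]
  | node n G ts ih =>
    obtain ⟨i, hi⟩ := exists_mem_child ha
    rw [blossomAt_node hw.1 hi, BTree.labels, ih i (hw.2.2 i) hi, labels]
    ext x
    simp only [Finset.mem_union, Finset.mem_erase, Finset.mem_biUnion, Finset.mem_univ, true_and,
      Fin.exists_iff_succAbove i (P := fun j => x ∈ (ts j).labels)]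
    constructor
    · rintro (⟨h1, h2⟩ | ⟨j, hj⟩)
      · exact ⟨h1, Or.inl h2⟩
      · refine ⟨?_, Or.inr ⟨j, hj⟩⟩
        rintro rfl
        exact Finset.disjoint_left.1 (hw.1 _ _ (Fin.succAbove_ne i j)) hj hi
    · rintro ⟨h1, h2 | h2⟩
      · exact Or.inl ⟨h1, h2⟩
      · exact Or.inr h2

theorem wellFormed_blossomAt {t : STree} (hw : t.WellFormed) {a : ℕ} (ha : a ∈ t.labels) :
    (t.blossomAt a).WellFormed := by
  induction t with
  | leaf b => trivial
  | node n G ts ih =>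
    obtain ⟨i, hi⟩ := exists_mem_child ha
    rw [blossomAt_node hw.1 hi]
    refine ⟨fun j => ?_, fun j j' hj => hw.1 _ _ fun h => hj (Fin.succAbove_right_injective h),
      hw.2.1.comp (Fin.strictMono_succAbove i), ih i (hw.2.2 i) hi, fun j => hw.2.2 _⟩
    rw [labels_blossomAt (hw.2.2 i) hi]
    exact Finset.disjoint_of_subset_left (Finset.erase_subset _ _)
      (hw.1 _ _ (Fin.succAbove_ne i j).symm)

theorem comap_equiv_eq_top {V W : Type*} (e : V ≃ W) (G : SimpleGraph W) :
    G.comap e = ⊤ ↔ G = ⊤ := by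
  refine ⟨fun h => ?_, fun h => h ▸ SimpleGraph.comap_top e.injective⟩
  have := congrArg (fun H => H.comap e.symm) h
  simp only [SimpleGraph.comap_comap, Equiv.self_comp_symm, SimpleGraph.comap_id] at this
  rw [this]
  exact SimpleGraph.comap_top e.symm.injective

theorem comap_equiv_eq_bot {V W : Type*} (e : V ≃ W) (G : SimpleGraph W) :
    G.comap e = ⊥ ↔ G = ⊥ := by
  refine ⟨fun h => ?_, fun h => h ▸ SimpleGraph.comap_bot e⟩
  have := congrArg (fun H => H.comap e.symm) h
  simp only [SimpleGraph.comap_comap, Equiv.self_comp_symm, SimpleGraph.comap_id] at this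
  rw [this]
  exact SimpleGraph.comap_bot _

theorem rootOplus_blossomAt {t : STree} (hw : t.WellFormed) {a : ℕ} (ha : a ∈ t.labels) :
    (t.blossomAt a).RootOplus ↔ t.RootOplus := by
  cases t with
  | leaf b => rfl
  | node n G ts =>
    obtain ⟨i, hi⟩ := exists_mem_child ha
    rw [blossomAt_node hw.1 hi]
    exact comap_equiv_eq_top _ _

theorem rootOminus_blossomAt {t : STree} (hw : t.WellFormed) {a : ℕ} (ha : a ∈ t.labels) :
    (t.blossomAt a).RootOminus ↔ t.RootOminus := by
  cases t with
  | leaf b => rfl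
  | node n G ts =>
    obtain ⟨i, hi⟩ := exists_mem_child ha
    rw [blossomAt_node hw.1 hi]
    exact comap_equiv_eq_bot _ _

/-- By stability, membership in `P` does not depend on the position given to the vertex `*`: the
definition for blossomed trees uses 0, blossoming uses the position of the child. -/
theorem comap_comap_mem_iff {P : ∀ n : ℕ, Set (SimpleGraph (Fin n))}
    (hstable : StableByRelabeling P) {n : ℕ} {V : Type*} (e e' : Fin n ≃ V)
    (G : SimpleGraph (Fin n)) : (G.comap e.symm).comap e' ∈ P n ↔ G ∈ P n := by
  rw [SimpleGraph.comap_comap]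
  have h : ⇑e.symm ∘ ⇑e' = ⇑(e'.trans e.symm) := rfl
  rw [h]
  refine ⟨fun hG => ?_, fun hG => hstable.comap_mem _ hG⟩
  have := hstable.comap_mem (e'.trans e.symm).symm hG
  rwa [SimpleGraph.comap_comap, Equiv.self_comp_symm, SimpleGraph.comap_id] at this

theorem isDecomposition_blossomAt {P : ∀ n : ℕ, Set (SimpleGraph (Fin n))}
    (hstable : StableByRelabeling P) {t : STree} (hw : t.WellFormed) {a : ℕ} (ha : a ∈ t.labels) :
    (t.blossomAt a).IsDecomposition P ↔ t.IsDecomposition P := by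
  induction t with
  | leaf b => rfl
  | node n G ts ih =>
    obtain ⟨i, hi⟩ := exists_mem_child ha
    rw [blossomAt_node hw.1 hi]
    simp only [BTree.IsDecomposition, IsDecomposition, ih i (hw.2.2 i) hi,
      rootOplus_blossomAt (hw.2.2 i) hi, rootOminus_blossomAt (hw.2.2 i) hi, comap_equiv_eq_top,
      comap_equiv_eq_bot, comap_comap_mem_iff hstable,
      Fin.forall_iff_succAbove i (P := fun j => ¬ (ts j).RootOplus),
      Fin.forall_iff_succAbove i (P := fun j => ¬ (ts j).RootOminus),
      Fin.forall_iff_succAbove i (P := fun j => (ts j).IsDecomposition P)]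

/-- The two increasing sequences have the same terms, hence are equal, and the position of the
removed term is determined. -/
theorem eq_of_strictMono_of_succAbove {α : Type*} [LinearOrder α] {m : ℕ} {f g : Fin (m + 1) → α}
    (hf : StrictMono f) (hg : StrictMono g) {i i' : Fin (m + 1)} (h0 : f i = g i')
    (h : ∀ j, f (i.succAbove j) = g (i'.succAbove j)) : i = i' := by
  have hr : Set.range f = Set.range g := by
    ext x
    simp only [Set.mem_range, Fin.exists_iff_succAbove i (P := fun j => f j = x),
      Fin.exists_iff_succAbove i' (P := fun j => g j = x), h0, h]
  have := (StrictMono.range_inj hf hg).1 hr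
  rw [this] at h0
  exact hg.injective h0

/-- A blossomed tree forgets the rank of the child containing the blossom. Once `a` is restored this
rank is forced by the order of the minimal labels. -/
theorem blossomAt_injective {a : ℕ} {t t' : STree} (hw : t.WellFormed) (hw' : t'.WellFormed)
    (ha : a ∈ t.labels) (ha' : a ∈ t'.labels) (h : t.blossomAt a = t'.blossomAt a) : t = t' := by
  induction t generalizing t' with
  | leaf b =>
    cases t' with
    | leaf b' =>
      have h1 : a = b := by simpa [labels] using ha
      have h2 : a = b' := by simpa [labels] using ha'
      rw [← h1, ← h2]
    | node n G ts =>
      obtain ⟨i, hi⟩ := exists_mem_child ha'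
      rw [blossomAt_node hw'.1 hi] at h
      cases h
  | node n G ts ih =>
    obtain ⟨i, hi⟩ := exists_mem_child ha
    rw [blossomAt_node hw.1 hi] at h
    cases t' with
    | leaf b => cases h
    | node n' G' ts' =>
      obtain ⟨i', hi'⟩ := exists_mem_child ha'
      rw [blossomAt_node hw'.1 hi', BTree.node.injEq] at h
      obtain ⟨rfl, h1, h2, h3⟩ := h
      have h1 := eq_of_heq h1
      have h3 := congrFun (eq_of_heq h3)
      have h4 := ih i (hw.2.2 i) (hw'.2.2 i') hi hi' h2
      obtain rfl : i = i' := eq_of_strictMono_of_succAbove hw.2.1 hw'.2.1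
        (by simp only [h4]) (fun j => by simp only [h3])
      have hts : ts = ts' := by
        funext j
        rcases Fin.eq_self_or_eq_succAbove i j with rfl | ⟨j, rfl⟩
        · exact h4
        · exact h3 j
      have hG : G = G' := by
        have := congrArg (fun H => H.comap (finSuccEquiv' i)) h1
        simpa only [SimpleGraph.comap_comap, Equiv.symm_comp_self, SimpleGraph.comap_id] using this
      rw [hts, hG]

theorem exists_strictMono_insertNth {α : Type*} [LinearOrder α] {m : ℕ} {f : Fin m → α}
    (hf : StrictMono f) {x : α} (hx : ∀ i, f i ≠ x) :
    ∃ i : Fin (m + 1), StrictMono (i.insertNth x f : Fin (m + 1) → α) := by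
  -- The position is the number of terms below `x`.
  set s : Finset (Fin m) := Finset.univ.filter fun i => f i < x with hs
  have hcard : s.card ≤ m := (Finset.card_le_univ s).trans (by simp)
  refine ⟨⟨s.card, by omega⟩, (Fin.strictMono_insertNth_iff _ _ _).2 ⟨hf, fun i hi => ?_,
    fun i hi => ?_⟩⟩
  · by_contra hlt
    have hsub : s ⊆ Finset.Iio i := by
      intro j hj
      rw [Finset.mem_Iio]
      by_contra hji
      exact hlt ((hf.monotone (not_lt.1 hji)).trans_lt (Finset.mem_filter.1 hj).2)
    have := Finset.card_le_card hsub
    rw [Fin.card_Iio] at this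
    simp only [Fin.lt_def, Fin.val_castSucc] at hi
    omega
  · by_contra hlt
    have hlt' : f i < x := lt_of_le_of_ne (not_lt.1 hlt) (hx i)
    have hsub : Finset.Iic i ⊆ s := by
      intro j hj
      rw [Finset.mem_Iic] at hj
      exact Finset.mem_filter.2 ⟨Finset.mem_univ _, (hf.monotone hj).trans_lt hlt'⟩
    have := Finset.card_le_card hsub
    rw [Fin.card_Iic] at this
    simp only [Fin.le_def, Fin.val_castSucc] at hi
    omega

/-- Put the leaf `a` back recursively, then insert the rebuilt child at the place imposed by its
minimal label and carry the vertex `*` of the decoration to that place. -/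
theorem exists_blossomAt_eq {b : BTree} (hw : b.WellFormed) {a : ℕ} (ha : a ∉ b.labels) :
    ∃ t : STree, t.WellFormed ∧ t.labels = insert a b.labels ∧ t.blossomAt a = b := by
  induction b with
  | blossom => exact ⟨leaf a, trivial, by simp [labels, BTree.labels], rfl⟩
  | node n G b ts ih =>
    have hab : a ∉ b.labels := fun h => ha (BTree.labels_subset_node G b ts h)
    have hai : ∀ i, a ∉ (ts i).labels := fun i h =>
      ha (BTree.labels_child_subset_node G b ts i h)
    obtain ⟨s, hs1, hs2, hs3⟩ := ih hw.2.2.2.1 hab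
    have has : a ∈ s.labels := by simp [hs2]
    have hds : ∀ j, Disjoint s.labels (ts j).labels := fun j => by
      rw [hs2, Finset.disjoint_insert_left]
      exact ⟨hai j, hw.1 j⟩
    obtain ⟨i, hi⟩ := exists_strictMono_insertNth hw.2.2.1 (x := s.labels.min)
      fun j => (min_ne_min_of_disjoint (labels_nonempty s) (hds j)).symm
    set us : Fin (n + 2) → STree := i.insertNth s ts with hus
    have hu0 : us i = s := Fin.insertNth_apply_same (α := fun _ => STree) i s ts
    have hu1 : ∀ j, us (i.succAbove j) = ts j := fun j =>
      Fin.insertNth_apply_succAbove (α := fun _ => STree) i s ts j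
    have hd : ∀ j j', j ≠ j' → Disjoint (us j).labels (us j').labels := by
      intro j j' hj
      rcases Fin.eq_self_or_eq_succAbove i j with h | ⟨k, h⟩ <;>
        rcases Fin.eq_self_or_eq_succAbove i j' with h' | ⟨k', h'⟩
      · exact absurd (h.trans h'.symm) hj
      · rw [h, h', hu0, hu1]
        exact hds k'
      · rw [h, h', hu0, hu1]
        exact (hds k).symm
      · rw [h, h', hu1, hu1]
        exact hw.2.1 _ _ fun hk => hj (by rw [h, h', hk])
    have hmin : (fun j => (us j).labels.min) = i.insertNth s.labels.min
        fun j => (ts j).labels.min := by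
      funext j
      rcases Fin.eq_self_or_eq_succAbove i j with rfl | ⟨k, rfl⟩
      · rw [hu0, Fin.insertNth_apply_same]
      · rw [hu1, Fin.insertNth_apply_succAbove]
    refine ⟨node n (G.comap (finSuccEquiv' i)) us, ⟨hd, hmin ▸ hi, fun j => ?_⟩, ?_, ?_⟩
    · rcases Fin.eq_self_or_eq_succAbove i j with rfl | ⟨k, rfl⟩
      · rw [hu0]
        exact hs1
      · rw [hu1]
        exact hw.2.2.2.2 k
    · ext x
      simp only [labels, BTree.labels, Finset.mem_biUnion, Finset.mem_univ, true_and,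
        Fin.exists_iff_succAbove i (P := fun j => x ∈ (us j).labels), hu0, hu1, hs2,
        Finset.mem_insert, Finset.mem_union, or_assoc]
    · rw [blossomAt_node hd (i := i) (hu0.symm ▸ has), SimpleGraph.comap_comap,
        Equiv.self_comp_symm, SimpleGraph.comap_id, hu0, hs3]
      simp only [hu1]

end STree

end

end ModDec

namespace ModDec

noncomputable section

open Finset STree

variable {P : ∀ n : ℕ, Set (SimpleGraph (Fin n))}

/-! ### Counting blossomed trees -/

theorem rank_Icc {n x : ℕ} (hx : x ∈ Finset.Icc 1 n) : rank (Finset.Icc 1 n) x = x := by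
  rw [Finset.mem_Icc] at hx
  have : (Finset.Icc 1 n).filter (· ≤ x) = Finset.Icc 1 x := by
    ext y
    simp only [Finset.mem_filter, Finset.mem_Icc]
    omega
  rw [rank, this]
  simp

theorem BTree.reduce_eq (b : BTree) : b.reduce = b.relabel (rank b.labels) := rfl

theorem mem_blossomedClass_iff (hstable : StableByRelabeling P) {b : BTree} {n : ℕ} :
    (b ∈ blossomedClass P ∧ b.size = n) ↔
      (b.WellFormed ∧ b.labels = Finset.Icc 1 n) ∧ b.IsDecomposition P := by
  constructor
  · rintro ⟨⟨t, ht, a, ha, rfl⟩, rfl⟩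
    have hw := wellFormed_blossomAt ht.1.1 ha
    have hw' : (t.blossoming a).WellFormed := hw.relabel (strictMonoOn_rank _)
    refine ⟨⟨hw', ?_⟩, ?_⟩
    · rw [← hw'.card_labels, STree.blossoming, BTree.reduce_eq, BTree.labels_relabel, image_rank]
      simp
    · exact (BTree.isDecomposition_relabel P _ _).2
        ((isDecomposition_blossomAt hstable ht.1.1 ha).2 ht.2)
  · rintro ⟨⟨hw, hl⟩, hd⟩
    have hsize : b.size = n := by rw [← hw.card_labels, hl]; simp
    refine ⟨?_, hsize⟩
    -- With the largest label `n + 1` as blossom, the other labels are already `1, …, n` and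
    -- reduction changes nothing.
    obtain ⟨t, h1, h2, h3⟩ := exists_blossomAt_eq hw (a := n + 1) (by simp [hl])
    have ha : n + 1 ∈ t.labels := by simp [h2]
    have ht : t ∈ treesOn P (Finset.Icc 1 (n + 1)) := by
      refine mem_treesOn.2 ⟨⟨h1, ?_⟩, (isDecomposition_blossomAt hstable h1 ha).1 (h3.symm ▸ hd)⟩
      rw [h2, hl]
      ext x
      simp only [Finset.mem_insert, Finset.mem_Icc]
      omega
    refine ⟨t, (mem_treesOn_Icc.1 ht).1, n + 1, ha, ?_⟩
    rw [STree.blossoming, h3, BTree.reduce_eq, hl]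
    refine (BTree.relabel_eq_self fun x hx => rank_Icc ?_).symm
    rwa [hl] at hx

theorem BTree.relabel_injective {f : ℕ → ℕ} {b b' : BTree} {A : Finset ℕ} (hf : Set.InjOn f A)
    (hb : b.labels = A) (hb' : b'.labels = A) (h : b.relabel f = b'.relabel f) : b = b' := by
  have := congrArg (fun c => c.relabel (Function.invFunOn f A)) h
  simp only [BTree.relabel_relabel] at this
  rwa [BTree.relabel_eq_self, BTree.relabel_eq_self] at this
  · exact fun x hx => hf.leftInvOn_invFunOn (Finset.mem_coe.2 (hb' ▸ hx))
  · exact fun x hx => hf.leftInvOn_invFunOn (Finset.mem_coe.2 (hb ▸ hx))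

theorem card_erase_Icc {n a : ℕ} (ha : a ∈ Finset.Icc 1 (n + 1)) :
    ((Finset.Icc 1 (n + 1)).erase a).card = n := by
  rw [Finset.card_erase_of_mem ha]
  simp

/-- For a prescribed `a`, undo the reduction by the inverse of the rank function on the labels other
than `a`, then put the leaf `a` back. -/
theorem exists_blossoming_eq (hstable : StableByRelabeling P) {n a : ℕ}
    (ha : a ∈ Finset.Icc 1 (n + 1)) {b : BTree} (hb : b ∈ blossomedClass P) (hn : b.size = n) :
    ∃ t ∈ treesOn P (Finset.Icc 1 (n + 1)), t.blossoming a = b := by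
  obtain ⟨⟨hw, hl⟩, hd⟩ := (mem_blossomedClass_iff hstable).1 ⟨hb, hn⟩
  set A := (Finset.Icc 1 (n + 1)).erase a with hA
  have hr := strictMonoOn_rank A
  have him : A.image (rank A) = Finset.Icc 1 n := by rw [image_rank, hA, card_erase_Icc ha]
  set g := Function.invFunOn (rank A) A with hg
  have hmono : StrictMonoOn g b.labels := by
    rw [hl, ← him]
    exact strictMonoOn_invFunOn hr
  have hlab : (b.relabel g).labels = A := by
    rw [BTree.labels_relabel, hl, ← him, image_invFunOn hr]
  obtain ⟨t, h1, h2, h3⟩ := exists_blossomAt_eq (hw.relabel hmono) (a := a) (by simp [hlab, hA])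
  have hat : a ∈ t.labels := by simp [h2]
  refine ⟨t, mem_treesOn.2 ⟨⟨h1, ?_⟩, (isDecomposition_blossomAt hstable h1 hat).1 ?_⟩, ?_⟩
  · rw [h2, hlab, hA, Finset.insert_erase ha]
  · rw [h3, BTree.isDecomposition_relabel]
    exact hd
  · rw [STree.blossoming, h3, BTree.reduce_eq, hlab, BTree.relabel_relabel]
    refine BTree.relabel_eq_self fun x hx => ?_
    rw [hl, ← him] at hx
    exact Function.invFunOn_eq (by simpa using hx)

open scoped Classical in
/-- A blossomed tree of size `n` comes from `n + 1` pairs formed by a tree and a leaf. -/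
theorem X_mul_egf_blossomedClass (hstable : StableByRelabeling P) {Q : BTree → Prop}
    (hQ : ∀ f b, Q (b.relabel f) ↔ Q b) {w : STree → ℚ}
    (hw : ∀ t : STree, t.WellFormed →
      w t = ((t.labels.filter fun a => Q (t.blossomAt a)).card : ℚ)) :
    PowerSeries.X * egf BTree.size {b ∈ blossomedClass P | Q b} = weightSeries P w := by
  ext n
  cases n with
  | zero =>
    rw [PowerSeries.coeff_zero_X_mul, PowerSeries.coeff_zero_eq_constantCoeff_apply,
      constantCoeff_weightSeries]
  | succ n =>
    rw [PowerSeries.coeff_succ_X_mul, egf, weightSeries, PowerSeries.coeff_mk,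
      PowerSeries.coeff_mk]
    have hfin : {b | b ∈ {b ∈ blossomedClass P | Q b} ∧ b.size = n}.Finite := by
      refine ((treesOn P (Finset.Icc 1 (n + 1))).finite_toSet.image
        (STree.blossoming (n + 1))).subset ?_
      rintro b ⟨⟨hb, -⟩, hn⟩
      obtain ⟨t, ht, h⟩ := exists_blossoming_eq hstable (a := n + 1) (by simp) hb hn
      exact ⟨t, ht, h⟩
    set B := hfin.toFinset with hB
    have hcard : (({b | b ∈ {b ∈ blossomedClass P | Q b} ∧ b.size = n}).ncard : ℚ) = B.card := by
      rw [Set.ncard_eq_toFinset_card _ hfin]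
    have hsum : ∑ t ∈ treesOn P (Finset.Icc 1 (n + 1)), w t = (n + 1) * (B.card : ℚ) := by
      have hbij : ((treesOn P (Finset.Icc 1 (n + 1))).sigma fun t =>
          t.labels.filter fun a => Q (t.blossomAt a)).card
            = (Finset.Icc 1 (n + 1) ×ˢ B).card := by
        -- Reduction loses the label of the blossomed leaf. Kept as a separate coordinate it makes
        -- the map bijective, which gives `n + 1` preimages for each blossomed tree.
        refine Finset.card_bij (fun x _ => (x.2, x.1.blossoming x.2)) ?_ ?_ ?_
        · rintro ⟨t, a⟩ h
          simp only [Finset.mem_sigma, Finset.mem_filter] at h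
          obtain ⟨ht, ha, hQa⟩ := h
          have ht' := mem_treesOn_Icc.1 ht
          have hl := (mem_treesOn.1 ht).1.2
          have hwf := (mem_treesOn.1 ht).1.1
          simp only [Finset.mem_product, hB, Set.Finite.mem_toFinset, Set.mem_ofPred_eq]
          have hmem : t.blossoming a ∈ blossomedClass P := ⟨t, ht'.1, a, ha, rfl⟩
          refine ⟨hl ▸ ha, ⟨hmem, (hQ _ _).2 hQa⟩, ?_⟩
          have hw' : (t.blossoming a).WellFormed :=
            (wellFormed_blossomAt hwf ha).relabel (strictMonoOn_rank _)
          rw [← hw'.card_labels, STree.blossoming, BTree.reduce_eq, BTree.labels_relabel,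
            image_rank, labels_blossomAt hwf ha, hl, card_erase_Icc (hl ▸ ha)]
          simp
        · rintro ⟨t, a⟩ h ⟨t', a'⟩ h' he
          simp only [Finset.mem_sigma, Finset.mem_filter] at h h'
          simp only [Prod.mk.injEq] at he
          obtain ⟨rfl, he⟩ := he
          obtain ⟨⟨hwf, hl⟩, -⟩ := mem_treesOn.1 h.1
          obtain ⟨⟨hwf', hl'⟩, -⟩ := mem_treesOn.1 h'.1
          have h1 := labels_blossomAt hwf h.2.1
          have h2 := labels_blossomAt hwf' h'.2.1
          rw [hl] at h1
          rw [hl'] at h2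
          rw [STree.blossoming, STree.blossoming, BTree.reduce_eq, BTree.reduce_eq, h1, h2] at he
          have := BTree.relabel_injective (strictMonoOn_rank _).injOn h1 h2 he
          rw [blossomAt_injective hwf hwf' h.2.1 h'.2.1 this]
        · rintro ⟨a, b⟩ h
          simp only [Finset.mem_product, hB, Set.Finite.mem_toFinset, Set.mem_ofPred_eq] at h
          obtain ⟨ha, ⟨hb, hQb⟩, hn⟩ := h
          obtain ⟨t, ht, hta⟩ := exists_blossoming_eq hstable ha hb hn
          refine ⟨⟨t, a⟩, ?_, by rw [hta]⟩
          simp only [Finset.mem_sigma, Finset.mem_filter]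
          refine ⟨ht, (mem_treesOn.1 ht).1.2 ▸ ha, ?_⟩
          rw [← hta] at hQb
          exact (hQ _ _).1 hQb
      rw [Finset.card_sigma, Finset.card_product, Nat.card_Icc, Nat.add_sub_cancel] at hbij
      rw [Finset.sum_congr rfl fun t ht => hw t (mem_treesOn.1 ht).1.1]
      exact_mod_cast hbij
    rw [hcard, hsum, Nat.factorial_succ]
    push_cast
    field_simp

/-! ### The series of blossomed trees -/

theorem blossomAt_eq_blossom_iff {t : STree} (hw : t.WellFormed) {a : ℕ} (ha : a ∈ t.labels) :
    t.blossomAt a = BTree.blossom ↔ ∃ b, t = leaf b := by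
  cases t with
  | leaf b => simp [blossomAt]
  | node n G ts =>
    obtain ⟨i, hi⟩ := exists_mem_child ha
    rw [blossomAt_node hw.1 hi]
    simp

-- Common treatment of ⊕ and ⊖, with `R` for replaceability. The blossom is attached to the root
-- exactly when the child containing it is a leaf, the case corrected by `leafWeight` in the
-- recursive weight.
open scoped Classical in
theorem replaceableWeight_eq_card {lin : ∀ n, SimpleGraph (Fin n)}
    {lin' : ∀ n, SimpleGraph (Option (Fin (n + 1)))} {R : BTree → Prop} (h0 : R .blossom)
    (hR : ∀ n G b ts, R (.node n G b ts) ↔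
      (b = .blossom ∧ G ≠ lin' n) ∨ (b ≠ .blossom ∧ R b))
    (hlin : ∀ n (i : Fin (n + 2)) (G : SimpleGraph (Fin (n + 2))),
      G.comap (finSuccEquiv' i).symm = lin' n ↔ G = lin (n + 2))
    {t : STree} (hw : t.WellFormed) :
    replaceableWeight lin t = ((t.labels.filter fun a => R (t.blossomAt a)).card : ℚ) := by
  induction t with
  | leaf b => simp [replaceableWeight, labels, blossomAt, h0]
  | node n G ts ih =>
    rw [replaceableWeight, labels, Finset.filter_biUnion, Finset.card_biUnion]
    · push_cast
      refine Finset.sum_congr rfl fun i _ => ?_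
      have key : ∀ a ∈ (ts i).labels, (R ((node n G ts).blossomAt a) ↔
          ((∃ b, ts i = leaf b) ∧ G ≠ lin (n + 2)) ∨
            ((¬ ∃ b, ts i = leaf b) ∧ R ((ts i).blossomAt a))) := by
        intro a ha
        rw [blossomAt_node hw.1 ha, hR, Ne, Ne, hlin, blossomAt_eq_blossom_iff (hw.2.2 i) ha]
      rw [Finset.filter_congr key]
      rw [ih i (hw.2.2 i)]
      cases ts i with
      | leaf b =>
        by_cases hG : G = lin (n + 2) <;> simp [hG, labels, blossomAt, h0, leafWeight]
      | node m H us => simp [leafWeight]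
    · intro i _ j _ hij
      exact Finset.disjoint_of_subset_left (Finset.filter_subset _ _)
        (Finset.disjoint_of_subset_right (Finset.filter_subset _ _) (hw.1 i j hij))

open scoped Classical in
theorem replaceableWeight_top_eq_card {t : STree} (hw : t.WellFormed) :
    replaceableWeight (fun _ => ⊤) t =
      ((t.labels.filter fun a => (t.blossomAt a).OplusReplaceable).card : ℚ) :=
  replaceableWeight_eq_card (lin' := fun _ => ⊤) trivial
    (fun _ G b ts => BTree.oplusReplaceable_node G b ts) (fun _ _ _ => comap_equiv_eq_top _ _) hw

open scoped Classical in
theorem replaceableWeight_bot_eq_card {t : STree} (hw : t.WellFormed) :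
    replaceableWeight (fun _ => ⊥) t =
      ((t.labels.filter fun a => (t.blossomAt a).OminusReplaceable).card : ℚ) :=
  replaceableWeight_eq_card (lin' := fun _ => ⊥) trivial
    (fun _ G b ts => BTree.ominusReplaceable_node G b ts) (fun _ _ _ => comap_equiv_eq_bot _ _) hw

theorem X_mul_serTblo (hstable : StableByRelabeling P) :
    PowerSeries.X * serTblo P = weightSeries P sizeWeight := by
  classical
  rw [← X_mul_egf_blossomedClass hstable (Q := fun _ => True) (fun _ _ => Iff.rfl)
    (fun t ht => by simp [sizeWeight, ht.card_labels])]
  simp [serTblo]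

theorem X_mul_serToplus (hstable : StableByRelabeling P) :
    PowerSeries.X * serToplus P = replaceableSeries P :=
  X_mul_egf_blossomedClass hstable (fun f b => BTree.oplusReplaceable_relabel f b)
    (fun _ ht => replaceableWeight_top_eq_card ht)

open scoped Classical in
theorem card_filter_not_rootOplus {t : STree} (hw : t.WellFormed) (Q : BTree → Prop) {c : ℚ}
    (h : c = ((t.labels.filter fun a => Q (t.blossomAt a)).card : ℚ)) :
    (if ¬ t.RootOplus then c else 0) = ((t.labels.filter fun a =>
      ¬ (t.blossomAt a).RootOplus ∧ Q (t.blossomAt a)).card : ℚ) := by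
  have : ∀ a ∈ t.labels, (¬ (t.blossomAt a).RootOplus ∧ Q (t.blossomAt a) ↔
      ¬ t.RootOplus ∧ Q (t.blossomAt a)) := fun a ha => by rw [rootOplus_blossomAt hw ha]
  rw [Finset.filter_congr this, h]
  by_cases hr : t.RootOplus <;> simp [hr]

theorem X_mul_serTnotOplusBlo (hstable : StableByRelabeling P) :
    PowerSeries.X * serTnotOplusBlo P = notOplusSeries P sizeWeight := by
  classical
  rw [notOplusSeries, ← X_mul_egf_blossomedClass hstable (Q := fun b => ¬ b.RootOplus ∧ True)
    (fun f b => by rw [BTree.rootOplus_relabel])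
    (fun t ht => by
      convert card_filter_not_rootOplus ht (fun _ => True) (c := sizeWeight t)
        (by simp [sizeWeight, ht.card_labels]))]
  simp [serTnotOplusBlo]

theorem X_mul_serTnotOplusOminus (hstable : StableByRelabeling P) :
    PowerSeries.X * serTnotOplusOminus P =
      notOplusSeries P (replaceableWeight fun _ => ⊥) := by
  classical
  rw [notOplusSeries, ← X_mul_egf_blossomedClass hstable
    (Q := fun b => ¬ b.RootOplus ∧ b.OminusReplaceable)
    (fun f b => by rw [BTree.rootOplus_relabel, BTree.ominusReplaceable_relabel])
    (fun t ht => by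
      convert card_filter_not_rootOplus ht BTree.OminusReplaceable
        (replaceableWeight_bot_eq_card ht))]
  rfl

/-- The convention excludes the tree reduced to its blossom, which comes from the one-leaf tree;
this is the term −X. -/
theorem X_mul_serTnotOplusOplus (hstable : StableByRelabeling P) :
    PowerSeries.X * serTnotOplusOplus P =
      notOplusSeries P (replaceableWeight fun _ => ⊤) - PowerSeries.X := by
  classical
  have hX : notOplusSeries P (replaceableWeight fun _ => ⊤) - PowerSeries.X =
      notOplusSeries P fun t => replaceableWeight (fun _ => ⊤) t - leafWeight t := by
    rw [notOplusSeries_sub, notOplusSeries_leafWeight]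
  rw [hX, notOplusSeries, ← X_mul_egf_blossomedClass hstable
    (Q := fun b => ¬ b.RootOplus ∧ b.OplusReplaceable ∧ b ≠ BTree.blossom)
    (fun f b => by
      rw [BTree.rootOplus_relabel, BTree.oplusReplaceable_relabel, Ne,
        BTree.relabel_eq_blossom_iff])
    (fun t ht => by
      convert card_filter_not_rootOplus ht
        (fun b => b.OplusReplaceable ∧ b ≠ BTree.blossom) ?_
      rw [replaceableWeight_top_eq_card ht]
      cases t with
      | leaf b => simp [leafWeight, labels, blossomAt, BTree.OplusReplaceable]
      | node n G ts =>
        rw [leafWeight, sub_zero]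
        congr 2
        ext a
        simp only [Finset.mem_filter]
        refine and_congr_right fun ha => (and_iff_left ?_).symm
        rw [Ne, blossomAt_eq_blossom_iff ht ha]
        simp)]
  rfl

end

end ModDec

namespace ModDec

noncomputable section

open Finset STree

variable {P : ∀ n : ℕ, Set (SimpleGraph (Fin n))}

/-! ### Relations between the series -/

theorem serT_eq_treeSeries : serT P = treeSeries P := by
  ext n
  rw [serT, egf, treeSeries, weightSeries, PowerSeries.coeff_mk, PowerSeries.coeff_mk]
  congr 1
  rw [Finset.sum_const, nsmul_eq_mul, mul_one, ← Set.ncard_coe_finset]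
  congr 2
  ext t
  exact mem_treesOn_Icc.symm

theorem serTnotOplus_eq : serTnotOplus P = notOplusSeries P fun _ => 1 := by
  classical
  ext n
  rw [serTnotOplus, notOplusSeries, egf, weightSeries, PowerSeries.coeff_mk, PowerSeries.coeff_mk]
  congr 1
  rw [← Finset.sum_filter, Finset.sum_const, nsmul_eq_mul, mul_one, ← Set.ncard_coe_finset]
  congr 2
  ext t
  simp only [Set.mem_ofPred_eq, Finset.coe_filter, mem_treesOn_Icc]
  tauto

/-- It turns exp(n_L T_not⊕) into a power of 1 + T, one factor for each linear node. -/
theorem exp_subst_smul {U : ℚ⟦X⟧} (hU : PowerSeries.HasSubst U) (n : ℕ) :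
    (PowerSeries.exp ℚ).subst ((n : ℚ) • U) = (PowerSeries.exp ℚ).subst U ^ n := by
  have hU' : PowerSeries.HasSubst ((n : ℚ) • U) := by
    rw [PowerSeries.HasSubst] at hU ⊢
    have : MvPowerSeries.constantCoeff ((n : ℚ) • U) = (n : ℚ) • MvPowerSeries.constantCoeff U := rfl
    rw [this]
    exact hU.smul _
  rw [← PowerSeries.subst_pow hU, PowerSeries.exp_pow_eq_rescale_exp]
  ext m
  rw [PowerSeries.coeff_subst' hU, PowerSeries.coeff_subst' hU']
  refine finsum_congr fun d => ?_
  rw [PowerSeries.coeff_rescale, smul_pow, PowerSeries.coeff_smul]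
  simp only [smul_eq_mul]
  ring

theorem exp_subst_smul_serTnotOplus (n : ℕ) :
    (PowerSeries.exp ℚ).subst ((n : ℚ) • serTnotOplus P) = (1 + serT P) ^ n := by
  have h : PowerSeries.HasSubst (notOplusSeries P fun _ => 1) := hasSubst_weightSeries _
  rw [serTnotOplus_eq, exp_subst_smul h, exp_subst_notOplusSeries,
    serT_eq_treeSeries]

theorem one_add_serT_ne_zero : 1 + serT P ≠ 0 := by
  rw [serT_eq_treeSeries]
  exact one_add_treeSeries_ne_zero

/-- T^⊕ is the inverse of the denominator of the system, so solving the system amounts to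
multiplying by T^⊕. -/
theorem serToplus_mul_denominator
    (hprime : ∀ (n : ℕ) (G : SimpleGraph (Fin n)), G ∈ P n → IsPrime G)
    (hstable : StableByRelabeling P) : serToplus P * denominator P = 1 := by
  have h := (replaceableWeight_top_equations hprime hstable).2.2
  rw [← X_mul_serToplus hstable] at h
  refine mul_left_cancel₀ PowerSeries.X_ne_zero ?_
  rw [← mul_assoc, h, mul_one]

theorem serTblo_eq (hprime : ∀ (n : ℕ) (G : SimpleGraph (Fin n)), G ∈ P n → IsPrime G)
    (hstable : StableByRelabeling P) : serTblo P = (1 + serT P) * serToplus P := by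
  have h := (sizeWeight_equations hprime hstable).2.2
  have hR := serToplus_mul_denominator hprime hstable
  rw [← X_mul_serTblo hstable, ← serT_eq_treeSeries] at h
  refine mul_left_cancel₀ PowerSeries.X_ne_zero ?_
  linear_combination serToplus P * h - PowerSeries.X * serTblo P * hR

theorem serTnotOplusBlo_eq (hprime : ∀ (n : ℕ) (G : SimpleGraph (Fin n)), G ∈ P n → IsPrime G)
    (hstable : StableByRelabeling P) : serTnotOplusBlo P = serToplus P := by
  have h := (sizeWeight_equations hprime hstable).1
  rw [← X_mul_serTblo hstable, ← X_mul_serTnotOplusBlo hstable, ← serT_eq_treeSeries,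
    serTblo_eq hprime hstable] at h
  refine mul_left_cancel₀ PowerSeries.X_ne_zero ?_
  refine mul_left_cancel₀ (one_add_serT_ne_zero (P := P)) ?_
  linear_combination -h

theorem one_add_serT_mul_serTnotOplusOplus
    (hprime : ∀ (n : ℕ) (G : SimpleGraph (Fin n)), G ∈ P n → IsPrime G)
    (hstable : StableByRelabeling P) :
    (1 + serT P) * serTnotOplusOplus P = serToplus P - 1 := by
  have h := (replaceableWeight_top_equations hprime hstable).1
  rw [← X_mul_serTnotOplusOplus hstable, ← X_mul_serToplus hstable, ← serT_eq_treeSeries] at h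
  refine mul_left_cancel₀ PowerSeries.X_ne_zero ?_
  linear_combination h

theorem one_add_serT_mul_serTnotOplusOminus
    (hprime : ∀ (n : ℕ) (G : SimpleGraph (Fin n)), G ∈ P n → IsPrime G)
    (hstable : StableByRelabeling P) :
    (1 + serT P) * serTnotOplusOminus P = serToplus P := by
  obtain ⟨-, h1, h2⟩ := replaceableWeight_bot_equations hprime hstable
  have hR := serToplus_mul_denominator hprime hstable
  rw [h1, ← X_mul_serTnotOplusOminus hstable, ← serT_eq_treeSeries] at h2
  refine mul_left_cancel₀ PowerSeries.X_ne_zero ?_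
  linear_combination serToplus P * h2 -
    (1 + serT P) * PowerSeries.X * serTnotOplusOminus P * hR

theorem derivative_serT (hstable : StableByRelabeling P) :
    PowerSeries.derivative ℚ (serT P) = serTblo P := by
  refine mul_left_cancel₀ PowerSeries.X_ne_zero ?_
  rw [X_mul_serTblo hstable, weightSeries_sizeWeight, serT_eq_treeSeries]

theorem derivative_serTnotOplus (hstable : StableByRelabeling P) :
    PowerSeries.derivative ℚ (serTnotOplus P) = serTnotOplusBlo P := by
  refine mul_left_cancel₀ PowerSeries.X_ne_zero ?_
  rw [X_mul_serTnotOplusBlo hstable, notOplusSeries_sizeWeight, serTnotOplus_eq]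

/-- Both restricted series, multiplied by 1 + T, give the full one, so the series for ⊖ equals the
one for ⊕ that occurs in the formula. -/
theorem notOminusSeries_sizeWeight
    (hprime : ∀ (n : ℕ) (G : SimpleGraph (Fin n)), G ∈ P n → IsPrime G)
    (hstable : StableByRelabeling P) :
    notOminusSeries P sizeWeight = PowerSeries.X * serTnotOplusBlo P := by
  obtain ⟨h1, h2, -⟩ := sizeWeight_equations hprime hstable
  rw [X_mul_serTnotOplusBlo hstable]
  exact mul_left_cancel₀ one_add_treeSeries_ne_zero (h2.symm.trans h1)

/-! ### The series of a marked tree, recursively -/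

/-- The factor of the part of the tree above the root of the induced tree. -/
def rootFactor (P : ∀ n : ℕ, Set (SimpleGraph (Fin n))) : STree → Set (List ℕ) → ℚ⟦X⟧
  | .leaf _, _ => PowerSeries.derivative ℚ (serT P)
  | .node _ _ _, N => open scoped Classical in if [] ∈ N then serTblo P else serToplus P

/-- The factor of the part of the tree above the root of the induced tree, under a linear node
with the decoration of the complete (if `b` is true) or the edgeless (if not) graphs. -/
def linearFactor (P : ∀ n : ℕ, Set (SimpleGraph (Fin n))) (b : Prop) :
    STree → Set (List ℕ) → ℚ⟦X⟧
  | .leaf _, _ => PowerSeries.derivative ℚ (serTnotOplus P)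
  | .node _ G _, N => open scoped Classical in
      if [] ∈ N then serTnotOplusBlo P
      else if (G = ⊤ ↔ b) then serTnotOplusOplus P else serTnotOplusOminus P

/-- The factor of the edge from a node decorated with `G` to its child `t`. -/
def edgeFactor (P : ∀ n : ℕ, Set (SimpleGraph (Fin n))) {n : ℕ} (G : SimpleGraph (Fin n))
    (N : Set (List ℕ)) (t : STree) (N' : Set (List ℕ)) : ℚ⟦X⟧ :=
  open scoped Classical in if [] ∈ N then rootFactor P t N' else linearFactor P (G = ⊤) t N'

/-- The series of the trees inducing a given tree without the factor of the root. -/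
def coreSeries (P : ∀ n : ℕ, Set (SimpleGraph (Fin n))) : STree → Set (List ℕ) → ℚ⟦X⟧
  | .leaf _, _ => PowerSeries.X
  | .node _ G ts, N =>
      (open scoped Classical in
        if [] ∈ N then (occSeries P G).subst (serT P) else 1 + serT P) *
      ∏ j, edgeFactor P G N (ts j) (tailPaths j N) * coreSeries P (ts j) (tailPaths j N)

section Node

variable {k : ℕ} (G : SimpleGraph (Fin (k + 2))) (ts : Fin (k + 2) → STree)

theorem rootFactor_node (N : Set (List ℕ)) :
    rootFactor P (node k G ts) N =
      open scoped Classical in if [] ∈ N then serTblo P else serToplus P := rfl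

theorem linearFactor_node (b : Prop) (N : Set (List ℕ)) :
    linearFactor P b (node k G ts) N = open scoped Classical in
      if [] ∈ N then serTnotOplusBlo P
      else if (G = ⊤ ↔ b) then serTnotOplusOplus P else serTnotOplusOminus P := rfl

theorem coreSeries_node (N : Set (List ℕ)) :
    coreSeries P (node k G ts) N =
      (open scoped Classical in
        if [] ∈ N then (occSeries P G).subst (serT P) else 1 + serT P) *
      ∏ j, edgeFactor P G N (ts j) (tailPaths j N) * coreSeries P (ts j) (tailPaths j N) := rfl

end Node

/-- Induction on τ. The three series are treated together because a linear node of τ outside `N`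
needs the restricted series of its children, a node in `N` the full ones. -/
theorem weightSeries_markingWeight
    (hprime : ∀ (n : ℕ) (G : SimpleGraph (Fin n)), G ∈ P n → IsPrime G)
    (hstable : StableByRelabeling P) (τ : STree) (N : Set (List ℕ))
    (hN : τ.nonlinearNodes ⊆ N) :
    weightSeries P (fun t => markingWeight t τ N) = rootFactor P τ N * coreSeries P τ N ∧
    notOplusSeries P (fun t => markingWeight t τ N) =
      linearFactor P True τ N * coreSeries P τ N ∧
    notOminusSeries P (fun t => markingWeight t τ N) =
      linearFactor P False τ N * coreSeries P τ N := by
  induction τ generalizing N with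
  | leaf a =>
    simp only [markingWeight_leaf, rootFactor, linearFactor, coreSeries, derivative_serT hstable,
      derivative_serTnotOplus hstable]
    refine ⟨?_, ?_, ?_⟩
    · rw [mul_comm, X_mul_serTblo hstable]
    · rw [mul_comm, X_mul_serTnotOplusBlo hstable]
    · rw [mul_comm, notOminusSeries_sizeWeight hprime hstable]
  | node k G ts ih =>
    have ih' := fun j : Fin (k + 2) => ih j (tailPaths j N) fun p hp =>
      hN ((cons_mem_nonlinearNodes G ts j p).2 hp)
    obtain ⟨h1, h2, h3⟩ := markingWeight_equations hprime hstable G ts N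
    simp only [ih'] at h1 h2 h3
    have hlin : [] ∉ N → G = ⊤ ∨ G = ⊥ := fun h => by
      by_contra hG
      exact h (hN ((nil_mem_nonlinearNodes G ts).2 hG))
    have hR := serToplus_mul_denominator hprime hstable
    have hC := one_add_serT_mul_serTnotOplusOplus hprime hstable
    have hCm := one_add_serT_mul_serTnotOplusOminus hprime hstable
    have he := one_add_serT_ne_zero (P := P)
    simp only [rootFactor_node, linearFactor_node, coreSeries_node, edgeFactor,
      serTblo_eq hprime hstable, serTnotOplusBlo_eq hprime hstable]
    rw [denominator] at hR
    rw [← serT_eq_treeSeries] at h1 h2 h3 hR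
    set M := weightSeries P fun t => markingWeight t (node k G ts) N
    set Mp := notOplusSeries P fun t => markingWeight t (node k G ts) N
    set Mm := notOminusSeries P fun t => markingWeight t (node k G ts) N
    set p := (occSeries P (⊥ : SimpleGraph (Fin 1))).subst (serT P)
    by_cases hroot : [] ∈ N
    · simp only [hroot, not_true_eq_false, false_and, if_true, if_false, add_zero] at h1 h2 h3 ⊢
      set b := (occSeries P G).subst (serT P) *
        ∏ j, rootFactor P (ts j) (tailPaths j N) * coreSeries P (ts j) (tailPaths j N)
      -- The elimination expresses M times the denominator through the source, and `hR` inverts the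
      -- denominator.
      have hM : M = (1 + serT P) * serToplus P * b := by
        linear_combination -M * hR + serToplus P * (1 + serT P) * h3 + serToplus P * h1 +
          serToplus P * h2
      refine ⟨hM, mul_left_cancel₀ he ?_, mul_left_cancel₀ he ?_⟩
      · linear_combination hM - h1
      · linear_combination hM - h2
    · rcases hlin hroot with rfl | rfl
      · simp only [hroot, top_ne_bot_fin, not_false_eq_true, and_true, and_false, if_true, if_false,
          add_zero, iff_false, not_true_eq_false] at h1 h2 h3 ⊢
        set b := (1 + serT P) *
          ∏ j, linearFactor P True (ts j) (tailPaths j N) * coreSeries P (ts j) (tailPaths j N)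
        have hM : M = serToplus P * b := by
          linear_combination -M * hR + serToplus P * (1 + serT P) * h3 + serToplus P * h1 +
            serToplus P * h2
        -- The source `b` belongs to the ⊕ equation only. So (1 + T)M⁺ = (T^⊕ − 1)b yields T_not⊕^⊕,
        -- while (1 + T)M⁻ = T^⊕ b yields T_not⊕^⊖.
        refine ⟨hM, mul_left_cancel₀ he ?_, mul_left_cancel₀ he ?_⟩
        · linear_combination hM - h1 - b * hC
        · linear_combination hM - h2 - b * hCm
      · simp only [hroot, (top_ne_bot_fin _).symm, not_false_eq_true, and_true, and_false, if_true,
          if_false, add_zero, iff_true] at h1 h2 h3 ⊢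
        set b := (1 + serT P) *
          ∏ j, linearFactor P False (ts j) (tailPaths j N) * coreSeries P (ts j) (tailPaths j N)
        have hM : M = serToplus P * b := by
          linear_combination -M * hR + serToplus P * (1 + serT P) * h3 + serToplus P * h1 +
            serToplus P * h2
        refine ⟨hM, mul_left_cancel₀ he ?_, mul_left_cancel₀ he ?_⟩
        · linear_combination hM - h1 - b * hCm
        · linear_combination hM - h2 - b * hC

end

end ModDec

namespace ModDec

noncomputable section

open Finset STree

variable {P : ∀ n : ℕ, Set (SimpleGraph (Fin n))}

/-! ### Sets of nodes and edges, recursively -/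

/-- The series `x` if `p` holds, and `1` otherwise. -/
def factorIf (p : Prop) (x : ℚ⟦X⟧) : ℚ⟦X⟧ := open scoped Classical in if p then x else 1

theorem factorIf_pos {p : Prop} (h : p) (x : ℚ⟦X⟧) : factorIf p x = x := if_pos h

theorem factorIf_neg {p : Prop} (h : ¬ p) (x : ℚ⟦X⟧) : factorIf p x = 1 := if_neg h

/-- The paths in `N` that start with `i`, without their first step. -/
def tailFinset (i : ℕ) (N : Finset (List ℕ)) : Finset (List ℕ) :=
  N.preimage (List.cons i) List.cons_injective.injOn

theorem mem_tailFinset {i : ℕ} {N : Finset (List ℕ)} {p : List ℕ} :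
    p ∈ tailFinset i N ↔ i :: p ∈ N := by
  simp [tailFinset]

theorem coe_tailFinset (i : ℕ) (N : Finset (List ℕ)) :
    (tailFinset i N : Set (List ℕ)) = tailPaths i N := by
  ext p
  exact mem_tailFinset

/-- A product over nodes splits into the root and the children of the root; the exponents of the
formula are compared with the recursion in this way. -/
theorem prod_eq_prod_tailFinset {M : Type*} [CommMonoid M] {m : ℕ} {S : Finset (List ℕ)}
    (hS : ∀ i p, i :: p ∈ S → i < m) (f : List ℕ → M) :
    ∏ p ∈ S, f p =
      (if [] ∈ S then f [] else 1) * ∏ j : Fin m, ∏ q ∈ tailFinset j S, f ((j : ℕ) :: q) := by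
  classical
  have h : S = S.filter (· = []) ∪
      Finset.univ.biUnion fun j : Fin m => (tailFinset j S).image (List.cons (j : ℕ)) := by
    ext p
    cases p with
    | nil => simp
    | cons i p =>
      simp only [Finset.mem_union, Finset.mem_filter, Finset.mem_biUnion, Finset.mem_image,
        Finset.mem_univ, true_and, mem_tailFinset, reduceCtorEq, and_false, false_or,
        List.cons.injEq]
      constructor
      · exact fun hp => ⟨⟨i, hS i p hp⟩, p, hp, rfl, rfl⟩
      · rintro ⟨j, q, hq, rfl, rfl⟩
        exact hq
  conv_lhs => rw [h]
  rw [Finset.prod_union, Finset.prod_biUnion]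
  · congr 1
    · have h : S.filter (· = []) = if [] ∈ S then {[]} else ∅ := by
        ext p
        by_cases h : [] ∈ S
        · simp only [Finset.mem_filter, h, if_true, Finset.mem_singleton, and_iff_right_iff_imp]
          rintro rfl
          exact h
        · simp only [Finset.mem_filter, h, if_false, Finset.notMem_empty, iff_false, not_and]
          rintro hp rfl
          exact h hp
      rw [h]
      split_ifs <;> simp
    · exact Finset.prod_congr rfl fun j _ => Finset.prod_image List.cons_injective.injOn
  · intro i _ j _ hij
    rw [Function.onFun, Finset.disjoint_left]
    intro p hp hp'
    obtain ⟨q, -, rfl⟩ := Finset.mem_image.1 hp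
    obtain ⟨q', -, h'⟩ := Finset.mem_image.1 hp'
    exact hij (Fin.ext (List.cons.inj h').1.symm)
  · rw [Finset.disjoint_left]
    intro p hp hp'
    obtain ⟨j, -, hj⟩ := Finset.mem_biUnion.1 hp'
    obtain ⟨q, -, rfl⟩ := Finset.mem_image.1 hj
    simp at hp

theorem pow_ncard_eq_prod {m : ℕ} {S : Set (List ℕ)} (hfin : S.Finite)
    (hS : ∀ i p, i :: p ∈ S → i < m) (x : ℚ⟦X⟧) :
    x ^ S.ncard = factorIf ([] ∈ S) x *
      ∏ j : Fin m, x ^ (tailPaths j S).ncard := by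
  lift S to Finset (List ℕ) using hfin
  have h := prod_eq_prod_tailFinset (M := ℚ⟦X⟧) hS fun _ => x
  simp only [Finset.prod_const] at h
  simp only [← coe_tailFinset, Set.ncard_coe_finset, h]
  congr 1
  simp [factorIf]

/-- The nodes of `B` that are children of nodes of `A`. -/
def childrenIn (A B : Set (List ℕ)) : Set (List ℕ) :=
  {q | q ∈ B ∧ q ≠ [] ∧ q.dropLast ∈ A}

/-- An edge is determined by its lower end, so counting edges becomes counting nodes. -/
theorem numEdges_eq_ncard (A B : Set (List ℕ)) : numEdges A B = (childrenIn A B).ncard := by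
  have h : childrenIn A B =
      Prod.snd '' {e : List ℕ × List ℕ | e.1 ∈ A ∧ e.2 ∈ B ∧ ∃ i, e.2 = e.1 ++ [i]} := by
    ext q
    constructor
    · rintro ⟨hB, hq, hA⟩
      exact ⟨(q.dropLast, q), ⟨hA, hB, q.getLast hq, (List.dropLast_append_getLast hq).symm⟩, rfl⟩
    · rintro ⟨⟨p, q⟩, ⟨hA, hB, i, hi⟩, rfl⟩
      obtain rfl : q = p ++ [i] := hi
      exact ⟨hB, by simp, by simpa using hA⟩
  rw [numEdges, h, Set.InjOn.ncard_image]
  rintro ⟨p, q⟩ ⟨-, -, i, hi⟩ ⟨p', q'⟩ ⟨-, -, i', hi'⟩ (rfl : q = q')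
  have := hi.symm.trans hi'
  obtain ⟨rfl, -⟩ := List.append_inj' this rfl
  rfl

/-- An edge starts at the root or lies inside one child; the root itself is the lower end of no
edge. -/
theorem pow_numEdges_eq_prod {m : ℕ} (A : Set (List ℕ)) {B : Set (List ℕ)} (hfin : B.Finite)
    (hB : ∀ i p, i :: p ∈ B → i < m) (x : ℚ⟦X⟧) :
    x ^ numEdges A B = ∏ j : Fin m,
      factorIf ([] ∈ A ∧ [] ∈ tailPaths j B) x *
        x ^ numEdges (tailPaths j A) (tailPaths j B) := by
  classical
  rw [numEdges_eq_ncard, pow_ncard_eq_prod (hfin.subset fun q hq => hq.1)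
    (fun i p hp => hB i p hp.1), factorIf_neg fun h => h.2.1 rfl, one_mul]
  refine Finset.prod_congr rfl fun j _ => ?_
  have hfin' : (tailPaths j B).Finite := hfin.preimage List.cons_injective.injOn
  have hsub : childrenIn (tailPaths j A) (tailPaths j B) ⊆ tailPaths j B := fun q hq => hq.1
  have hcons : ∀ q, q ≠ [] → (q ∈ tailPaths j (childrenIn A B) ↔
      q ∈ childrenIn (tailPaths j A) (tailPaths j B)) := by
    intro q hq
    simp only [tailPaths, childrenIn, Set.mem_ofPred_eq, List.dropLast_cons_of_ne_nil hq, ne_eq,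
      reduceCtorEq, not_false_eq_true, true_and, hq]
  have hnil : [] ∈ tailPaths j (childrenIn A B) ↔ [] ∈ A ∧ [] ∈ tailPaths j B := by
    simp [tailPaths, childrenIn, and_comm]
  have hnil' : [] ∉ childrenIn (tailPaths j A) (tailPaths j B) := fun h => h.2.1 rfl
  rw [numEdges_eq_ncard]
  by_cases h : [] ∈ A ∧ [] ∈ tailPaths j B
  · have : tailPaths j (childrenIn A B) =
        insert [] (childrenIn (tailPaths j A) (tailPaths j B)) := by
      ext q
      rw [Set.mem_insert_iff]
      by_cases hq : q = []
      · subst hq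
        simp only [hnil, h, and_self, true_or]
      · simp only [hcons q hq, hq, false_or]
    rw [this, Set.ncard_insert_of_notMem hnil' (hfin'.subset hsub), pow_succ,
      mul_comm, factorIf_pos h]
  · have : tailPaths j (childrenIn A B) = childrenIn (tailPaths j A) (tailPaths j B) := by
      ext q
      by_cases hq : q = []
      · subst hq
        simp only [hnil, h, hnil']
      · exact hcons q hq
    rw [this, factorIf_neg h, one_mul]

/-! ### Finiteness of the set of nodes, and nodes of the children -/

namespace STree

/-- The nodes of a tree. -/
def nodes (t : STree) : Set (List ℕ) := {p | (t.subtreeAt p).isSome}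

theorem lt_of_cons_mem_nodes {n : ℕ} {G : SimpleGraph (Fin (n + 2))} {ts : Fin (n + 2) → STree}
    {i : ℕ} {p : List ℕ} (h : i :: p ∈ (node n G ts).nodes) : i < n + 2 := by
  by_contra hi
  simp [nodes, subtreeAt_cons_of_le G ts hi] at h

theorem finite_nodes (t : STree) : t.nodes.Finite := by
  induction t with
  | leaf a =>
    refine (Set.finite_singleton []).subset fun p hp => ?_
    cases p with
    | nil => rfl
    | cons i p => simp [nodes, subtreeAt] at hp
  | node n G ts ih =>
    refine ((Set.finite_singleton []).union (Set.finite_iUnion fun j : Fin (n + 2) =>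
      (ih j).image (List.cons (j : ℕ)))).subset fun p hp => ?_
    cases p with
    | nil => exact Or.inl rfl
    | cons i p =>
      refine Or.inr (Set.mem_iUnion.2 ⟨⟨i, lt_of_cons_mem_nodes hp⟩, p, ?_, rfl⟩)
      have := subtreeAt_cons G ts ⟨i, lt_of_cons_mem_nodes hp⟩ p
      simpa [nodes, ← this] using hp

theorem internalNodes_subset_nodes (t : STree) : t.internalNodes ⊆ t.nodes := by
  rintro p ⟨n, G, ts, h⟩
  simp [nodes, h]

theorem leafNodes_subset_nodes (t : STree) : t.leafNodes ⊆ t.nodes := by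
  rintro p ⟨a, h⟩
  simp [nodes, h]

theorem oplusNodes_subset_nodes (t : STree) : t.oplusNodes ⊆ t.nodes := by
  rintro p ⟨s, h, -⟩
  simp [nodes, h]

theorem ominusNodes_subset_nodes (t : STree) : t.ominusNodes ⊆ t.nodes := by
  rintro p ⟨s, h, -⟩
  simp [nodes, h]

section Tails

variable {n : ℕ} (G : SimpleGraph (Fin (n + 2))) (ts : Fin (n + 2) → STree) (j : Fin (n + 2))

theorem tailPaths_internalNodes :
    tailPaths j (node n G ts).internalNodes = (ts j).internalNodes :=
  Set.ext fun p => cons_mem_internalNodes G ts j p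

theorem tailPaths_leafNodes : tailPaths j (node n G ts).leafNodes = (ts j).leafNodes :=
  Set.ext fun p => cons_mem_leafNodes G ts j p

theorem tailPaths_oplusNodes : tailPaths j (node n G ts).oplusNodes = (ts j).oplusNodes :=
  Set.ext fun p => cons_mem_oplusNodes G ts j p

theorem tailPaths_ominusNodes : tailPaths j (node n G ts).ominusNodes = (ts j).ominusNodes :=
  Set.ext fun p => cons_mem_ominusNodes G ts j p

end Tails

theorem oplusNodes_leaf (a : ℕ) : (leaf a).oplusNodes = ∅ := by
  ext p
  simp only [oplusNodes, Set.mem_ofPred_eq, Set.mem_empty_iff_false, iff_false]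
  rintro ⟨s, h, hs⟩
  cases p <;> cases h
  exact hs

theorem ominusNodes_leaf (a : ℕ) : (leaf a).ominusNodes = ∅ := by
  ext p
  simp only [ominusNodes, Set.mem_ofPred_eq, Set.mem_empty_iff_false, iff_false]
  rintro ⟨s, h, hs⟩
  cases p <;> cases h
  exact hs

theorem nil_mem_leafNodes_leaf (a : ℕ) : [] ∈ (leaf a).leafNodes := ⟨a, rfl⟩

theorem nil_notMem_leafNodes_node {n : ℕ} (G : SimpleGraph (Fin (n + 2)))
    (ts : Fin (n + 2) → STree) : [] ∉ (node n G ts).leafNodes := by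
  rintro ⟨a, h⟩
  rw [subtreeAt_nil] at h
  cases h

end STree

theorem tailPaths_diff (i : ℕ) (A B : Set (List ℕ)) :
    tailPaths i (A \ B) = tailPaths i A \ tailPaths i B := rfl

theorem numEdges_empty_left (B : Set (List ℕ)) : numEdges ∅ B = 0 := by
  simp [numEdges]

/-! ### The closed form -/

/-- `Occ_{G,P}(T)`, for a graph `G` bundled with its size. -/
def decSeries (P : ∀ n : ℕ, Set (SimpleGraph (Fin n))) (d : Σ k : ℕ, SimpleGraph (Fin k)) :
    ℚ⟦X⟧ :=
  (occSeries P d.2).subst (serT P)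

/-- The series of the trees inducing a given tree, without the factor of the root, in closed
form. -/
def closedSeries (P : ∀ n : ℕ, Set (SimpleGraph (Fin n))) (τ : STree) (N : Finset (List ℕ)) :
    ℚ⟦X⟧ :=
  PowerSeries.X ^ τ.size *
    serTnotOplusOplus P ^ numEdges (τ.oplusNodes \ N) (τ.oplusNodes \ N) *
    serTnotOplusOplus P ^ numEdges (τ.ominusNodes \ N) (τ.ominusNodes \ N) *
    serTnotOplusOminus P ^ numEdges (τ.oplusNodes \ N) (τ.ominusNodes \ N) *
    serTnotOplusOminus P ^ numEdges (τ.ominusNodes \ N) (τ.oplusNodes \ N) *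
    serTnotOplusBlo P ^ numEdges (τ.internalNodes \ N) N *
    PowerSeries.derivative ℚ (serTnotOplus P) ^ numEdges (τ.internalNodes \ N) τ.leafNodes *
    (1 + serT P) ^ (τ.internalNodes \ N).ncard *
    serToplus P ^ numEdges N (τ.internalNodes \ N) *
    serTblo P ^ numEdges N N *
    PowerSeries.derivative ℚ (serT P) ^ numEdges N τ.leafNodes *
    ∏ p ∈ N, decSeries P (τ.dec p)

/-- Exactly one of the nine conditions holds for an edge, according to its two ends (in `N`, linear
⊕, linear ⊖, or a leaf), so a single factor differs from 1. -/
theorem edgeFactor_eq_prod {n : ℕ} (G : SimpleGraph (Fin (n + 2))) (ts : Fin (n + 2) → STree)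
    (N : Set (List ℕ)) (hG : [] ∉ N → G = ⊤ ∨ G = ⊥) (s : STree) (N' : Set (List ℕ))
    (hs : s.nonlinearNodes ⊆ N') (hN' : N' ⊆ s.internalNodes) :
    edgeFactor P G N s N' =
      factorIf ([] ∈ (node n G ts).oplusNodes \ N ∧ [] ∈ s.oplusNodes \ N') (serTnotOplusOplus P) *
      factorIf ([] ∈ (node n G ts).ominusNodes \ N ∧ [] ∈ s.ominusNodes \ N')
        (serTnotOplusOplus P) *
      factorIf ([] ∈ (node n G ts).oplusNodes \ N ∧ [] ∈ s.ominusNodes \ N')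
        (serTnotOplusOminus P) *
      factorIf ([] ∈ (node n G ts).ominusNodes \ N ∧ [] ∈ s.oplusNodes \ N')
        (serTnotOplusOminus P) *
      factorIf ([] ∈ (node n G ts).internalNodes \ N ∧ [] ∈ N') (serTnotOplusBlo P) *
      factorIf ([] ∈ (node n G ts).internalNodes \ N ∧ [] ∈ s.leafNodes)
        (PowerSeries.derivative ℚ (serTnotOplus P)) *
      factorIf ([] ∈ N ∧ [] ∈ s.internalNodes \ N') (serToplus P) *
      factorIf ([] ∈ N ∧ [] ∈ N') (serTblo P) *
      factorIf ([] ∈ N ∧ [] ∈ s.leafNodes) (PowerSeries.derivative ℚ (serT P)) := by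
  cases s with
  | leaf a =>
    have h : [] ∉ N' := fun h => by simpa [internalNodes_leaf] using hN' h
    by_cases hN : [] ∈ N
    · simp [edgeFactor, factorIf, rootFactor, hN, h, internalNodes_leaf, nil_mem_leafNodes_leaf]
    · simp [edgeFactor, factorIf, linearFactor, hN, h, internalNodes_leaf, nil_mem_leafNodes_leaf,
        oplusNodes_leaf, ominusNodes_leaf, nil_mem_internalNodes]
  | node k H us =>
    have hH : [] ∉ N' → H = ⊤ ∨ H = ⊥ := fun h => by
      by_contra hH
      exact h (hs ((nil_mem_nonlinearNodes H us).2 hH))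
    by_cases hN : [] ∈ N <;> by_cases h' : [] ∈ N'
    · simp [edgeFactor, factorIf, rootFactor_node, hN, h', nil_notMem_leafNodes_node]
    · simp [edgeFactor, factorIf, rootFactor_node, hN, h', nil_notMem_leafNodes_node,
        nil_mem_internalNodes]
    · simp [edgeFactor, factorIf, linearFactor_node, hN, h', nil_notMem_leafNodes_node,
        nil_mem_internalNodes]
    · rcases hG hN with rfl | rfl <;> rcases hH h' with rfl | rfl <;>
        simp [edgeFactor, factorIf, linearFactor_node, hN, h', nil_notMem_leafNodes_node,
          nil_mem_oplusNodes, nil_mem_ominusNodes, (top_ne_bot_fin _).symm]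

/-- All exponents are additive over the root, its outgoing edges and its children, so both sides
satisfy the same recursion. -/
theorem coreSeries_eq_closedSeries (τ : STree) (N : Finset (List ℕ))
    (hN : (N : Set (List ℕ)) ⊆ τ.internalNodes) (hnonlin : τ.nonlinearNodes ⊆ N) :
    coreSeries P τ N = closedSeries P τ N := by
  classical
  induction τ generalizing N with
  | leaf a =>
    obtain rfl : N = ∅ := by
      rw [internalNodes_leaf] at hN
      exact_mod_cast Set.subset_empty_iff.1 hN
    simp [coreSeries, closedSeries, internalNodes_leaf, oplusNodes_leaf, ominusNodes_leaf,
      numEdges_empty_left, size]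
  | node n G ts ih =>
    have hN' : ∀ j : Fin (n + 2),
        (tailFinset j N : Set (List ℕ)) ⊆ (ts j).internalNodes := fun j p hp =>
      (cons_mem_internalNodes G ts j p).1 (hN (mem_tailFinset.1 hp))
    have hnl : ∀ j : Fin (n + 2), (ts j).nonlinearNodes ⊆ tailFinset j N := fun j p hp =>
      mem_tailFinset.2 (hnonlin ((cons_mem_nonlinearNodes G ts j p).2 hp))
    have hG : [] ∉ (N : Set (List ℕ)) → G = ⊤ ∨ G = ⊥ := fun h => by
      by_contra hG
      exact h (hnonlin ((nil_mem_nonlinearNodes G ts).2 hG))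
    have hcore : coreSeries P (node n G ts) N =
        factorIf ([] ∈ (node n G ts).internalNodes \ (N : Set (List ℕ))) (1 + serT P) *
          (if [] ∈ N then decSeries P ((node n G ts).dec []) else 1) *
          ∏ j, edgeFactor P G N (ts j) (tailPaths j N) * coreSeries P (ts j) (tailPaths j N) := by
      rw [coreSeries_node]
      congr 1
      by_cases h : [] ∈ N
      · simp only [Finset.mem_coe, h, if_true, Set.mem_sdiff, not_true_eq_false, and_false]
        rw [factorIf_neg not_false, one_mul]
        rfl
      · simp [h, nil_mem_internalNodes, factorIf]
    set τ := node n G ts with hτ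
    have key : ∀ {A B : Set (List ℕ)}, B ⊆ τ.nodes → ∀ x : ℚ⟦X⟧, x ^ numEdges A B =
        ∏ j : Fin (n + 2), factorIf ([] ∈ A ∧ [] ∈ tailPaths j B) x *
          x ^ numEdges (tailPaths j A) (tailPaths j B) := fun hB x =>
      pow_numEdges_eq_prod _ (τ.finite_nodes.subset hB)
        (fun i p hp => lt_of_cons_mem_nodes (hB hp)) x
    have hp := τ.oplusNodes_subset_nodes
    have hm := τ.ominusNodes_subset_nodes
    have hi := τ.internalNodes_subset_nodes
    have hl := τ.leafNodes_subset_nodes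
    have hd : ∀ {A : Set (List ℕ)}, A ⊆ τ.nodes → A \ N ⊆ τ.nodes := fun h =>
      Set.sdiff_subset.trans h
    rw [closedSeries, key (hd hp), key (hd hm), key (hd hm), key (hd hp), key (hN.trans hi),
      key hl, pow_ncard_eq_prod (m := n + 2) (τ.finite_nodes.subset (hd hi))
        (fun i p hp => lt_of_cons_mem_nodes (hd hi hp)), key (hd hi), key (hN.trans hi), key hl,
      prod_eq_prod_tailFinset (m := n + 2) fun i p hp =>
        lt_of_cons_mem_internalNodes G ts (hN (Finset.mem_coe.2 hp)), hτ, hcore]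
    simp only [tailPaths_diff, tailPaths_internalNodes, tailPaths_leafNodes, tailPaths_oplusNodes,
      tailPaths_ominusNodes, ← coe_tailFinset, dec_cons, size, ← Finset.prod_pow_eq_pow_sum]
    simp only [ih _ _ (hN' _) (hnl _), closedSeries, Finset.prod_mul_distrib,
      edgeFactor_eq_prod G ts N hG _ _ (hnl _) (hN' _)]
    ring

end

end ModDec

/-! ### The closed formula -/

open ModDec in
theorem mainTheorem5 (P : ∀ n : ℕ, Set (SimpleGraph (Fin n)))
    (hprime : ∀ (n : ℕ) (G : SimpleGraph (Fin n)), G ∈ P n → IsPrime G)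
    (hstable : StableByRelabeling P)
    (τ : STree) (hτ : τ.IsSubstitutionTree) (hsize : 2 ≤ τ.size)
    (N : Finset (List ℕ)) (hN : (N : Set (List ℕ)) ⊆ τ.internalNodes)
    (hnonlin : τ.nonlinearNodes ⊆ (N : Set (List ℕ))) :
    serTtau P τ N =
      (PowerSeries.X : ℚ⟦X⟧) ^ τ.size
        * (if ([] : List ℕ) ∈ N then serTblo P else serToplus P)
        * serTnotOplusOplus P ^
            (numEdges (τ.oplusNodes \ N) (τ.oplusNodes \ N)
              + numEdges (τ.ominusNodes \ N) (τ.ominusNodes \ N))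
        * serTnotOplusOminus P ^
            (numEdges (τ.oplusNodes \ N) (τ.ominusNodes \ N)
              + numEdges (τ.ominusNodes \ N) (τ.oplusNodes \ N))
        * serTnotOplusBlo P ^ numEdges (τ.internalNodes \ N) N
        * (PowerSeries.derivative ℚ (serTnotOplus P)) ^ numEdges (τ.internalNodes \ N) τ.leafNodes
        * (PowerSeries.exp ℚ).subst (((τ.internalNodes \ N).ncard : ℚ) • serTnotOplus P)
        * serToplus P ^ numEdges N (τ.internalNodes \ N)
        * serTblo P ^ numEdges N N
        * (PowerSeries.derivative ℚ (serT P)) ^ numEdges N τ.leafNodes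
        * ∏ p ∈ N, (occSeries P (τ.dec p).2).subst (serT P) := by
  rw [serTtau_eq_weightSeries P hτ.1 hsize hN,
    (weightSeries_markingWeight hprime hstable τ N hnonlin).1,
    coreSeries_eq_closedSeries τ N hN hnonlin, exp_subst_smul_serTnotOplus, closedSeries]
  simp only [decSeries]
  cases τ with
  -- The bound on the size excludes a leaf, whose root factor would be T′ instead of T^root.
  | leaf a => simp [STree.size] at hsize
  | node n G ts =>
    have h : rootFactor P (.node n G ts) N = if [] ∈ N then serTblo P else serToplus P := by
      rw [rootFactor_node]
      congr 1
    rw [h]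
    ring
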